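/- **Proposition (variance of the finest level $L$ of the multilevel double-loop quasi-Monte Carlo estimator with inexact sampling).** *Setting.* Let $d_1,d_2\ge 1$, let $U\subseteq\mathbb R$ be an open interval, $f\in C^2(U)$, and let $g$ and $g_h$ (the approximation of $g$ with discretization parameter $h$; only $h=h_\ell$ with $0\le\ell\le L$ is used) be measurable functions of $(\boldsymbol y,\boldsymbol x)$ with values in $U$ for $\boldsymbol y\in(0,1)^{d_1}$, $\boldsymbol x\in[0,1]^{d_2}$, such that $\bar g(\boldsymbol y)=\int_{[0,1]^{d_2}}g(\boldsymbol y,\boldsymbol x)\,d\boldsymbol x$ and $\bar g_{h}(\boldsymbol y)=\int_{[0,1]^{d_2}}g_{h}(\boldsymbol y,\boldsymbol x)\,d\boldsymbol x$ exist for all $\boldsymbol y\in(0,1)^{d_1}$. Let $L,N_L,M_0\ge1$ be integers, $h_0>0$, $M_\ell=M_02^\ell$, $h_\ell=h_02^{-\ell}$. Let $\boldsymbol u^{(1)},\boldsymbol u^{(2)},\dots$ and $\boldsymbol t^{(1)},\boldsymbol t^{(2)},\dots$ be Sobol' sequences in dimensions $d_1$ and $d_2$, let $\boldsymbol\tau,\boldsymbol\rho$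 be independent Owen (nested uniform, base 2) scramblings, and put $\boldsymbol y^{(n)}=\boldsymbol\tau(\boldsymbol u^{(n)})$. For points $\boldsymbol x=(\boldsymbol x^{(m)})_m$ write $G_\ell^{\boldsymbol x}(\boldsymbol y)=\frac1{M_\ell}\sum_{m=1}^{M_\ell}g_{h_\ell}(\boldsymbol y,\boldsymbol x^{(m)})$. The difference on level $L$ is $$\Delta_L=\frac1{N_L}\sum_{n=1}^{N_L}\Big[f\big(G_L^{\boldsymbol\rho(\boldsymbol t)}(\boldsymbol y^{(n)})\big)-f\big(G_{L-1}^{\boldsymbol t}(\boldsymbol y^{(n)})\big)\Big].$$ *Auxiliary functions.* For $c,a:(0,1)^{d_1}\to U$ put $$\Lambda[c,a]=f'(c)\,(a-c),\qquad R[c,a]=(a-c)^2\int_0^1 f''(c+s(a-c))(1-s)\,ds,$$ and let $\varphi^{(I)}_{\ell,\boldsymbol x}=\Lambda[\bar g,G_\ell^{\boldsymbol x}]$, $\varphi^{(II)}_{\ell,\boldsymbol x}=R[\bar g,G_\ell^{\boldsymbol x}]$, $\varphi^{(III)}_{\boldsymbol x}=\Lambda[\bar g_{h_L},G_L^{\boldsymbol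 x}]$, $\varphi^{(IV)}_{\boldsymbol x}=R[\bar g_{h_L},G_L^{\boldsymbol x}]$. *Assumptions.* Let $\epsilon,\eta_s,C_{\epsilon,d_2},C_{\eta_s},\tilde b^{(I)},\dots,\tilde b^{(IV)}>0$ and let $A^{(I)},\dots,A^{(IV)}\in\mathbb R^{d_1}$ have largest entries $A^{(J)}_{\max}=\max_iA^{(J)}_i$ with $0<A^{(I)}_{\max},A^{(II)}_{\max}<\frac12$ and $0<A^{(III)}_{\max},A^{(IV)}_{\max}<1$. Write $w_{A,u}(\boldsymbol y)=\prod_{i=1}^{d_1}\min(y_i,1-y_i)^{-A_i-\mathbb 1_{\{i\in u\}}}$. Assume that for $(\ell,\boldsymbol x)=(L-1,\boldsymbol t)$, and almost surely for $(\ell,\boldsymbol x)=(L,\boldsymbol\rho(\boldsymbol t))$, the mixed partial derivatives $\partial^u$ ($u\subseteq\{1,\dots,d_1\}$, at most one derivative in each variable) of $\varphi^{(I)}_{\ell,\boldsymbol x}$ and $\varphi^{(II)}_{\ell,\boldsymbol x}$ exist, are continuous on $(0,1)^{d_1}$ and satisfy there $$|\partial^u\varphi^{(I)}_{\ell,\boldsymbol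 x}|\le\big(C_{\epsilon,d_2}M_\ell^{-1+\epsilon}+C_{\eta_s}h_\ell^{\eta_s}\big)\tilde b^{(I)}w_{A^{(I)},u},\qquad |\partial^u\varphi^{(II)}_{\ell,\boldsymbol x}|\le\big(C_{\epsilon,d_2}^2M_\ell^{-2+2\epsilon}+C_{\eta_s}^2h_\ell^{2\eta_s}\big)\tilde b^{(II)}w_{A^{(II)},u};$$ and that almost surely, for $\boldsymbol x=\boldsymbol\rho(\boldsymbol t)$, on $(0,1)^{d_1}$, $$|\varphi^{(III)}_{\boldsymbol x}|\le C_{\epsilon,d_2}M_L^{-1+\epsilon}\,\tilde b^{(III)}w_{A^{(III)},\emptyset},\qquad |\varphi^{(IV)}_{\boldsymbol x}|\le C_{\epsilon,d_2}^2M_L^{-2+2\epsilon}\,\tilde b^{(IV)}w_{A^{(IV)},\emptyset}.$$ *Conclusion.* There are constants $C_{\epsilon,d_1}>0$ and $B_A>0$, depending only on $\epsilon$ and on $A$, respectively (and on $d_1$ and the outer Sobol' sequence), such that in every such setting $\Delta_L$ is square integrable and $$\begin{aligned}\mathbb V[\Delta_L]\le{}&\frac{\big(C_{\epsilon,d_2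}^2M_L^{-2+2\epsilon}+C_{\eta_s}^2h_L^{2\eta_s}\big)(b^{(I)})^2B_{A^{(I)}}^2C_{\epsilon,d_1}^2}{N_L^{2-2\epsilon-2A^{(I)}_{\max}}}+\frac{\big(C_{\epsilon,d_2}^4M_L^{-4+4\epsilon}+C_{\eta_s}^4h_L^{4\eta_s}\big)(b^{(II)})^2B_{A^{(II)}}^2C_{\epsilon,d_1}^2}{N_L^{2-2\epsilon-2A^{(II)}_{\max}}}\\&+\frac{C_{\epsilon,d_2}^2(b^{(III)})^2B_{A^{(III)}}^2}{M_L^{2-2\epsilon}}+\frac{C_{\epsilon,d_2}^4(b^{(IV)})^2B_{A^{(IV)}}^2}{M_L^{4-4\epsilon}},\end{aligned}$$ where $(b^{(I)})^2=8\big(\max\{2^{2-2\epsilon},2^{2\eta_s}\}+1\big)(\tilde b^{(I)})^2$, $(b^{(II)})^2=8\big(\max\{2^{4-4\epsilon},2^{4\eta_s}\}+1\big)(\tilde b^{(II)})^2$, $(b^{(III)})^2=2(\tilde b^{(III)})^2$, $(b^{(IV)})^2=2(\tilde b^{(IV)})^2$. The constants may be chosen with $C_{\epsilon,d_1}\to\infty$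 as $\epsilon\to0^+$ and $B_A\to\infty$ as $\min_iA_i\to0^+$. -/

import Mathlib

open MeasureTheory ProbabilityTheory Filter Topology

noncomputable section

/-! ### Sobol' sequences -/

/-- A polynomial over the field with two elements is primitive (in the sense of finite fields) if it
is irreducible and its root generates the multiplicative group of the extension it defines. -/
def IsPrimitivePolynomial (p : Polynomial (ZMod 2)) : Prop :=
  Irreducible p ∧ orderOf (AdjoinRoot.root p) = 2 ^ p.natDegree - 1

/-- The data of a `d`-dimensional Sobol' sequence. `bit j i k` is the binary digit of index `i`
(that is, the coefficient of `2 ^ (-(i + 1))`) of the direction number of index `k` (counted from 0)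
of the coordinate `j`. -/
structure SobolData (d : ℕ) where
  /-- the polynomial attached to each coordinate -/
  poly : Fin d → Polynomial (ZMod 2)
  /-- the binary digits of the direction numbers -/
  bit : Fin d → ℕ → ℕ → ZMod 2
  /-- the first coordinate (van der Corput) belongs to the polynomial `X` ... -/
  poly_first : ∀ j : Fin d, j.val = 0 → poly j = Polynomial.X
  /-- ... and the other ones to primitive polynomials ... -/
  poly_primitive : ∀ j : Fin d, j.val ≠ 0 → IsPrimitivePolynomial (poly j)
  /-- ... that are pairwise different. -/
  poly_injective : Function.Injective poly
  /-- The initial direction numbers are `m / 2 ^ (k + 1)` with `m` odd and `m < 2 ^ (k + 1)`. -/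
  bit_diag : ∀ j k, k < (poly j).natDegree → bit j k k = 1
  bit_below : ∀ j i k, k < (poly j).natDegree → k < i → bit j i k = 0
  /-- The recurrence of the direction numbers: with `p = X ^ e + a₁ X ^ (e - 1) + ... + a_e`, this is
  `v_{k + e} = a₁ v_{k + e - 1} ⊕ ... ⊕ a_e v_k ⊕ (v_k >> e)`, digit by digit. -/
  bit_rec : ∀ j i k,
    ∑ l ∈ Finset.range ((poly j).natDegree + 1), (poly j).coeff l * bit j i (k + l) =
      if (poly j).natDegree ≤ i then bit j (i - (poly j).natDegree) k else 0

/-- The binary digits of the point of index `n` (counted from 0) of a Sobol' sequence: the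
exclusive or of the direction numbers selected by the binary digits of `n` (all of which have an
index below `n`, as `n < 2 ^ n`). -/
def SobolData.digits {d : ℕ} (S : SobolData d) (n : ℕ) (j : Fin d) (i : ℕ) : Bool :=
  decide ((∑ k ∈ Finset.range n, if n.testBit k then S.bit j i k else 0) = 1)

/-- The point of `[0,1]^d` with the given binary digits. -/
def pointOfDigits {d : ℕ} (x : Fin d → ℕ → Bool) : Fin d → ℝ :=
  fun j => ∑' i : ℕ, if x j i then ((1 : ℝ) / 2) ^ (i + 1) else 0

/-- The point of index `n` (counted from 0) of a Sobol' sequence. -/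
def SobolData.point {d : ℕ} (S : SobolData d) (n : ℕ) : Fin d → ℝ :=
  pointOfDigits (S.digits n)

/-! ### Owen's scrambling -/

/-- Nested scrambling in base 2: the digit of index `i` of the coordinate `j` is flipped or not,
according to a bit that depends on `j` and on the preceding digits of that coordinate. -/
def scrambleDigits {d : ℕ} (b : Fin d × List Bool → Bool) (x : Fin d → ℕ → Bool) :
    Fin d → ℕ → Bool :=
  fun j i => xor (x j i) (b (j, (List.range i).map (x j)))

/-- The point of index `n` of the scrambled Sobol' sequence. -/
def SobolData.scrambled {d : ℕ} (S : SobolData d) (b : Fin d × List Bool → Bool) (n : ℕ) :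
    Fin d → ℝ :=
  pointOfDigits (scrambleDigits b (S.digits n))

/-- Independent fair random bits. As the two permutations of `{0, 1}` are the identity and the flip,
scrambling with such bits is Owen's (nested uniform) scrambling. -/
def IsFairBits {Ω ι : Type*} [MeasurableSpace Ω] (ξ : ι → Ω → Bool) (P : Measure Ω) : Prop :=
  (∀ i, Measurable (ξ i)) ∧ (∀ i, P {ω | ξ i ω = true} = 1 / 2) ∧ iIndepFun ξ P

/-! ### The estimator -/

/-- `(1/M) ∑_{m=1}^M g(y, x⁽ᵐ⁾)`, with the points numbered from 0. -/
def innerMean {d₁ d₂ : ℕ} (g : (Fin d₁ → ℝ) → (Fin d₂ → ℝ) → ℝ) (M : ℕ) (x : ℕ → Fin d₂ → ℝ)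
    (y : Fin d₁ → ℝ) : ℝ :=
  (1 / (M : ℝ)) * ∑ m ∈ Finset.range M, g y (x m)

/-- `(1/N) ∑_{n=1}^N f((1/M) ∑_{m=1}^M g(y⁽ⁿ⁾, x⁽ᵐ⁾))`, with the points numbered from 0. -/
def doubleLoop {d₁ d₂ : ℕ} (f : ℝ → ℝ) (g : (Fin d₁ → ℝ) → (Fin d₂ → ℝ) → ℝ) (N M : ℕ)
    (y : ℕ → Fin d₁ → ℝ) (x : ℕ → Fin d₂ → ℝ) : ℝ :=
  (1 / (N : ℝ)) * ∑ n ∈ Finset.range N, f (innerMean g M x (y n))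

/-- The inner integral of `g(y, ·)` over `[0,1]^{d₂}`. -/
def innerIntegral {d₁ d₂ : ℕ} (g : (Fin d₁ → ℝ) → (Fin d₂ → ℝ) → ℝ) (y : Fin d₁ → ℝ) : ℝ :=
  ∫ x in Set.Icc (0 : Fin d₂ → ℝ) 1, g y x

/-- Number of inner samples on level `ℓ`. -/
def levelM (M₀ ℓ : ℕ) : ℕ := M₀ * 2 ^ ℓ

/-- Discretization parameter on level `ℓ`. -/
def levelH (h₀ : ℝ) (ℓ : ℕ) : ℝ := h₀ / 2 ^ ℓ

/-- The difference on the finest level `L` of the multilevel double-loop estimator with one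
randomization: scrambled inner points for the fine term, the Sobol' points themselves for the
coarse term, and the same scrambled outer points in both terms. -/
def finestDifference {d₁ d₂ : ℕ} (S₁ : SobolData d₁) (S₂ : SobolData d₂) (f : ℝ → ℝ)
    (gh : ℝ → (Fin d₁ → ℝ) → (Fin d₂ → ℝ) → ℝ) (L N M₀ : ℕ) (h₀ : ℝ)
    (τ : Fin d₁ × List Bool → Bool) (ρ : Fin d₂ × List Bool → Bool) : ℝ :=
  doubleLoop f (gh (levelH h₀ L)) N (levelM M₀ L) (S₁.scrambled τ) (S₂.scrambled ρ) -
    doubleLoop f (gh (levelH h₀ (L - 1))) N (levelM M₀ (L - 1)) (S₁.scrambled τ) S₂.point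

/-! ### The auxiliary functions and the boundary growth condition -/

/-- `f'(c(y)) (a(y) - c(y))`. -/
def linearPart {d : ℕ} (f : ℝ → ℝ) (c a : (Fin d → ℝ) → ℝ) (y : Fin d → ℝ) : ℝ :=
  deriv f (c y) * (a y - c y)

/-- `(a(y) - c(y))² ∫₀¹ f''(c(y) + s (a(y) - c(y))) (1 - s) ds`. -/
def remainderPart {d : ℕ} (f : ℝ → ℝ) (c a : (Fin d → ℝ) → ℝ) (y : Fin d → ℝ) : ℝ :=
  (a y - c y) ^ 2 * ∫ s in (0 : ℝ)..1, deriv (deriv f) (c y + s * (a y - c y)) * (1 - s)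

/-- The open unit cube. -/
def openCube (d : ℕ) : Set (Fin d → ℝ) := {y | ∀ i, 0 < y i ∧ y i < 1}

/-- `∏ᵢ min(yᵢ, 1 - yᵢ) ^ (- Aᵢ - 1_{i ∈ u})`. -/
def edgeWeight {d : ℕ} (A : Fin d → ℝ) (u : Finset (Fin d)) (y : Fin d → ℝ) : ℝ :=
  ∏ i, min (y i) (1 - y i) ^ (-A i - if i ∈ u then (1 : ℝ) else 0)

/-- The boundary growth condition with constant `K` and exponents `A`: on the open cube, the mixed
partial derivatives `∂ u` of `φ`, at most once in each variable, exist and are continuous, and they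
are bounded by `K * edgeWeight A u`. -/
def BoundaryGrowth {d : ℕ} (φ : (Fin d → ℝ) → ℝ) (K : ℝ) (A : Fin d → ℝ) : Prop :=
  ∃ D : Finset (Fin d) → (Fin d → ℝ) → ℝ,
    (∀ y ∈ openCube d, D ∅ y = φ y) ∧
    (∀ u, ContinuousOn (D u) (openCube d)) ∧
    (∀ u, ∀ i ∉ u, ∀ y ∈ openCube d,
      HasDerivAt (fun s => D u (Function.update y i s)) (D (insert i u) y) (y i)) ∧
    (∀ u, ∀ y ∈ openCube d, |D u y| ≤ K * edgeWeight A u y)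

/-- The growth bound for the function alone, without derivatives. -/
def ValueGrowth {d : ℕ} (φ : (Fin d → ℝ) → ℝ) (K : ℝ) (A : Fin d → ℝ) : Prop :=
  ∀ y ∈ openCube d, |φ y| ≤ K * edgeWeight A ∅ y

/-- The largest exponent. -/
def maxExp {d : ℕ} (A : Fin d → ℝ) : ℝ := ⨆ i, A i

/-- The growth assumption on the first auxiliary function `φ^(I)`, for the approximation `G` of `g`
with discretization parameter `h` and for the first `M` of the inner points `x`. -/
def GrowthI {d₁ d₂ : ℕ} (f : ℝ → ℝ) (g G : (Fin d₁ → ℝ) → (Fin d₂ → ℝ) → ℝ) (h : ℝ) (M : ℕ)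
    (x : ℕ → Fin d₂ → ℝ) (ε C₂ η Cη b : ℝ) (A : Fin d₁ → ℝ) : Prop :=
  BoundaryGrowth (linearPart f (innerIntegral g) (innerMean G M x))
    ((C₂ * (M : ℝ) ^ (-1 + ε) + Cη * h ^ η) * b) A

/-- The growth assumption on the second auxiliary function `φ^(II)`. -/
def GrowthII {d₁ d₂ : ℕ} (f : ℝ → ℝ) (g G : (Fin d₁ → ℝ) → (Fin d₂ → ℝ) → ℝ) (h : ℝ) (M : ℕ)
    (x : ℕ → Fin d₂ → ℝ) (ε C₂ η Cη b : ℝ) (A : Fin d₁ → ℝ) : Prop :=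
  BoundaryGrowth (remainderPart f (innerIntegral g) (innerMean G M x))
    ((C₂ ^ 2 * (M : ℝ) ^ (-2 + 2 * ε) + Cη ^ 2 * h ^ (2 * η)) * b) A

/-- The growth assumption on the third auxiliary function `φ^(III)`, which is centred at the inner
integral of the approximation `G` itself. -/
def GrowthIII {d₁ d₂ : ℕ} (f : ℝ → ℝ) (G : (Fin d₁ → ℝ) → (Fin d₂ → ℝ) → ℝ) (M : ℕ)
    (x : ℕ → Fin d₂ → ℝ) (ε C₂ b : ℝ) (A : Fin d₁ → ℝ) : Prop :=
  ValueGrowth (linearPart f (innerIntegral G) (innerMean G M x))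
    (C₂ * (M : ℝ) ^ (-1 + ε) * b) A

/-- The growth assumption on the fourth auxiliary function `φ^(IV)`. -/
def GrowthIV {d₁ d₂ : ℕ} (f : ℝ → ℝ) (G : (Fin d₁ → ℝ) → (Fin d₂ → ℝ) → ℝ) (M : ℕ)
    (x : ℕ → Fin d₂ → ℝ) (ε C₂ b : ℝ) (A : Fin d₁ → ℝ) : Prop :=
  ValueGrowth (remainderPart f (innerIntegral G) (innerMean G M x))
    (C₂ ^ 2 * (M : ℝ) ^ (-2 + 2 * ε) * b) A

/-- What is taken for granted of an inner integrand: it is measurable, it takes its values in the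
domain `U` of the outer function, and its inner integral exists. -/
def AdmissibleIntegrand {d₁ d₂ : ℕ} (U : Set ℝ) (G : (Fin d₁ → ℝ) → (Fin d₂ → ℝ) → ℝ) : Prop :=
  Measurable (Function.uncurry G) ∧
    (∀ y ∈ openCube d₁, ∀ x ∈ Set.Icc (0 : Fin d₂ → ℝ) 1, G y x ∈ U) ∧
    ∀ y ∈ openCube d₁, IntegrableOn (G y) (Set.Icc 0 1)

end

/-! Taylor's formula around the inner integral of `g` writes the integrand of the level difference
as `φ^(I) + φ^(II)` on level `L` minus `φ^(I) + φ^(II)` on level `L - 1`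
(`taylor_linearPart_remainderPart`). For a fixed inner scrambling these are four fixed functions of
`y` with boundary growth, and the outer scrambled points average each of them with a small mean
square error. The resulting conditional mean still depends on the inner scrambling. It is compared
with its value at one fixed good scrambling: the coarse term cancels, and `φ^(III) + φ^(IV)`, used
for both scramblings, bounds what is left. Since the variance is at most the mean square distance to
any constant, these two contributions give the claim (`variance_finest_le`).

The core is `eLpNorm_error_le`: for growth exponent `a < 1/2`, the root mean square error of `N`
scrambled Sobol' points is of order `N ^ (a + ε - 1)`, up to constants in which `a` and `ε` are
separated. It rests on three facts.

(1) Equidistribution. The rows of the generating matrices are sequences on which polynomials over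
the field with two elements act by shifts. Pairwise coprimality of the Sobol' polynomials makes the
leading rows jointly independent, with a defect `quality`.

(2) Cancellation. A function of finitely many digits is a sum of Haar type components of levels `κ`.
Over a dyadic block of `2 ^ k` points, a nonconstant component with `∑ κ j + quality ≤ k` sums to
zero for every scrambling. For the other components only boundedly many points are correlated with a
given one, so that the second moment of the sum is at most a constant times `2 ^ k` times the second
moment of the component.

(3) Decay. A component of level `κ` is controlled by a mixed difference. Boundary growth bounds it
by a product of one-dimensional terms, whose mean square is of order `(4 ^ a / 2) ^ (∑ κ j)`.

Summing over levels treats dyadic blocks, the binary expansion of `N` treats all `N`, and Fatou's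
lemma passes from functions on dyadic grids to functions on the open cube. -/

/-! ### Equidistribution of Sobol' sequences -/

section Shift

open Polynomial

/-- The shift of binary sequences. -/
noncomputable def seqShift : Module.End (ZMod 2) (ℕ → ZMod 2) := LinearMap.funLeft (ZMod 2) (ZMod 2) Nat.succ

theorem seqShift_pow_apply (l : ℕ) (s : ℕ → ZMod 2) (k : ℕ) : (seqShift ^ l) s k = s (k + l) := by
  induction l generalizing k with
  | zero => simp
  | succ l ih =>
    rw [pow_succ', Module.End.mul_apply, seqShift, LinearMap.funLeft_apply, ← seqShift, ih]
    congr 1; omega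

theorem aeval_seqShift_apply (p : (ZMod 2)[X]) (s : ℕ → ZMod 2) (k : ℕ) :
    aeval seqShift p s k = ∑ l ∈ Finset.range (p.natDegree + 1), p.coeff l * s (k + l) := by
  rw [aeval_eq_sum_range, LinearMap.sum_apply, Finset.sum_apply]
  simp [seqShift_pow_apply]

/-- A polynomial in the shift that kills `s` is a linear recurrence with nonzero leading
coefficient, so the first `natDegree` terms determine `s`. -/
theorem eq_zero_of_aeval_seqShift_eq_zero {p : (ZMod 2)[X]} (hp : p ≠ 0) {s : ℕ → ZMod 2}
    (hs : aeval seqShift p s = 0) (h0 : ∀ k < p.natDegree, s k = 0) : s = 0 := by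
  funext k
  induction k using Nat.strong_induction_on with
  | _ k ih =>
    by_cases hk : k < p.natDegree
    · exact h0 k hk
    · have h := congrFun hs (k - p.natDegree)
      rw [aeval_seqShift_apply, Finset.sum_range_succ, Finset.sum_eq_zero] at h
      · have h2 : k - p.natDegree + p.natDegree = k := by omega
        rw [h2, zero_add] at h
        exact (mul_eq_zero.1 h).resolve_left (by simpa using hp)
      · intro l hl
        rw [ih _ (by have := Finset.mem_range.1 hl; omega)]
        simp

end Shift

namespace SobolData

open Polynomial

variable {d : ℕ} (S : SobolData d)

theorem irreducible_poly (j : Fin d) : Irreducible (S.poly j) := by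
  by_cases h : j.val = 0
  · rw [S.poly_first j h]; exact irreducible_X
  · exact (S.poly_primitive j h).1

theorem natDegree_poly_pos (j : Fin d) : 0 < (S.poly j).natDegree :=
  (S.irreducible_poly j).natDegree_pos

theorem monic_of_ne_zero {p : (ZMod 2)[X]} (hp : p ≠ 0) : p.Monic := by
  have h : ∀ a : ZMod 2, a ≠ 0 → a = 1 := by decide
  exact h _ (leadingCoeff_ne_zero.2 hp)

theorem isCoprime_poly {i j : Fin d} (h : i ≠ j) : IsCoprime (S.poly i) (S.poly j) := by
  rw [(S.irreducible_poly i).coprime_iff_not_dvd]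
  intro hd
  have := (S.irreducible_poly i).associated_of_dvd (S.irreducible_poly j) hd
  exact h (S.poly_injective (eq_of_monic_of_associated
    (monic_of_ne_zero (S.irreducible_poly i).ne_zero)
    (monic_of_ne_zero (S.irreducible_poly j).ne_zero) this))

/-- This is the recurrence of the direction numbers read by rows: the polynomial of the coordinate,
evaluated at the shift, lowers the row index by the degree and kills the rows below it. -/
theorem aeval_bit (j : Fin d) (i : ℕ) : aeval seqShift (S.poly j) (S.bit j i) =
    if (S.poly j).natDegree ≤ i then S.bit j (i - (S.poly j).natDegree) else 0 := by
  funext k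
  rw [aeval_seqShift_apply, S.bit_rec]
  split_ifs <;> rfl

theorem aeval_pow_bit (j : Fin d) (q i : ℕ) (h : i < (S.poly j).natDegree * q) :
    aeval seqShift (S.poly j ^ q) (S.bit j i) = 0 := by
  induction q generalizing i with
  | zero => simp at h
  | succ q ih =>
    rw [pow_succ, map_mul, Module.End.mul_apply, aeval_bit]
    split_ifs with h1
    · exact ih _ (by rw [Nat.mul_succ] at h; omega)
    · simp

/-- Applying the polynomial of the coordinate to a relation gives a shorter relation, which disposes
of the coefficients of index at least the degree. The remaining rows are triangular with unit
diagonal by the choice of the initial direction numbers. -/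
theorem coeff_eq_zero_of_sum_bit_eq_zero (j : Fin d) (r : ℕ) (c : ℕ → ZMod 2)
    (h : ∑ i ∈ Finset.range r, c i • S.bit j i = 0) : ∀ i < r, c i = 0 := by
  induction r using Nat.strong_induction_on generalizing c with
  | _ r ih =>
    set e := (S.poly j).natDegree with he
    have hepos : 0 < e := S.natDegree_poly_pos j
    have hhigh : ∀ i < r, e ≤ i → c i = 0 := by
      intro i hir hei
      have h1 := congrArg (aeval seqShift (S.poly j)) h
      rw [map_sum, map_zero] at h1
      simp only [map_smul, aeval_bit] at h1
      have h2 : ∑ i ∈ Finset.range (r - e), c (e + i) • S.bit j i = 0 := by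
        rw [← h1]
        have hr : r = e + (r - e) := by omega
        conv_rhs => rw [hr, Finset.sum_range_add]
        rw [Finset.sum_eq_zero (s := Finset.range e), zero_add]
        · refine Finset.sum_congr rfl fun i _ => ?_
          rw [if_pos (by omega)]
          congr 2; omega
        · intro i hi
          rw [if_neg (by have := Finset.mem_range.1 hi; omega), smul_zero]
      have := ih (r - e) (by omega) (fun i => c (e + i)) h2 (i - e) (by omega)
      simpa [show e + (i - e) = i by omega] using this
    intro i
    induction i using Nat.strong_induction_on with
    | _ i ih2 =>
      intro hir
      by_cases hei : e ≤ i
      · exact hhigh i hir hei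
      · have h1 := congrFun h i
        rw [Finset.sum_apply, Finset.sum_eq_single i] at h1
        · simpa [S.bit_diag j i (by omega)] using h1
        · intro i' hi' hne
          have hi'r := Finset.mem_range.1 hi'
          rcases lt_or_gt_of_ne hne with hlt | hgt
          · simp [ih2 i' hlt hi'r]
          · simp [S.bit_below j i' i (by omega) hgt]
        · intro hn; exact absurd (Finset.mem_range.2 hir) hn

/-- The quality parameter of the Sobol' sequence. -/
noncomputable def quality : ℕ := ∑ j, ((S.poly j).natDegree - 1)

/-- The contribution `s j` of each coordinate is killed by a power of its own polynomial. The
product of these powers has degree at most `k` and kills the total, which starts with `k` zeros and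
therefore vanishes. Coprimality then separates the coordinates. -/
theorem coeff_eq_zero_of_sum_sum_bit (r : Fin d → ℕ) (k : ℕ) (hk : ∑ j, r j + S.quality ≤ k)
    (c : Fin d → ℕ → ZMod 2)
    (h : ∀ m < k, ∑ j, ∑ i ∈ Finset.range (r j), c j i * S.bit j i m = 0) :
    ∀ j, ∀ i < r j, c j i = 0 := by
  set e : Fin d → ℕ := fun j => (S.poly j).natDegree with he
  -- This is `r j / e j` rounded up; the rounding costs at most `e j - 1` per coordinate, and
  -- `quality` is the sum of these losses.
  set q : Fin d → ℕ := fun j => (r j + (e j - 1)) / e j with hq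
  have hepos : ∀ j, 0 < e j := S.natDegree_poly_pos
  have hqle : ∀ j, e j * q j ≤ r j + (e j - 1) := fun j => Nat.mul_div_le _ _
  have hrq : ∀ j, r j ≤ e j * q j := fun j => by
    have h1 := Nat.lt_mul_div_succ (r j + (e j - 1)) (hepos j)
    have h2 := hepos j
    rw [Nat.mul_add] at h1
    simp only [hq]; omega
  set s : Fin d → ℕ → ZMod 2 := fun j => ∑ i ∈ Finset.range (r j), c j i • S.bit j i with hs
  have hker : ∀ j, aeval seqShift (S.poly j ^ q j) (s j) = 0 := by
    intro j
    simp only [hs, map_sum, map_smul]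
    refine Finset.sum_eq_zero fun i hi => ?_
    rw [S.aeval_pow_bit j _ _ ((Finset.mem_range.1 hi).trans_le (hrq j)), smul_zero]
  have hkill : ∀ (j : Fin d) (P : (ZMod 2)[X]), S.poly j ^ q j ∣ P → aeval seqShift P (s j) = 0 := by
    rintro j _ ⟨Q, rfl⟩
    rw [mul_comm, map_mul, Module.End.mul_apply, hker, map_zero]
  have hsum : ∑ j, s j = 0 := by
    have hne : ∏ j, S.poly j ^ q j ≠ 0 :=
      Finset.prod_ne_zero_iff.2 fun j _ => pow_ne_zero _ (S.irreducible_poly j).ne_zero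
    refine eq_zero_of_aeval_seqShift_eq_zero hne ?_ ?_
    · rw [map_sum]
      exact Finset.sum_eq_zero fun j _ => hkill j _ (Finset.dvd_prod_of_mem _ (Finset.mem_univ j))
    · intro m hm
      rw [natDegree_prod _ _ fun j _ => pow_ne_zero _ (S.irreducible_poly j).ne_zero] at hm
      simp only [natDegree_pow] at hm
      have h1 : ∑ j, q j * (S.poly j).natDegree ≤ k := by
        refine le_trans ?_ hk
        rw [quality, ← Finset.sum_add_distrib]
        exact Finset.sum_le_sum fun j _ => by rw [mul_comm]; exact hqle j
      have := h m (hm.trans_le h1)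
      simpa [hs, Finset.sum_apply] using this
  -- As the total is zero, `s j` is also killed by the product of the other powers; a Bézout
  -- identity with its own power leaves only `s j = 0`.
  have hzero : ∀ j, s j = 0 := by
    intro j
    have hcop : IsCoprime (S.poly j ^ q j) (∏ j' ∈ Finset.univ.erase j, S.poly j' ^ q j') :=
      IsCoprime.prod_right fun j' hj' =>
        (S.isCoprime_poly (Finset.ne_of_mem_erase hj').symm).pow
    have hother : aeval seqShift (∏ j' ∈ Finset.univ.erase j, S.poly j' ^ q j') (s j) = 0 := by
      have h1 := congrArg (aeval seqShift (∏ j' ∈ Finset.univ.erase j, S.poly j' ^ q j')) hsum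
      rw [map_sum, map_zero, Finset.sum_eq_single j] at h1
      · exact h1
      · intro j' _ hne
        exact hkill j' _ (Finset.dvd_prod_of_mem (fun j' => S.poly j' ^ q j')
          (Finset.mem_erase.2 ⟨hne, Finset.mem_univ _⟩))
      · simp
    obtain ⟨u, v, huv⟩ := hcop
    have h1 : aeval seqShift (u * S.poly j ^ q j + v * ∏ j' ∈ Finset.univ.erase j, S.poly j' ^ q j')
        (s j) = s j := by rw [huv]; simp
    rw [← h1, map_add, map_mul, map_mul, LinearMap.add_apply, Module.End.mul_apply,
      Module.End.mul_apply, hker, hother, map_zero, map_zero, add_zero]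
  exact fun j => S.coeff_eq_zero_of_sum_bit_eq_zero j (r j) (c j) (hzero j)

/-- Independent rows make the matrix surjective on columns, since row rank equals column rank. -/
theorem exists_sum_bit_eq (r : Fin d → ℕ) (k : ℕ) (hk : ∑ j, r j + S.quality ≤ k)
    (v : Fin d → ℕ → ZMod 2) :
    ∃ c : Fin k → ZMod 2, ∀ j, ∀ i < r j, ∑ m : Fin k, S.bit j i m * c m = v j i := by
  classical
  let M : Matrix (Σ j, Fin (r j)) (Fin k) (ZMod 2) := fun p m => S.bit p.1 p.2 m
  have hinj : Function.Injective M.vecMulLinear := by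
    rw [← LinearMap.ker_eq_bot, LinearMap.ker_eq_bot']
    intro c hc
    have := S.coeff_eq_zero_of_sum_sum_bit r k hk
      (fun j i => if h : i < r j then c ⟨j, ⟨i, h⟩⟩ else 0) (by
        intro m hm
        have h1 := congrFun hc ⟨m, hm⟩
        rw [Matrix.vecMulLinear_apply, Matrix.vecMul, dotProduct, Fintype.sum_sigma] at h1
        rw [Pi.zero_apply] at h1
        rw [← h1]
        refine Finset.sum_congr rfl fun j _ => ?_
        rw [Finset.sum_range]
        exact Finset.sum_congr rfl fun i _ => by simp [M])
    funext ⟨j, i⟩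
    simpa using this j i i.2
  have hsurj : Function.Surjective M.mulVecLin := by
    rw [← LinearMap.range_eq_top]
    apply Submodule.eq_top_of_finrank_eq
    have h1 : M.rank = Module.finrank (ZMod 2) (LinearMap.range M.mulVecLin) := rfl
    have h2 : M.transpose.rank = Module.finrank (ZMod 2) (LinearMap.range M.vecMulLinear) := by
      rw [Matrix.rank, Matrix.mulVecLin_transpose]
    rw [← h1, ← Matrix.rank_transpose, h2, LinearMap.finrank_range_of_inj hinj]
  obtain ⟨c, hc⟩ := hsurj (fun p => v p.1 p.2)
  exact ⟨c, fun j i hi => congrFun hc ⟨j, ⟨i, hi⟩⟩⟩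

theorem digits_eq (n k : ℕ) (hn : n < 2 ^ k) (j : Fin d) (i : ℕ) : S.digits n j i =
    decide ((∑ m ∈ Finset.range k, if n.testBit m then S.bit j i m else 0) = 1) := by
  have key : ∀ k', n < 2 ^ k' → ∀ k'' ≥ k', (∑ m ∈ Finset.range k'',
      if n.testBit m then S.bit j i m else 0) =
      ∑ m ∈ Finset.range k', if n.testBit m then S.bit j i m else 0 := by
    intro k' hk' k'' hk''
    refine (Finset.sum_subset (Finset.range_mono hk'') fun m _ hm => ?_).symm
    rw [Finset.mem_range, not_lt] at hm
    rw [Nat.testBit_lt_two_pow (hk'.trans_le (Nat.pow_le_pow_right (by norm_num) hm))]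
    simp
  rw [digits]
  congr 2
  rcases le_total n k with h | h
  · exact (key n Nat.lt_two_pow_self k h).symm
  · exact key k hn n h

/-- This linearity turns every statement about pairs of points in a block into one about a single
index below `2 ^ k`. -/
theorem digits_xor (n m : ℕ) : S.digits (n ^^^ m) = S.digits n + S.digits m := by
  funext j i
  obtain ⟨k, hn, hm⟩ : ∃ k, n < 2 ^ k ∧ m < 2 ^ k :=
    ⟨max n m, (Nat.lt_two_pow_self).trans_le (Nat.pow_le_pow_right (by norm_num) (le_max_left _ _)),
      (Nat.lt_two_pow_self).trans_le (Nat.pow_le_pow_right (by norm_num) (le_max_right _ _))⟩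
  rw [Pi.add_apply, Pi.add_apply, S.digits_eq _ k (Nat.xor_lt_two_pow hn hm), S.digits_eq _ k hn,
    S.digits_eq _ k hm]
  have h1 : (∑ l ∈ Finset.range k, if (n ^^^ m).testBit l then S.bit j i l else 0) =
      (∑ l ∈ Finset.range k, if n.testBit l then S.bit j i l else 0) +
      ∑ l ∈ Finset.range k, if m.testBit l then S.bit j i l else 0 := by
    rw [← Finset.sum_add_distrib]
    refine Finset.sum_congr rfl fun l _ => ?_
    have h2 : ∀ a : ZMod 2, a + a = 0 := by decide
    rw [Nat.testBit_xor]
    cases n.testBit l <;> cases m.testBit l <;> simp [h2]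
  rw [h1]
  have h3 : ∀ a b : ZMod 2, decide (a + b = 1) = xor (decide (a = 1)) (decide (b = 1)) := by decide
  exact h3 _ _

theorem exists_digits_eq (r : Fin d → ℕ) (k : ℕ) (hk : ∑ j, r j + S.quality ≤ k)
    (v : Fin d → ℕ → Bool) :
    ∃ δ < 2 ^ k, ∀ j, ∀ i < r j, S.digits δ j i = v j i := by
  obtain ⟨c, hc⟩ := S.exists_sum_bit_eq r k hk (fun j i => if v j i then 1 else 0)
  refine ⟨Nat.ofBits fun m => decide (c m = 1), Nat.ofBits_lt_two_pow _, fun j i hi => ?_⟩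
  rw [S.digits_eq _ k (Nat.ofBits_lt_two_pow _)]
  have h1 : (∑ m ∈ Finset.range k, if (Nat.ofBits fun m => decide (c m = 1)).testBit m then
      S.bit j i m else 0) = if v j i then 1 else 0 := by
    rw [← hc j i hi, Finset.sum_range]
    refine Finset.sum_congr rfl fun m _ => ?_
    rw [Nat.testBit_ofBits_lt _ _ m.2]
    have : ∀ a : ZMod 2, a = 0 ∨ a = 1 := by decide
    rcases this (c m) with h | h <;> simp [h]
  rw [h1]
  cases v j i <;> simp

/-- The number of points with a given index range that lie in a given elementary interval. -/
theorem card_digits_eq_zero (r : Fin d → ℕ) (k : ℕ) (hk : ∑ j, r j + S.quality ≤ k) :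
    ((Finset.range (2 ^ k)).filter fun δ => ∀ j, ∀ i < r j, S.digits δ j i = false).card *
      2 ^ (∑ j, r j) = 2 ^ k := by
  classical
  set π : ℕ → (∀ j, Fin (r j) → Bool) := fun n j i => S.digits n j i with hπ
  have h1 : (Finset.range (2 ^ k)).card = ∑ v : (∀ j, Fin (r j) → Bool),
      ((Finset.range (2 ^ k)).filter fun n => π n = v).card :=
    Finset.card_eq_sum_card_fiberwise fun _ _ => Finset.mem_coe.2 (Finset.mem_univ _)
  -- All fibres of the digit map have the same size: exclusive or with a preimage of `v` is a
  -- bijection from the fibre over zero to the fibre over `v`.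
  have h2 : ∀ v : (∀ j, Fin (r j) → Bool), ((Finset.range (2 ^ k)).filter fun n => π n = v).card =
      ((Finset.range (2 ^ k)).filter fun δ => ∀ j, ∀ i < r j, S.digits δ j i = false).card := by
    intro v
    obtain ⟨δ, hδ, hδv⟩ := S.exists_digits_eq r k hk
      (fun j i => if h : i < r j then v j ⟨i, h⟩ else false)
    have hmem : ∀ n, π (n ^^^ δ) = v ↔ ∀ j, ∀ i < r j, S.digits n j i = false := by
      intro n
      simp only [hπ, funext_iff, S.digits_xor]
      constructor
      · intro h j i hi
        have h3 := h j ⟨i, hi⟩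
        have h4 := hδv j i hi
        rw [dif_pos hi] at h4
        change xor (S.digits n j i) (S.digits δ j i) = _ at h3
        rw [h4] at h3
        revert h3
        cases S.digits n j i <;> cases v j ⟨i, hi⟩ <;> simp
      · rintro h j ⟨i, hi⟩
        have h4 := hδv j i hi
        rw [dif_pos hi] at h4
        change xor (S.digits n j i) (S.digits δ j i) = _
        rw [h4, h j i hi, Bool.false_xor]
    refine Finset.card_bij' (fun n _ => n ^^^ δ) (fun n _ => n ^^^ δ) ?_ ?_ ?_ ?_
    · intro n hn
      simp only [Finset.mem_filter, Finset.mem_range] at hn ⊢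
      refine ⟨Nat.xor_lt_two_pow hn.1 hδ, ?_⟩
      rw [← hmem, Nat.xor_assoc, Nat.xor_self, Nat.xor_zero]
      exact hn.2
    · intro n hn
      simp only [Finset.mem_filter, Finset.mem_range] at hn ⊢
      exact ⟨Nat.xor_lt_two_pow hn.1 hδ, (hmem n).2 hn.2⟩
    · intro n _; simp
    · intro n _; simp
  rw [Finset.card_range, Finset.sum_congr rfl fun v _ => h2 v, Finset.sum_const, smul_eq_mul] at h1
  have h3 : (Finset.univ : Finset (∀ j, Fin (r j) → Bool)).card = 2 ^ ∑ j, r j := by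
    rw [Finset.card_univ, Fintype.card_pi]
    simp [Finset.prod_pow_eq_pow_sum]
  rw [h3, mul_comm] at h1
  exact h1.symm

end SobolData

/-! ### Fair coins and scrambled digits -/

/-- Digit arrays of points of the unit cube. -/
abbrev Digits (d : ℕ) := Fin d → ℕ → Bool

/-- The law of a fair coin. -/
noncomputable def fairCoin : Measure Bool := (1 / 2 : ENNReal) • (Measure.dirac true + Measure.dirac false)

instance : IsProbabilityMeasure fairCoin := ⟨by
  simp [fairCoin, ENNReal.inv_two_add_inv_two]⟩

/-- The law of independent fair coins. -/
noncomputable def coinLaw (ι : Type*) : Measure (ι → Bool) := Measure.infinitePi fun _ => fairCoin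

instance (ι : Type*) : IsProbabilityMeasure (coinLaw ι) := by unfold coinLaw; infer_instance

theorem fairCoin_map_add (c : Bool) : fairCoin.map (fun x => x + c) = fairCoin := by
  unfold fairCoin
  rw [Measure.map_smul, Measure.map_add _ _ (measurable_of_countable _), Measure.map_dirac' (measurable_of_countable _),
    Measure.map_dirac' (measurable_of_countable _)]
  cases c
  · rfl
  · rw [add_comm]; rfl

/-- Flipping a deterministic set of scrambling bits preserves their law. Uniformity of scrambled
points and orthogonality of Haar components are both derived from this symmetry. -/
theorem measurePreserving_add_coinLaw {ι : Type*} (c : ι → Bool) :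
    MeasurePreserving (fun b : ι → Bool => b + c) (coinLaw ι) (coinLaw ι) := by
  have hm : ∀ i, Measurable fun x : Bool => x + c i := fun i => measurable_of_countable _
  refine ⟨measurable_pi_lambda _ fun i => (hm i).comp (measurable_pi_apply i), ?_⟩
  have := Measure.infinitePi_map_pi (fun _ : ι => fairCoin) (f := fun i x => x + c i) hm
  unfold coinLaw
  rw [show (fun b : ι → Bool => b + c) = fun b i => b i + c i from rfl, this]
  congr 1
  funext i
  exact fairCoin_map_add _

theorem isFairBits_map {Ω ι : Type*} [MeasurableSpace Ω] {ξ : ι → Ω → Bool} {P : Measure Ω}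
    [IsProbabilityMeasure P] (h : IsFairBits ξ P) : P.map (fun ω i => ξ i ω) = coinLaw ι := by
  rw [(iIndepFun_iff_map_fun_eq_infinitePi_map h.1).1 h.2.2, coinLaw]
  congr 1
  funext i
  have hp : IsProbabilityMeasure (P.map (ξ i)) := Measure.isProbabilityMeasure_map (h.1 i).aemeasurable
  have ht : (P.map (ξ i)) {true} = 1 / 2 := by
    rw [Measure.map_apply (h.1 i) (measurableSet_singleton _), ← h.2.1 i]; rfl
  have hf : (P.map (ξ i)) {false} = 1 / 2 := by
    have h1 : ({false} : Set Bool) = {true}ᶜ := by ext b; cases b <;> simp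
    rw [h1, prob_compl_eq_one_sub (measurableSet_singleton _), ht]
    simp
  refine Measure.ext_of_singleton fun b => ?_
  cases b
  · rw [hf]; simp [fairCoin]
  · rw [ht]; simp [fairCoin]

section Scramble

variable {d : ℕ}

/-- The law of the bits of a scrambling in dimension `d`. -/
noncomputable abbrev scrLaw (d : ℕ) : Measure (Fin d × List Bool → Bool) := coinLaw _

theorem scrambleDigits_add (b c : Fin d × List Bool → Bool) (x : Digits d) :
    scrambleDigits (b + c) x =
      scrambleDigits b x + fun j i => c (j, (List.range i).map (x j)) := by
  funext j i
  exact (Bool.xor_assoc _ _ _).symm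

theorem measurable_scrambleDigits (x : Digits d) :
    Measurable fun b : Fin d × List Bool → Bool => scrambleDigits b x := by
  refine measurable_pi_lambda _ fun j => measurable_pi_lambda _ fun i => ?_
  exact (measurable_of_countable (fun y : Bool => xor (x j i) y)).comp (measurable_pi_apply _)

/-- A function of digit arrays that only depends on the first `K` digits of each coordinate. -/
def FirstDigits (K : ℕ) (H : Digits d → ℝ) : Prop :=
  ∀ x x' : Digits d, (∀ j, ∀ i < K, x j i = x' j i) → H x = H x'

/-- Restriction to the first `K` digits. -/
def truncDigits (K : ℕ) (x : Digits d) : Fin d → Fin K → Bool := fun j i => x j i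

/-- Extension of finitely many digits by zeros. -/
def extDigits {K : ℕ} (v : Fin d → Fin K → Bool) : Digits d :=
  fun j i => if h : i < K then v j ⟨i, h⟩ else false

theorem FirstDigits.eq_ext {K : ℕ} {H : Digits d → ℝ} (hH : FirstDigits K H) (x : Digits d) :
    H x = H (extDigits (truncDigits K x)) :=
  hH _ _ fun j i hi => by simp [extDigits, truncDigits, hi]

theorem measurable_truncDigits (K : ℕ) : Measurable (truncDigits K : Digits d → _) :=
  measurable_pi_lambda _ fun j => measurable_pi_lambda _ fun i =>
    (measurable_pi_apply (i : ℕ)).comp (measurable_pi_apply j)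

theorem FirstDigits.measurable {K : ℕ} {H : Digits d → ℝ} (hH : FirstDigits K H) :
    Measurable H := by
  rw [funext hH.eq_ext]
  exact (measurable_of_countable fun v : Fin d → Fin K → Bool => H (extDigits v)).comp
    (measurable_truncDigits K)

theorem FirstDigits.exists_bound {K : ℕ} {H : Digits d → ℝ} (hH : FirstDigits K H) :
    ∃ C, ∀ x, ‖H x‖ ≤ C := by
  refine ⟨∑ v : Fin d → Fin K → Bool, ‖H (extDigits v)‖, fun x => ?_⟩
  rw [hH.eq_ext x]
  exact Finset.single_le_sum (f := fun v : Fin d → Fin K → Bool => ‖H (extDigits v)‖)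
    (fun _ _ => norm_nonneg _) (Finset.mem_univ _)

theorem FirstDigits.memLp {K : ℕ} {H : Digits d → ℝ} (hH : FirstDigits K H) (x : Digits d)
    (p : ENNReal) : MemLp (fun b => H (scrambleDigits b x)) p (scrLaw d) := by
  obtain ⟨C, hC⟩ := hH.exists_bound
  exact MemLp.of_bound (hH.measurable.comp (measurable_scrambleDigits x)).aestronglyMeasurable C
    (Eventually.of_forall fun _ => hC _)

theorem FirstDigits.integrable {K : ℕ} {H : Digits d → ℝ} (hH : FirstDigits K H) (x : Digits d) :
    Integrable (fun b => H (scrambleDigits b x)) (scrLaw d) :=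
  memLp_one_iff_integrable.1 (hH.memLp x 1)

theorem FirstDigits.sq {K : ℕ} {H : Digits d → ℝ} (hH : FirstDigits K H) :
    FirstDigits K fun x => H x ^ 2 :=
  fun x x' h => by simp only [hH x x' h]

theorem FirstDigits.translate {K : ℕ} {H : Digits d → ℝ} (hH : FirstDigits K H) (v : Digits d) :
    FirstDigits K fun x => H (x + v) :=
  fun x x' h => hH _ _ fun j i hi => by simp only [Pi.add_apply, h j i hi]

/-- A translation of the output is produced by flipping scrambling bits according to the length of
the prefix alone. -/
theorem integral_scramble_translate (H : Digits d → ℝ) (x v : Digits d) :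
    ∫ b, H (scrambleDigits b x + v) ∂scrLaw d = ∫ b, H (scrambleDigits b x) ∂scrLaw d := by
  set c : Fin d × List Bool → Bool := fun q => v q.1 q.2.length with hc
  have hmp := measurePreserving_add_coinLaw c
  have he : MeasurableEmbedding fun b : Fin d × List Bool → Bool => b + c := by
    refine (MeasurableEquiv.mk (Equiv.addRight c) hmp.measurable ?_).measurableEmbedding
    exact (measurePreserving_add_coinLaw (-c)).measurable
  rw [← hmp.integral_comp he fun b => H (scrambleDigits b x)]
  simp only [scrambleDigits_add, hc, List.length_map, List.length_range]

/-- The integral is unchanged under translation by each of the `2 ^ (d * K)` digit patterns, while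
the sum of all the translates of `H` is constant. -/
theorem integral_scramble_eq_sum {K : ℕ} {H : Digits d → ℝ} (hH : FirstDigits K H) (x : Digits d) :
    ∫ b, H (scrambleDigits b x) ∂scrLaw d =
      (2 ^ (d * K) : ℝ)⁻¹ * ∑ v : Fin d → Fin K → Bool, H (extDigits v) := by
  have h1 : ∑ v : Fin d → Fin K → Bool, ∫ b, H (scrambleDigits b x + extDigits v) ∂scrLaw d =
      ∑ v : Fin d → Fin K → Bool, H (extDigits v) := by
    rw [← integral_finsetSum _ fun v _ => (hH.translate _).integrable x]
    have h2 : ∀ z : Digits d, ∑ v : Fin d → Fin K → Bool, H (z + extDigits v) =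
        ∑ v : Fin d → Fin K → Bool, H (extDigits v) := by
      intro z
      rw [← Equiv.sum_comp (Equiv.addLeft (truncDigits K z))]
      refine Finset.sum_congr rfl fun v _ => hH _ _ fun j i hi => ?_
      simp only [extDigits, truncDigits, hi, dif_pos, Pi.add_apply, Equiv.coe_addLeft]
      cases z j i <;> cases v j ⟨i, hi⟩ <;> rfl
    simp_rw [h2]
    simp
  simp_rw [integral_scramble_translate, Finset.sum_const] at h1
  rw [← h1]
  simp
  rw [← mul_assoc, mul_comm d K, pow_mul, inv_mul_cancel₀ (by positivity), one_mul]

theorem integral_scramble_congr {K : ℕ} {H : Digits d → ℝ} (hH : FirstDigits K H)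
    (x x' : Digits d) :
    ∫ b, H (scrambleDigits b x) ∂scrLaw d = ∫ b, H (scrambleDigits b x') ∂scrLaw d := by
  rw [integral_scramble_eq_sum hH, integral_scramble_eq_sum hH]

end Scramble

/-! ### Dyadic blocks of a scrambled Sobol' sequence -/

/-- The digit array with a single nonzero digit. -/
def bitAt {d : ℕ} (j : Fin d) (i : ℕ) : Digits d := Pi.single j (Pi.single i true)

theorem bitAt_apply_self {d : ℕ} (j : Fin d) (i : ℕ) : bitAt j i j i = true := by simp [bitAt]

theorem bitAt_apply_ne {d : ℕ} {j j' : Fin d} {i i' : ℕ} (h : j' ≠ j ∨ i' ≠ i) :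
    bitAt j i j' i' = false := by
  unfold bitAt
  by_cases hj : j' = j
  · subst hj
    have : i' ≠ i := by tauto
    simp [this]
    rfl
  · simp [hj]
    rfl

theorem exists_le_sum_eq {d : ℕ} (f : Fin d → ℕ) (s : ℕ) (hs : s ≤ ∑ j, f j) :
    ∃ g : Fin d → ℕ, (∀ j, g j ≤ f j) ∧ ∑ j, g j = s := by
  induction s with
  | zero => exact ⟨0, fun j => Nat.zero_le _, by simp⟩
  | succ s ih =>
    obtain ⟨g, hg, hgs⟩ := ih (by omega)
    have : ∃ j, g j < f j := by
      by_contra! hcon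
      have := Finset.sum_le_sum fun j (_ : j ∈ Finset.univ) => hcon j
      omega
    obtain ⟨j, hj⟩ := this
    refine ⟨g + Pi.single j 1, fun j' => ?_, ?_⟩
    · by_cases h : j' = j
      · subst h; simpa using hj
      · simpa [h] using hg j'
    · simp [Finset.sum_add_distrib, hgs]

section Block

variable {d : ℕ} (S : SobolData d)

/-- Functions of Haar type of level `κ`. -/
structure IsHaar (κ : Fin d → ℕ) (H : Digits d → ℝ) : Prop where
  dep : ∀ x x' : Digits d, (∀ j, ∀ i < κ j, x j i = x' j i) → H x = H x'
  anti : ∀ j, κ j ≠ 0 → ∀ x, H (x + bitAt j (κ j - 1)) = -H x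

theorem IsHaar.firstDigits {κ : Fin d → ℕ} {H : Digits d → ℝ} (hH : IsHaar κ H) :
    FirstDigits (∑ j, κ j) H :=
  fun x x' h => hH.dep x x' fun j i hi => h j i
    (hi.trans_le (Finset.single_le_sum (f := κ) (fun _ _ => Nat.zero_le _) (Finset.mem_univ j)))

/-- The index range of a dyadic block. -/
def dyadicBlock (k a : ℕ) : Finset ℕ := Finset.Ico (a * 2 ^ k) ((a + 1) * 2 ^ k)

theorem mem_dyadicBlock {k a n : ℕ} : n ∈ dyadicBlock k a ↔ n / 2 ^ k = a := by
  rw [dyadicBlock, Finset.mem_Ico, Nat.div_eq_iff (by positivity)]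
  have : 0 < 2 ^ k := by positivity
  rw [add_mul, one_mul]
  omega

theorem card_dyadicBlock (k a : ℕ) : (dyadicBlock k a).card = 2 ^ k := by
  rw [dyadicBlock, Nat.card_Ico, add_mul, one_mul, Nat.add_sub_cancel_left]

theorem xor_mem_dyadicBlock {k a n δ : ℕ} (hn : n ∈ dyadicBlock k a) (hδ : δ < 2 ^ k) :
    n ^^^ δ ∈ dyadicBlock k a := by
  rw [mem_dyadicBlock] at hn ⊢
  rw [← Nat.shiftRight_eq_div_pow] at hn ⊢
  rw [Nat.shiftRight_xor_distrib, hn, Nat.shiftRight_eq_div_pow, Nat.div_eq_of_lt hδ, Nat.xor_zero]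

theorem xor_lt_of_mem_dyadicBlock {k a n m : ℕ} (hn : n ∈ dyadicBlock k a)
    (hm : m ∈ dyadicBlock k a) : n ^^^ m < 2 ^ k := by
  rw [mem_dyadicBlock] at hn hm
  have h : (n ^^^ m) >>> k = 0 := by
    rw [Nat.shiftRight_xor_distrib, Nat.shiftRight_eq_div_pow, Nat.shiftRight_eq_div_pow, hn, hm,
      Nat.xor_self]
  rw [Nat.shiftRight_eq_div_pow] at h
  exact (Nat.div_eq_zero_iff.1 h).resolve_left (by positivity)

/-- Equidistribution provides an index `δ` below `2 ^ k` whose relevant digits all vanish except the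
last one in a coordinate `j` with `κ j ≠ 0`. Exclusive or with `δ` permutes the block, keeps the
prefixes that select the relevant scrambling bits, and changes the sign of `H`. -/
theorem IsHaar.sum_dyadicBlock_eq_zero {κ : Fin d → ℕ} {H : Digits d → ℝ} (hH : IsHaar κ H)
    (hκ : κ ≠ 0) {k : ℕ} (hk : ∑ j, κ j + S.quality ≤ k) (a : ℕ)
    (b : Fin d × List Bool → Bool) :
    ∑ n ∈ dyadicBlock k a, H (scrambleDigits b (S.digits n)) = 0 := by
  obtain ⟨j, hj⟩ := Function.ne_iff.1 hκ
  have hj : κ j ≠ 0 := hj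
  obtain ⟨δ, hδ, hδv⟩ := S.exists_digits_eq κ k hk (bitAt j (κ j - 1))
  have hprefix : ∀ n j', ∀ i < κ j', (List.range i).map (S.digits (n ^^^ δ) j') =
      (List.range i).map (S.digits n j') := by
    intro n j' i hi
    refine List.map_congr_left fun l hl => ?_
    have hl := List.mem_range.1 hl
    rw [S.digits_xor, Pi.add_apply, Pi.add_apply, hδv j' l (by omega)]
    rw [bitAt_apply_ne]
    · exact Bool.xor_false _
    · by_cases h : j' = j
      · subst h; right; omega
      · left; exact h
  have hflip : ∀ n, H (scrambleDigits b (S.digits (n ^^^ δ))) =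
      -H (scrambleDigits b (S.digits n)) := by
    intro n
    rw [← hH.anti j hj]
    refine hH.dep _ _ fun j' i hi => ?_
    change xor _ _ = xor (xor _ _) _
    rw [hprefix n j' i hi, S.digits_xor, ← hδv j' i hi]
    change xor (xor _ _) _ = _
    rw [Bool.xor_assoc, Bool.xor_assoc, Bool.xor_comm (S.digits δ j' i)]
  have h1 : ∑ n ∈ dyadicBlock k a, H (scrambleDigits b (S.digits n)) =
      ∑ n ∈ dyadicBlock k a, H (scrambleDigits b (S.digits (n ^^^ δ))) := by
    refine Finset.sum_nbij' (fun n => n ^^^ δ) (fun n => n ^^^ δ)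
      (fun n hn => xor_mem_dyadicBlock hn hδ) (fun n hn => xor_mem_dyadicBlock hn hδ)
      (fun n _ => by simp) (fun n _ => by simp) (fun n _ => by simp)
  simp_rw [hflip] at h1
  rw [Finset.sum_neg_distrib] at h1
  linarith

/-- Flip the single scrambling bit attached to the prefix of `x` of length `κ j - 1`. This flips the
last relevant digit of the scrambled `x`, hence the sign of its factor, and leaves the scrambled
`x'` alone because its prefix is different. -/
theorem IsHaar.integral_mul_eq_zero {κ : Fin d → ℕ} {H : Digits d → ℝ} (hH : IsHaar κ H)
    {x x' : Digits d} {j : Fin d} {i : ℕ} (hi : i < κ j - 1) (hx : x j i ≠ x' j i) :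
    ∫ b, H (scrambleDigits b x) * H (scrambleDigits b x') ∂scrLaw d = 0 := by
  classical
  set c : Fin d × List Bool → Bool :=
    Pi.single (j, (List.range (κ j - 1)).map (x j)) true with hc
  have hmp := measurePreserving_add_coinLaw c
  have he : MeasurableEmbedding fun b : Fin d × List Bool → Bool => b + c := by
    refine (MeasurableEquiv.mk (Equiv.addRight c) hmp.measurable ?_).measurableEmbedding
    exact (measurePreserving_add_coinLaw (-c)).measurable
  have h1 : ∀ b, H (scrambleDigits (b + c) x) = -H (scrambleDigits b x) := by
    intro b
    rw [← hH.anti j (by omega), scrambleDigits_add]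
    congr 2
    funext j' i'
    by_cases h : j' = j ∧ i' = κ j - 1
    · rw [h.1, h.2, bitAt_apply_self, hc]; simp
    · rw [bitAt_apply_ne (by tauto), hc, Pi.single_eq_of_ne]
      · rfl
      · intro h2
        have h3 := Prod.mk.inj h2
        have h4 := congrArg List.length h3.2
        simp at h4
        exact h ⟨h3.1, h4⟩
  have h2 : ∀ b, H (scrambleDigits (b + c) x') = H (scrambleDigits b x') := by
    intro b
    rw [scrambleDigits_add]
    congr 1
    funext j' i'
    rw [Pi.add_apply, Pi.add_apply, hc, Pi.single_eq_of_ne]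
    · exact Bool.xor_false _
    · intro h2
      have h3 := Prod.mk.inj h2
      have h4 := congrArg List.length h3.2
      simp at h4
      obtain ⟨rfl, h5⟩ := h3
      rw [h4, List.map_inj_left] at h5
      exact hx (h5 i (List.mem_range.2 hi)).symm
  have h3 := hmp.integral_comp he fun b => H (scrambleDigits b x) * H (scrambleDigits b x')
  simp_rw [h1, h2, neg_mul] at h3
  rw [integral_neg] at h3
  linarith

/-- Shortening the prefixes to total length `k - (quality + d)` only enlarges the set and makes the
exact count of `card_digits_eq_zero` available; the `d` pays for the digits lost in `κ j - 1`. -/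
theorem card_agree_le {κ : Fin d → ℕ} {k : ℕ} (hk : k < ∑ j, κ j + S.quality) (a n : ℕ)
    (hn : n ∈ dyadicBlock k a) :
    ((dyadicBlock k a).filter fun m => ∀ j, ∀ i < κ j - 1, S.digits n j i = S.digits m j i).card ≤
      2 ^ (S.quality + d) := by
  classical
  rcases le_or_gt k (S.quality + d) with hkd | hkd
  · refine (Finset.card_filter_le _ _).trans ?_
    rw [card_dyadicBlock]
    exact Nat.pow_le_pow_right (by norm_num) hkd
  · have hsum : k - (S.quality + d) ≤ ∑ j, (κ j - 1) := by
      have h1 : ∑ j, κ j ≤ ∑ j : Fin d, ((κ j - 1) + 1) :=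
        Finset.sum_le_sum fun j _ => by omega
      rw [Finset.sum_add_distrib] at h1
      simp at h1
      omega
    obtain ⟨r, hr, hrs⟩ := exists_le_sum_eq _ _ hsum
    have hcard := S.card_digits_eq_zero r k (by omega)
    have h2 : 2 ^ k = 2 ^ (S.quality + d) * 2 ^ (∑ j, r j) := by
      rw [← pow_add]; congr 1; omega
    rw [h2] at hcard
    have h3 := Nat.eq_of_mul_eq_mul_right (by positivity) hcard
    rw [← h3]
    refine Finset.card_le_card_of_injOn (fun m => n ^^^ m) ?_ ?_
    · intro m hm
      simp only [Finset.coe_filter, Set.mem_ofPred_eq] at hm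
      simp only [Finset.coe_filter, Set.mem_ofPred_eq, Finset.mem_range]
      rw [← h2]
      refine ⟨xor_lt_of_mem_dyadicBlock hn hm.1, fun j i hi => ?_⟩
      rw [S.digits_xor]
      change xor _ _ = false
      rw [hm.2 j i (hi.trans_le (hr j)), Bool.xor_self]
    · intro m _ m' _ h
      exact Nat.xor_right_injective h

/-- Expand the square. Pairs with different prefixes are orthogonal, each remaining pair contributes
at most the second moment of one point, and `card_agree_le` counts the remaining pairs. -/
theorem IsHaar.integral_sum_sq_le {κ : Fin d → ℕ} {H : Digits d → ℝ} (hH : IsHaar κ H) {k : ℕ}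
    (hk : k < ∑ j, κ j + S.quality) (a : ℕ) :
    ∫ b, (∑ n ∈ dyadicBlock k a, H (scrambleDigits b (S.digits n))) ^ 2 ∂scrLaw d ≤
      2 ^ k * 2 ^ (S.quality + d) * ∫ b, H (scrambleDigits b 0) ^ 2 ∂scrLaw d := by
  classical
  set σ := ∫ b, H (scrambleDigits b 0) ^ 2 ∂scrLaw d with hσ
  have hσ0 : 0 ≤ σ := integral_nonneg fun b => sq_nonneg _
  have hF := hH.firstDigits
  have hint : ∀ n m, Integrable (fun b => H (scrambleDigits b (S.digits n)) *
      H (scrambleDigits b (S.digits m))) (scrLaw d) :=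
    fun n m => (hF.memLp _ 2).integrable_mul (hF.memLp _ 2)
  have hsq : ∀ n, ∫ b, H (scrambleDigits b (S.digits n)) ^ 2 ∂scrLaw d = σ :=
    fun n => integral_scramble_congr hF.sq _ _
  have hle : ∀ n m, ∫ b, H (scrambleDigits b (S.digits n)) * H (scrambleDigits b (S.digits m))
      ∂scrLaw d ≤ if ∀ j, ∀ i < κ j - 1, S.digits n j i = S.digits m j i then σ else 0 := by
    intro n m
    split_ifs with h
    · calc _ ≤ ∫ b, (1 / 2 : ℝ) * (H (scrambleDigits b (S.digits n)) ^ 2 +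
            H (scrambleDigits b (S.digits m)) ^ 2) ∂scrLaw d := by
            refine integral_mono (hint n m)
              (((hF.sq.integrable _).add (hF.sq.integrable _)).const_mul _) fun b => ?_
            simp only
            nlinarith [sq_nonneg (H (scrambleDigits b (S.digits n)) -
              H (scrambleDigits b (S.digits m)))]
        _ = σ := by
            rw [integral_const_mul, integral_add (hF.sq.integrable _) (hF.sq.integrable _), hsq, hsq]
            ring
    · push Not at h
      obtain ⟨j, i, hi, hne⟩ := h
      rw [hH.integral_mul_eq_zero hi hne]
  calc _ = ∑ n ∈ dyadicBlock k a, ∑ m ∈ dyadicBlock k a,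
        ∫ b, H (scrambleDigits b (S.digits n)) * H (scrambleDigits b (S.digits m)) ∂scrLaw d := by
        simp_rw [sq, Finset.sum_mul_sum]
        rw [integral_finsetSum _ fun n _ => integrable_finsetSum _ fun m _ => hint n m]
        exact Finset.sum_congr rfl fun n _ => integral_finsetSum _ fun m _ => hint n m
    _ ≤ ∑ n ∈ dyadicBlock k a, 2 ^ (S.quality + d) * σ := by
        refine Finset.sum_le_sum fun n hn => ?_
        refine (Finset.sum_le_sum fun m _ => hle n m).trans ?_
        rw [← Finset.sum_filter, Finset.sum_const, nsmul_eq_mul]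
        refine mul_le_mul_of_nonneg_right ?_ hσ0
        exact_mod_cast card_agree_le S hk a n hn
    _ = _ := by
        rw [Finset.sum_const, card_dyadicBlock, nsmul_eq_mul]; push_cast; ring

end Block

/-! ### The Haar decomposition -/

section Haar

variable {d : ℕ}

/-- Translations of functions of digit arrays. -/
def translateHom (d : ℕ) : Multiplicative (Digits d) →* Module.End ℝ (Digits d → ℝ) where
  toFun v := LinearMap.funLeft ℝ ℝ fun x => x + v.toAdd
  map_one' := by ext; simp [LinearMap.funLeft]
  map_mul' v w := by
    ext H x
    simp only [LinearMap.funLeft_apply, Module.End.mul_apply, toAdd_mul]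
    rw [add_assoc]

/-- The action of the group algebra of the digit arrays on functions. -/
noncomputable def groupAct (d : ℕ) :
    AddMonoidAlgebra ℝ (Digits d) →ₐ[ℝ] Module.End ℝ (Digits d → ℝ) :=
  AddMonoidAlgebra.lift ℝ _ _ (translateHom d)

/-- The group algebra element of a translation. -/
noncomputable def tr (v : Digits d) : AddMonoidAlgebra ℝ (Digits d) := AddMonoidAlgebra.single v 1

@[simp] theorem groupAct_tr (v : Digits d) (H : Digits d → ℝ) (x : Digits d) :
    groupAct d (tr v) H x = H (x + v) := by
  simp [groupAct, tr, AddMonoidAlgebra.lift_single, translateHom, LinearMap.funLeft_apply]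

theorem groupAct_induction {p : AddMonoidAlgebra ℝ (Digits d) → Prop}
    (α : AddMonoidAlgebra ℝ (Digits d)) (htr : ∀ v, p (tr v)) (hadd : ∀ α β, p α → p β → p (α + β))
    (hsmul : ∀ (r : ℝ) α, p α → p (r • α)) : p α :=
  AddMonoidAlgebra.induction_on α htr hadd hsmul

theorem tr_mul_self (v : Digits d) : tr v * tr v = 1 := by
  have : v + v = 0 := by
    funext j i
    change xor (v j i) (v j i) = false
    exact Bool.xor_self _
  rw [tr, AddMonoidAlgebra.single_mul_single, this, one_mul]; rfl

/-- Averaging over a flip. -/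
noncomputable def avgOp (v : Digits d) : AddMonoidAlgebra ℝ (Digits d) := (1 / 2 : ℝ) • (1 + tr v)

/-- Half the difference over a flip. -/
noncomputable def difOp (v : Digits d) : AddMonoidAlgebra ℝ (Digits d) := (1 / 2 : ℝ) • (1 - tr v)

theorem avgOp_add_difOp (v : Digits d) : avgOp v + difOp v = 1 := by
  rw [avgOp, difOp, ← smul_add, add_add_sub_cancel, ← two_smul ℝ (1 : AddMonoidAlgebra ℝ (Digits d)),
    smul_smul]
  norm_num

theorem tr_mul_avgOp (v : Digits d) : tr v * avgOp v = avgOp v := by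
  rw [avgOp, mul_smul_comm, mul_add, mul_one, tr_mul_self, add_comm]

theorem tr_mul_difOp (v : Digits d) : tr v * difOp v = -difOp v := by
  rw [difOp, mul_smul_comm, mul_sub, mul_one, tr_mul_self, ← smul_neg, neg_sub]

theorem groupAct_avgOp (v : Digits d) (H : Digits d → ℝ) (x : Digits d) :
    groupAct d (avgOp v) H x = 1 / 2 * (H x + H (x + v)) := by
  simp [avgOp, mul_add]

theorem groupAct_difOp (v : Digits d) (H : Digits d → ℝ) (x : Digits d) :
    groupAct d (difOp v) H x = 1 / 2 * (H x - H (x + v)) := by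
  simp [difOp]

theorem FirstDigits.groupAct {K : ℕ} {H : Digits d → ℝ} (hH : FirstDigits K H)
    (α : AddMonoidAlgebra ℝ (Digits d)) : FirstDigits K (groupAct d α H) := by
  induction α using groupAct_induction with
  | htr v =>
    intro x x' h
    rw [groupAct_tr, groupAct_tr]
    exact hH.translate v x x' h
  | hadd α β hα hβ =>
    intro x x' h
    rw [map_add, LinearMap.add_apply, Pi.add_apply, Pi.add_apply, hα x x' h, hβ x x' h]
  | hsmul r α hα =>
    intro x x' h
    rw [map_smul, LinearMap.smul_apply, Pi.smul_apply, Pi.smul_apply, hα x x' h]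

/-- The difference operator of level `κ` in the coordinate `j`. -/
noncomputable def levelDif (j : Fin d) (κ : ℕ) : AddMonoidAlgebra ℝ (Digits d) :=
  if κ = 0 then 1 else difOp (bitAt j (κ - 1))

/-- Averaging over the digits from `κ` to `K - 1` of the coordinate `j`. -/
noncomputable def levelAvg (K : ℕ) (j : Fin d) (κ : ℕ) : AddMonoidAlgebra ℝ (Digits d) :=
  ∏ i ∈ Finset.Ico κ K, avgOp (bitAt j i)

/-- A telescoping identity: at each new digit the identity splits into averaging over that digit and
half the difference over its flip. The index `κ` records the last digit at which a difference is
taken. -/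
theorem sum_level (K : ℕ) (j : Fin d) :
    ∑ κ ∈ Finset.range (K + 1), levelAvg K j κ * levelDif j κ = 1 := by
  induction K with
  | zero => simp [levelAvg, levelDif]
  | succ K ih =>
    rw [Finset.sum_range_succ]
    have h1 : ∑ κ ∈ Finset.range (K + 1), levelAvg (K + 1) j κ * levelDif j κ =
        avgOp (bitAt j K) * ∑ κ ∈ Finset.range (K + 1), levelAvg K j κ * levelDif j κ := by
      rw [Finset.mul_sum]
      refine Finset.sum_congr rfl fun κ hκ => ?_
      have := Finset.mem_range.1 hκ
      rw [levelAvg, Finset.prod_Ico_succ_top (by omega), levelAvg]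
      ring
    rw [h1, ih, mul_one]
    simp only [levelAvg, Finset.Ico_self, Finset.prod_empty, one_mul, levelDif,
      Nat.add_eq_zero_iff, one_ne_zero, and_false, if_false, Nat.add_sub_cancel]
    exact avgOp_add_difOp _

/-- The Haar projection of level `κ` of functions of the first `K` digits. -/
noncomputable def haarProj (K : ℕ) (κ : Fin d → ℕ) : AddMonoidAlgebra ℝ (Digits d) :=
  ∏ j, levelAvg K j (κ j) * levelDif j (κ j)

/-- The levels of functions of the first `K` digits. -/
def levelBox (d K : ℕ) : Finset (Fin d → ℕ) := Fintype.piFinset fun _ => Finset.range (K + 1)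

theorem sum_haarProj (K : ℕ) : ∑ κ ∈ levelBox d K, haarProj K κ = 1 := by
  have := (Finset.prod_univ_sum (fun _ : Fin d => Finset.range (K + 1))
    fun j κ => levelAvg K j κ * levelDif j κ)
  simp only [sum_level, Finset.prod_const_one] at this
  exact this.symm

theorem sum_groupAct_haarProj (K : ℕ) (F : Digits d → ℝ) (x : Digits d) :
    ∑ κ ∈ levelBox d K, groupAct d (haarProj K κ) F x = F x := by
  have h := congrArg (fun α => groupAct d α F x) (sum_haarProj (d := d) K)
  simpa [map_sum] using h

theorem groupAct_mul_tr_left {α : AddMonoidAlgebra ℝ (Digits d)} (v x : Digits d)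
    (F : Digits d → ℝ) : groupAct d (tr v * α) F x = groupAct d α F (x + v) := by
  rw [map_mul, Module.End.mul_apply, groupAct_tr]

/-- The group algebra is commutative, so a translation can be moved to the factor of its own digit:
averages absorb it, and the difference factor changes sign. -/
theorem isHaar_haarProj {K : ℕ} {κ : Fin d → ℕ} {F : Digits d → ℝ}
    (hF : FirstDigits K F) : IsHaar κ (groupAct d (haarProj K κ) F) := by
  have hsplit : ∀ j, haarProj K κ = (levelAvg K j (κ j) * levelDif j (κ j)) *
      ∏ j' ∈ Finset.univ.erase j, levelAvg K j' (κ j') * levelDif j' (κ j') := fun j =>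
    (Finset.mul_prod_erase _ _ (Finset.mem_univ j)).symm
  constructor
  · set H := groupAct d (haarProj K κ) F with hHdef
    have hH : FirstDigits K H := hF.groupAct _
    have hadd : ∀ v w : Digits d, (∀ x, H (x + v) = H x) → (∀ x, H (x + w) = H x) →
        ∀ x, H (x + (v + w)) = H x := fun v w hv hw x => by rw [← add_assoc, hw, hv]
    have hbit : ∀ j i, κ j ≤ i → i < K → ∀ x, H (x + bitAt j i) = H x := by
      intro j i h1 h2 x
      rw [hHdef, ← groupAct_mul_tr_left, hsplit j, levelAvg,
        ← Finset.mul_prod_erase _ _ (Finset.mem_Ico.2 ⟨h1, h2⟩)]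
      simp only [← mul_assoc]
      rw [tr_mul_avgOp]
    have key : ∀ v : Digits d, (∀ j, ∀ i < κ j, v j i = false) → ∀ x, H (x + v) = H x := by
      intro v hv
      -- Since `v` vanishes below `κ`, the array `w` agrees with `v` on the first `K` digits, which
      -- are all that `H` sees.
      set w : Digits d := ∑ j, ∑ i ∈ Finset.Ico (κ j) K, if v j i then bitAt j i else 0 with hw
      have hwH : ∀ x, H (x + w) = H x := by
        refine Finset.sum_induction _ (fun v => ∀ x, H (x + v) = H x) hadd (by simp) fun j _ => ?_
        refine Finset.sum_induction _ (fun v => ∀ x, H (x + v) = H x) hadd (by simp) fun i hi => ?_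
        have := Finset.mem_Ico.1 hi
        split_ifs
        · exact hbit j i this.1 this.2
        · simp
      intro x
      rw [← hwH x]
      refine hH _ _ fun j i hi => ?_
      rw [Pi.add_apply, Pi.add_apply, Pi.add_apply, Pi.add_apply]
      congr 1
      simp only [hw, Finset.sum_apply]
      rw [Finset.sum_eq_single j]
      · by_cases hik : i < κ j
        · rw [hv j i hik, Finset.sum_eq_zero]
          · rfl
          · intro i' hi'
            have := Finset.mem_Ico.1 hi'
            split_ifs
            · exact bitAt_apply_ne (by omega)
            · rfl
        · rw [Finset.sum_eq_single i]
          · cases hvji : v j i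
            · simp; rfl
            · simp [bitAt_apply_self]
          · intro i' _ hne
            split_ifs
            · exact bitAt_apply_ne (Or.inr hne.symm)
            · rfl
          · intro h; exact absurd (Finset.mem_Ico.2 ⟨not_lt.1 hik, hi⟩) h
      · intro j' _ hne
        refine Finset.sum_eq_zero fun i' _ => ?_
        split_ifs
        · exact bitAt_apply_ne (Or.inl hne.symm)
        · rfl
      · simp
    intro x x' h
    have h1 := key (x + x') (fun j i hi => by
      rw [Pi.add_apply, Pi.add_apply, h j i hi]
      exact Bool.xor_self _) x
    rw [← h1]
    congr 1
    funext j i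
    change xor (x j i) (xor (x j i) (x' j i)) = x' j i
    rw [← Bool.xor_assoc, Bool.xor_self, Bool.false_xor]
  · intro j hj x
    rw [← groupAct_mul_tr_left, hsplit j, levelDif, if_neg hj]
    have : tr (bitAt j (κ j - 1)) * (levelAvg K j (κ j) * difOp (bitAt j (κ j - 1)) *
        ∏ j' ∈ Finset.univ.erase j, levelAvg K j' (κ j') * levelDif j' (κ j')) =
        -(levelAvg K j (κ j) * difOp (bitAt j (κ j - 1)) *
        ∏ j' ∈ Finset.univ.erase j, levelAvg K j' (κ j') * levelDif j' (κ j')) := by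
      linear_combination (levelAvg K j (κ j) *
        ∏ j' ∈ Finset.univ.erase j, levelAvg K j' (κ j') * levelDif j' (κ j')) *
        tr_mul_difOp (bitAt j (κ j - 1))
    rw [this, map_neg]
    rfl

theorem integral_groupAct_avgOp_sq_le {K : ℕ} {H : Digits d → ℝ} (hH : FirstDigits K H)
    (v x : Digits d) :
    ∫ b, groupAct d (avgOp v) H (scrambleDigits b x) ^ 2 ∂scrLaw d ≤
      ∫ b, H (scrambleDigits b x) ^ 2 ∂scrLaw d := by
  have h1 := integral_scramble_translate (fun z => H z ^ 2) x v
  calc _ ≤ ∫ b, (1 / 2 : ℝ) * (H (scrambleDigits b x) ^ 2 + H (scrambleDigits b x + v) ^ 2)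
        ∂scrLaw d := by
        refine integral_mono ((hH.groupAct _).sq.integrable x)
          (((hH.sq.integrable x).add ((hH.translate v).sq.integrable x)).const_mul _) fun b => ?_
        simp only [groupAct_avgOp]
        nlinarith [sq_nonneg (H (scrambleDigits b x) - H (scrambleDigits b x + v))]
    _ = _ := by
        rw [integral_const_mul, integral_add (hH.sq.integrable x)
          ((hH.translate v).sq.integrable x), h1]
        ring

theorem integral_groupAct_prod_avgOp_sq_le {K : ℕ} {H : Digits d → ℝ} (hH : FirstDigits K H)
    (x : Digits d) {ι : Type*} (s : Finset ι) (e : ι → Digits d) :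
    ∫ b, groupAct d (∏ i ∈ s, avgOp (e i)) H (scrambleDigits b x) ^ 2 ∂scrLaw d ≤
      ∫ b, H (scrambleDigits b x) ^ 2 ∂scrLaw d := by
  classical
  induction s using Finset.induction_on with
  | empty => simp
  | insert i s hi ih =>
    rw [Finset.prod_insert hi, map_mul]
    exact (integral_groupAct_avgOp_sq_le (hH.groupAct _) _ x).trans ih

/-- Averages over flips contract the second moment, so only the differences in the projection
matter. -/
theorem integral_haarProj_sq_le {K : ℕ} {F : Digits d → ℝ} (hF : FirstDigits K F)
    (κ : Fin d → ℕ) (x : Digits d) :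
    ∫ b, groupAct d (haarProj K κ) F (scrambleDigits b x) ^ 2 ∂scrLaw d ≤
      ∫ b, groupAct d (∏ j, levelDif j (κ j)) F (scrambleDigits b x) ^ 2 ∂scrLaw d := by
  have h : haarProj K κ = (∏ p ∈ Finset.univ.sigma fun j => Finset.Ico (κ j) K,
      avgOp (bitAt p.1 p.2)) * ∏ j, levelDif j (κ j) := by
    rw [haarProj, Finset.prod_mul_distrib, Finset.prod_sigma]
    rfl
  rw [h, map_mul]
  exact integral_groupAct_prod_avgOp_sq_le (hF.groupAct _) x _ _

theorem integral_groupAct_avgOp {K : ℕ} {H : Digits d → ℝ} (hH : FirstDigits K H)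
    (v x : Digits d) :
    ∫ b, groupAct d (avgOp v) H (scrambleDigits b x) ∂scrLaw d =
      ∫ b, H (scrambleDigits b x) ∂scrLaw d := by
  simp only [groupAct_avgOp]
  rw [integral_const_mul, integral_add (hH.integrable x) ((hH.translate v).integrable x),
    integral_scramble_translate]
  ring

/-- The component of level zero depends on no digit, and averaging does not change the mean.
Subtracting the mean therefore removes exactly this component. -/
theorem groupAct_haarProj_zero {K : ℕ} {F : Digits d → ℝ} (hF : FirstDigits K F) (x : Digits d) :
    groupAct d (haarProj K 0) F x = ∫ b, F (scrambleDigits b 0) ∂scrLaw d := by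
  have h1 : ∀ b, groupAct d (haarProj K 0) F (scrambleDigits b 0) =
      groupAct d (haarProj K 0) F x := fun b =>
    (isHaar_haarProj hF).dep _ _ fun j i hi => absurd hi (Nat.not_lt_zero i)
  have h2 : ∫ b, groupAct d (haarProj K 0) F (scrambleDigits b 0) ∂scrLaw d =
      ∫ b, F (scrambleDigits b 0) ∂scrLaw d := by
    have h : haarProj K (0 : Fin d → ℕ) = ∏ p ∈ Finset.univ.sigma fun _ : Fin d => Finset.range K,
        avgOp (bitAt p.1 p.2) := by
      simp [haarProj, Finset.prod_sigma, levelAvg, levelDif]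
    rw [h]
    generalize (Finset.univ.sigma fun _ : Fin d => Finset.range K) = s
    classical
    induction s using Finset.induction_on with
    | empty => simp
    | insert i s hi ih =>
      rw [Finset.prod_insert hi, map_mul, ← ih]
      exact integral_groupAct_avgOp (hF.groupAct _) _ 0
  rw [← h2]
  simp [h1]

end Haar

/-! ### Midpoints of dyadic intervals -/

/-- The midpoint of the dyadic interval with the given first `K` digits. -/
noncomputable def gridPoint (K : ℕ) (s : ℕ → Bool) : ℝ :=
  ∑ i ∈ Finset.range K, (if s i then ((1 : ℝ) / 2) ^ (i + 1) else 0) + (1 / 2) ^ (K + 1)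

theorem sum_half_pow (K : ℕ) : ∑ i ∈ Finset.range K, ((1 : ℝ) / 2) ^ (i + 1) = 1 - (1 / 2) ^ K := by
  induction K with
  | zero => simp
  | succ K ih => rw [Finset.sum_range_succ, ih]; ring

theorem gridPoint_pos (K : ℕ) (s : ℕ → Bool) : 0 < gridPoint K s := by
  unfold gridPoint
  have : 0 ≤ ∑ i ∈ Finset.range K, (if s i then ((1 : ℝ) / 2) ^ (i + 1) else 0) :=
    Finset.sum_nonneg fun i _ => by split_ifs <;> positivity
  positivity

theorem gridPoint_compl (K : ℕ) (s : ℕ → Bool) :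
    gridPoint K (fun i => !s i) = 1 - gridPoint K s := by
  have h : ∑ i ∈ Finset.range K, (if (!s i) = true then ((1 : ℝ) / 2) ^ (i + 1) else 0) +
      ∑ i ∈ Finset.range K, (if s i then ((1 : ℝ) / 2) ^ (i + 1) else 0) = 1 - (1 / 2) ^ K := by
    rw [← sum_half_pow, ← Finset.sum_add_distrib]
    exact Finset.sum_congr rfl fun i _ => by cases s i <;> simp
  unfold gridPoint
  rw [pow_succ]
  linarith

theorem gridPoint_lt_one (K : ℕ) (s : ℕ → Bool) : gridPoint K s < 1 := by
  have := gridPoint_pos K fun i => !s i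
  rw [gridPoint_compl] at this
  linarith

theorem gridPoint_congr {K : ℕ} {s s' : ℕ → Bool} (h : ∀ i < K, s i = s' i) :
    gridPoint K s = gridPoint K s' := by
  unfold gridPoint
  congr 1
  exact Finset.sum_congr rfl fun i hi => by rw [h i (Finset.mem_range.1 hi)]

theorem abs_gridPoint_flip {K i : ℕ} (hi : i < K) (s : ℕ → Bool) :
    |gridPoint K s - gridPoint K (s + Pi.single i true)| = (1 / 2) ^ (i + 1) := by
  unfold gridPoint
  rw [add_sub_add_right_eq_sub, ← Finset.sum_sub_distrib, Finset.sum_eq_single i]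
  · have : (s + Pi.single i true : ℕ → Bool) i = !s i := by
      rw [Pi.add_apply, Pi.single_eq_same]; exact Bool.xor_true _
    rw [this]
    cases s i <;> simp
  · intro i' _ hne
    have : (s + Pi.single i true : ℕ → Bool) i' = s i' := by
      rw [Pi.add_apply, Pi.single_eq_of_ne hne, add_zero]
    rw [this, sub_self]
  · intro h; exact absurd (Finset.mem_range.2 hi) h

theorem gridPoint_succ (K : ℕ) (s : ℕ → Bool) :
    gridPoint (K + 1) s = ((if s 0 then 1 else 0) + gridPoint K fun i => s (i + 1)) / 2 := by
  unfold gridPoint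
  rw [Finset.sum_range_succ', pow_succ, ← add_assoc, add_div, add_div, Finset.sum_div]
  have : ∀ i, (if s (i + 1) = true then ((1 : ℝ) / 2) ^ (i + 1 + 1) else 0) =
      (if s (i + 1) = true then ((1 : ℝ) / 2) ^ (i + 1) else 0) / 2 := by
    intro i; split_ifs <;> ring
  simp_rw [this]
  split_ifs <;> ring

/-- Distance to the ends of the unit interval. -/
noncomputable def edgeDist (t : ℝ) : ℝ := min t (1 - t)

theorem edgeDist_pos {t : ℝ} (h : 0 < t ∧ t < 1) : 0 < edgeDist t :=
  lt_min h.1 (by linarith)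

theorem edgeDist_le_half (t : ℝ) : edgeDist t ≤ 1 / 2 := by
  unfold edgeDist
  rcases le_total t (1 / 2) with h | h
  · exact (min_le_left _ _).trans h
  · exact (min_le_right _ _).trans (by linarith)

/-- The bound for half a difference over a flip of level `κ` at distance `q` from the ends. -/
noncomputable def flipBound (a : ℝ) (κ : ℕ) (q : ℝ) : ℝ :=
  min (q ^ (-a)) ((1 / 2) ^ κ * q ^ (-a - 1))

theorem flipBound_nonneg {a : ℝ} {κ : ℕ} {q : ℝ} (hq : 0 ≤ q) : 0 ≤ flipBound a κ q := by
  unfold flipBound; positivity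

/-- The first term of the minimum is the triangle inequality. The second is the mean value
inequality on `[q, 1 - q]`, which contains both points and on which the derivative is at most `C * q
^ (-a - 1)`. -/
theorem abs_half_sub_le {φ φ' : ℝ → ℝ} {a C : ℝ} {κ : ℕ} (ha : 0 ≤ a) (hC : 0 ≤ C)
    (hφ : ∀ t, 0 < t ∧ t < 1 → |φ t| ≤ C * edgeDist t ^ (-a))
    (hd : ∀ t, 0 < t ∧ t < 1 → HasDerivAt φ (φ' t) t)
    (hφ' : ∀ t, 0 < t ∧ t < 1 → |φ' t| ≤ C * edgeDist t ^ (-a - 1))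
    {p p' : ℝ} (hp : 0 < p ∧ p < 1) (hp' : 0 < p' ∧ p' < 1) (hpp : |p - p'| ≤ (1 / 2) ^ κ) :
    |1 / 2 * (φ p - φ p')| ≤ C * flipBound a κ (min (edgeDist p) (edgeDist p')) := by
  set q := min (edgeDist p) (edgeDist p') with hq
  have hq0 : 0 < q := lt_min (edgeDist_pos hp) (edgeDist_pos hp')
  have hmono : ∀ (t e : ℝ), 0 ≤ e → q ≤ edgeDist t → edgeDist t ^ (-e) ≤ q ^ (-e) := fun t e he ht =>
    Real.rpow_le_rpow_of_nonpos hq0 ht (by linarith)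
  rw [flipBound, mul_min_of_nonneg _ _ hC, abs_mul, abs_of_pos (by norm_num : (0 : ℝ) < 1 / 2)]
  refine le_min ?_ ?_
  · have h1 := hφ p hp
    have h2 := hφ p' hp'
    have h3 := mul_le_mul_of_nonneg_left (hmono p a ha (min_le_left _ _)) hC
    have h4 := mul_le_mul_of_nonneg_left (hmono p' a ha (min_le_right _ _)) hC
    have h5 := abs_sub (φ p) (φ p')
    linarith
  · have hmem : ∀ t, q ≤ edgeDist t → t ∈ Set.Icc q (1 - q) := fun t ht =>
      ⟨ht.trans (min_le_left _ _), by have := ht.trans (min_le_right _ _); linarith⟩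
    have h1 := (convex_Icc q (1 - q)).norm_image_sub_le_of_norm_hasDerivWithin_le
      (f := φ) (f' := φ') (C := C * q ^ (-a - 1)) (x := p') (y := p) (fun t ht =>
        (hd t ⟨hq0.trans_le ht.1, by linarith [ht.2]⟩).hasDerivWithinAt) (fun t ht => by
        refine (hφ' t ⟨hq0.trans_le ht.1, by linarith [ht.2]⟩).trans ?_
        have := hmono t (a + 1) (by linarith) (le_min ht.1 (by linarith [ht.2]))
        rw [neg_add'] at this
        exact mul_le_mul_of_nonneg_left this hC)
      (hmem _ (min_le_right _ _)) (hmem _ (min_le_left _ _))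
    rw [Real.norm_eq_abs, Real.norm_eq_abs] at h1
    have h2 : 0 ≤ C * q ^ (-a - 1) := by positivity
    have h3 := mul_le_mul_of_nonneg_left hpp h2
    have h4 := abs_nonneg (φ p - φ p')
    linarith

/-! ### Mixed differences -/

section Mixed

variable {d : ℕ}

/-- Differences in the coordinates of `s` never move the coordinate `i`, so that coordinate can be
frozen. -/
theorem groupAct_congr_coord {s : Finset (Fin d)} {i : Fin d} (hi : i ∉ s) (κ : Fin d → ℕ)
    {f f' : Digits d → ℝ} (x : Digits d) (h : ∀ x' : Digits d, x' i = x i → f x' = f' x') :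
    groupAct d (∏ j ∈ s, levelDif j (κ j)) f x = groupAct d (∏ j ∈ s, levelDif j (κ j)) f' x := by
  induction s using Finset.induction_on generalizing x with
  | empty => simpa using h x rfl
  | insert j s hj ih =>
    rw [Finset.mem_insert, not_or] at hi
    rw [Finset.prod_insert hj, map_mul, Module.End.mul_apply, Module.End.mul_apply, levelDif]
    split_ifs
    · simpa using ih hi.2 x h
    · rw [groupAct_difOp, groupAct_difOp, ih hi.2 x h, ih hi.2]
      intro x' hx'
      refine h x' ?_
      rw [hx', Pi.add_apply, bitAt, Pi.single_eq_of_ne hi.1, add_zero]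

theorem hasDerivAt_groupAct (α : AddMonoidAlgebra ℝ (Digits d)) {f : ℝ → Digits d → ℝ}
    {f' : Digits d → ℝ} {r : ℝ} (h : ∀ x, HasDerivAt (fun t => f t x) (f' x) r) (x : Digits d) :
    HasDerivAt (fun t => groupAct d α (f t) x) (groupAct d α f' x) r := by
  induction α using groupAct_induction with
  | htr v => simpa using h (x + v)
  | hadd α β hα hβ => simpa using hα.fun_add hβ
  | hsmul c α hα => simpa using hα.const_mul c

/-- The digits of the other point of a flip of level `κ`. -/
def levelFlip (κ : ℕ) (s : ℕ → Bool) : ℕ → Bool :=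
  if κ = 0 then s else s + Pi.single (κ - 1) true

/-- The distance of the points of a flip of level `κ` to the ends. -/
noncomputable def flipDist (K κ : ℕ) (s : ℕ → Bool) : ℝ :=
  min (edgeDist (gridPoint K s)) (edgeDist (gridPoint K (levelFlip κ s)))

theorem gridPoint_mem (K : ℕ) (s : ℕ → Bool) : 0 < gridPoint K s ∧ gridPoint K s < 1 :=
  ⟨gridPoint_pos K s, gridPoint_lt_one K s⟩

theorem flipDist_pos (K κ : ℕ) (s : ℕ → Bool) : 0 < flipDist K κ s :=
  lt_min (edgeDist_pos (gridPoint_mem _ _)) (edgeDist_pos (gridPoint_mem _ _))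

/-- Differences are taken in one coordinate at a time, by induction on `s`. The set `v` of variables
already differentiated is kept arbitrary because adding a coordinate `i` needs the hypothesis for
`v` and for `insert i v`: these bound a slice in the variable `i` and its derivative. -/
theorem abs_groupAct_levelDif_le {a c : ℝ} (ha : 0 ≤ a) (hc : 0 ≤ c)
    {D : Finset (Fin d) → (Fin d → ℝ) → ℝ}
    (hderiv : ∀ u, ∀ i ∉ u, ∀ y ∈ openCube d,
      HasDerivAt (fun s => D u (Function.update y i s)) (D (insert i u) y) (y i))
    (hbound : ∀ u, ∀ y ∈ openCube d, |D u y| ≤ c * edgeWeight (fun _ => a) u y)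
    {K : ℕ} {κ : Fin d → ℕ} (hκ : ∀ j, κ j ≤ K) (s : Finset (Fin d)) :
    ∀ v, Disjoint s v → ∀ (x : Digits d) (y : Fin d → ℝ), (∀ j ∉ s, 0 < y j ∧ y j < 1) →
    |groupAct d (∏ j ∈ s, levelDif j (κ j))
      (fun x' => D v (fun j => if j ∈ s then gridPoint K (x' j) else y j)) x| ≤
      c * ∏ j, if j ∈ s then flipBound a (κ j) (flipDist K (κ j) (x j)) else
        edgeDist (y j) ^ (-a - if j ∈ v then (1 : ℝ) else 0) := by
  induction s using Finset.induction_on with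
  | empty =>
    intro v _ x y hy
    have := hbound v y fun i => hy i (Finset.notMem_empty i)
    simpa only [Finset.prod_empty, map_one, Module.End.one_apply, Finset.notMem_empty, if_false]
  | insert i s hi ih =>
    intro v hdis x y hy
    rw [Finset.disjoint_insert_left] at hdis
    obtain ⟨hiv, hsv⟩ := hdis
    set R := ∏ j ∈ s, levelDif j (κ j) with hR
    set P := ∏ j ∈ Finset.univ.erase i, if j ∈ s then flipBound a (κ j) (flipDist K (κ j) (x j)) else
        edgeDist (y j) ^ (-a - if j ∈ v then (1 : ℝ) else 0) with hP
    have hP0 : 0 ≤ P := by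
      refine Finset.prod_nonneg fun j hj => ?_
      split_ifs with h1
      · exact flipBound_nonneg (flipDist_pos _ _ _).le
      all_goals
        have := edgeDist_pos (hy j (by
          rw [Finset.mem_insert, not_or]; exact ⟨Finset.ne_of_mem_erase hj, h1⟩))
        positivity
    have hupd : ∀ t, 0 < t ∧ t < 1 → ∀ j ∉ s, 0 < Function.update y i t j ∧
        Function.update y i t j < 1 := by
      intro t ht j hj
      by_cases h : j = i
      · subst h; simpa using ht
      · rw [Function.update_of_ne h]; exact hy j (by simp [h, hj])
    -- The slice: the differences over `s` have been taken, and the coordinate `i` is a free real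
    -- variable.
    let φ : Finset (Fin d) → ℝ → ℝ := fun w t => groupAct d R (fun x' => D w (fun j =>
      if j ∈ s then gridPoint K (x' j) else Function.update y i t j)) x
    have hprod : ∀ (w : Finset (Fin d)) (t : ℝ), (∀ j ≠ i, j ∈ w ↔ j ∈ v) →
        (∏ j, if j ∈ s then flipBound a (κ j) (flipDist K (κ j) (x j)) else
        edgeDist (Function.update y i t j) ^ (-a - if j ∈ w then (1 : ℝ) else 0)) =
        edgeDist t ^ (-a - if i ∈ w then (1 : ℝ) else 0) * P := by
      intro w t hw
      rw [← Finset.mul_prod_erase _ _ (Finset.mem_univ i), if_neg hi, Function.update_self]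
      congr 1
      refine Finset.prod_congr rfl fun j hj => ?_
      have hne := Finset.ne_of_mem_erase hj
      rw [Function.update_of_ne hne]
      simp only [hw j hne]
    have hφ : ∀ t, 0 < t ∧ t < 1 → |φ v t| ≤ (c * P) * edgeDist t ^ (-a) := by
      intro t ht
      have := ih v hsv x (Function.update y i t) (hupd t ht)
      rw [hprod v t (fun _ _ => Iff.rfl), if_neg hiv, sub_zero] at this
      exact this.trans (le_of_eq (by ring))
    have hφ' : ∀ t, 0 < t ∧ t < 1 → |φ (insert i v) t| ≤ (c * P) * edgeDist t ^ (-a - 1) := by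
      intro t ht
      have := ih (insert i v) (Finset.disjoint_insert_right.2 ⟨hi, hsv⟩) x (Function.update y i t)
        (hupd t ht)
      rw [hprod (insert i v) t (fun j hj => by simp [hj]), if_pos (Finset.mem_insert_self _ _)] at this
      exact this.trans (le_of_eq (by ring))
    have hd : ∀ t, 0 < t ∧ t < 1 → HasDerivAt (φ v) (φ (insert i v) t) t := by
      intro t ht
      refine hasDerivAt_groupAct R (fun x' => ?_) x
      set z : Fin d → ℝ := fun j => if j ∈ s then gridPoint K (x' j) else Function.update y i t j
        with hz
      have hzc : z ∈ openCube d := by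
        intro j
        simp only [hz]
        split_ifs with hj
        · exact gridPoint_mem _ _
        · exact hupd t ht j hj
      have h1 := hderiv v i hiv z hzc
      have h2 : z i = t := by simp [hz, hi]
      rw [h2] at h1
      convert h1 using 3 with r
      funext j
      by_cases h : j = i
      · subst h; simp [hi]
      · simp [h, hz]
    have hmain : ∀ x₁ : Digits d, (∀ j ≠ i, x₁ j = x j) → groupAct d R (fun x' => D v (fun j =>
        if j ∈ insert i s then gridPoint K (x' j) else y j)) x₁ = φ v (gridPoint K (x₁ i)) := by
      intro x₁ hx₁
      rw [hR, groupAct_congr_coord hi κ x₁ (f' := fun x' => D v (fun j =>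
        if j ∈ s then gridPoint K (x' j) else Function.update y i (gridPoint K (x₁ i)) j))]
      -- The two arrays differ by a translation in the coordinate `i`, which commutes with `R` and
      -- acts trivially once that coordinate is frozen.
      · have h1 : x₁ = x + Pi.single i (x₁ i + x i) := by
          funext j
          by_cases h : j = i
          · subst h
            funext l
            simp only [Pi.add_apply, Pi.single_eq_same]
            cases x₁ j l <;> cases x j l <;> rfl
          · rw [Pi.add_apply, Pi.single_eq_of_ne h, add_zero, hx₁ j h]
        have h2 : ∀ F : Digits d → ℝ, groupAct d R F x₁ =
            groupAct d R (groupAct d (tr (Pi.single i (x₁ i + x i))) F) x := by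
          intro F
          conv_lhs => rw [h1]
          rw [← groupAct_mul_tr_left, mul_comm, map_mul, Module.End.mul_apply]
        rw [← hR, h2]
        refine congrFun (congrArg (groupAct d R) (funext fun x' => ?_)) x
        rw [groupAct_tr]
        congr 1
        funext j
        by_cases h : j = i
        · subst h; simp [hi]
        · rw [Pi.add_apply, Pi.single_eq_of_ne h, add_zero]
      · intro x' hx'
        congr 1
        funext j
        by_cases h : j = i
        · subst h; simp [hx', hi]
        · simp [h]
    have hrhs : (∏ j, if j ∈ insert i s then flipBound a (κ j) (flipDist K (κ j) (x j)) else
        edgeDist (y j) ^ (-a - if j ∈ v then (1 : ℝ) else 0)) =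
        flipBound a (κ i) (flipDist K (κ i) (x i)) * P := by
      rw [← Finset.mul_prod_erase _ _ (Finset.mem_univ i), if_pos (Finset.mem_insert_self _ _)]
      congr 1
      refine Finset.prod_congr rfl fun j hj => ?_
      simp [Finset.ne_of_mem_erase hj]
    rw [hrhs, Finset.prod_insert hi, map_mul, Module.End.mul_apply, ← mul_assoc,
      mul_right_comm c]
    have hxp := gridPoint_mem K (x i)
    -- At level zero there is no difference, and `flipBound` reduces to the value bound because
    -- distances to the ends are at most one.
    by_cases hκi : κ i = 0
    · rw [levelDif, if_pos hκi, map_one, Module.End.one_apply, hmain x (fun _ _ => rfl)]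
      refine (hφ _ hxp).trans (mul_le_mul_of_nonneg_left ?_ (mul_nonneg hc hP0))
      rw [flipBound, flipDist, levelFlip, if_pos hκi, hκi, min_self, pow_zero, one_mul]
      refine le_min le_rfl ?_
      exact Real.rpow_le_rpow_of_exponent_ge (edgeDist_pos hxp)
        ((edgeDist_le_half _).trans (by norm_num)) (by linarith)
    · rw [levelDif, if_neg hκi, groupAct_difOp, hmain x (fun _ _ => rfl), hmain (x + bitAt i _)]
      · have h1 : (x + bitAt i (κ i - 1)) i = levelFlip (κ i) (x i) := by
          rw [levelFlip, if_neg hκi, Pi.add_apply, bitAt, Pi.single_eq_same]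
        rw [h1]
        refine abs_half_sub_le ha (mul_nonneg hc hP0) hφ hd hφ' hxp (gridPoint_mem _ _) ?_
        rw [levelFlip, if_neg hκi, abs_gridPoint_flip (by have := hκ i; omega)]
        exact le_of_eq (by congr 1; omega)
      · intro j hj
        rw [Pi.add_apply, bitAt, Pi.single_eq_of_ne hj, add_zero]

end Mixed

/-! ### Means over dyadic grids -/

/-- Extension of finitely many binary digits by zeros. -/
def extBits {K : ℕ} (v : Fin K → Bool) : ℕ → Bool := fun i => if h : i < K then v ⟨i, h⟩ else false

/-- The mean over the midpoints of the dyadic intervals of length `2 ^ (-K)`. -/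
noncomputable def gridMean (K : ℕ) (h : ℝ → ℝ) : ℝ :=
  (2 ^ K : ℝ)⁻¹ * ∑ v : Fin K → Bool, h (gridPoint K (extBits v))

theorem gridMean_mono {K : ℕ} {h h' : ℝ → ℝ} (hh : ∀ q, 0 < q → q < 1 → h q ≤ h' q) :
    gridMean K h ≤ gridMean K h' := by
  unfold gridMean
  gcongr
  exact hh _ (gridPoint_pos _ _) (gridPoint_lt_one _ _)

theorem gridMean_const_mul (K : ℕ) (c : ℝ) (h : ℝ → ℝ) :
    gridMean K (fun q => c * h q) = c * gridMean K h := by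
  unfold gridMean
  rw [← Finset.mul_sum]; ring

theorem gridMean_const (K : ℕ) (c : ℝ) : gridMean K (fun _ => c) = c := by
  unfold gridMean
  simp

/-- The finer grid consists of two half-size copies of the coarser one. This self-similarity drives
the estimates of means by recursion. -/
theorem gridMean_succ (K : ℕ) (h : ℝ → ℝ) : gridMean (K + 1) h =
    1 / 2 * gridMean K (fun q => h ((1 + q) / 2)) + 1 / 2 * gridMean K (fun q => h (q / 2)) := by
  unfold gridMean
  have h1 : ∀ (b : Bool) (w : Fin K → Bool),
      gridPoint (K + 1) (extBits (Fin.cons b w : Fin (K + 1) → Bool)) =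
        ((if b then 1 else 0) + gridPoint K (extBits w)) / 2 := by
    intro b w
    rw [gridPoint_succ]
    have h2 : extBits (Fin.cons b w : Fin (K + 1) → Bool) 0 = b := by simp [extBits]
    have h3 : (fun i => extBits (Fin.cons b w : Fin (K + 1) → Bool) (i + 1)) = extBits w := by
      funext i
      simp only [extBits, Nat.add_lt_add_iff_right]
      split_ifs
      · exact Fin.cons_succ (α := fun _ => Bool) b w ⟨i, _⟩
      · rfl
    rw [h2, h3]
  rw [← (Fin.consEquiv fun _ => Bool).sum_comp, Fintype.sum_prod_type, Fintype.sum_bool]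
  have h4 : ∀ (b : Bool) (w : Fin K → Bool),
      (Fin.consEquiv fun _ : Fin (K + 1) => Bool) (b, w) = Fin.cons b w := fun _ _ => rfl
  simp only [h4, h1, if_true, Bool.false_eq_true, if_false, zero_add]
  rw [pow_succ]
  field_simp

theorem gridMean_one_sub (K : ℕ) (h : ℝ → ℝ) : gridMean K (fun q => h (1 - q)) = gridMean K h := by
  unfold gridMean
  congr 1
  refine Fintype.sum_equiv (Equiv.piCongrRight fun _ => Equiv.boolNot) _ _ fun v => ?_
  change h (1 - _) = _
  rw [← gridPoint_compl]
  congr 1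
  refine gridPoint_congr fun i hi => ?_
  simp [extBits, hi]

theorem sum_levelFlip {K κ : ℕ} (hκ : κ ≤ K) (h : ℝ → ℝ) :
    ∑ v : Fin K → Bool, h (gridPoint K (levelFlip κ (extBits v))) =
      ∑ v : Fin K → Bool, h (gridPoint K (extBits v)) := by
  by_cases h0 : κ = 0
  · simp [levelFlip, h0]
  · refine Fintype.sum_equiv (Equiv.addRight (Pi.single ⟨κ - 1, by omega⟩ true)) _ _ fun v => ?_
    congr 1
    refine gridPoint_congr fun i hi => ?_
    rw [levelFlip, if_neg h0]
    simp only [extBits, hi, dif_pos, Pi.add_apply, Equiv.coe_addRight]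
    congr 1
    by_cases hi' : i = κ - 1
    · subst hi'; simp
    · rw [Pi.single_eq_of_ne hi', Pi.single_eq_of_ne]
      simpa [Fin.ext_iff] using hi'

/-- A bound for the means of a power. -/
noncomputable def powBound (b : ℝ) : ℝ := 2 ^ b / (1 - 2 ^ b / 2)

theorem two_rpow_lt {b : ℝ} (hb : b < 1) : (2 : ℝ) ^ b / 2 < 1 := by
  have := Real.rpow_lt_rpow_of_exponent_lt (one_lt_two : (1 : ℝ) < 2) hb
  rw [Real.rpow_one] at this
  linarith

theorem powBound_pos {b : ℝ} (hb : b < 1) : 0 < powBound b := by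
  have := two_rpow_lt hb
  unfold powBound
  have h : 0 < 1 - (2 : ℝ) ^ b / 2 := by linarith
  positivity

theorem div_two_rpow {q : ℝ} (hq : 0 < q) (e : ℝ) : (q / 2) ^ (-e) = 2 ^ e * q ^ (-e) := by
  rw [Real.div_rpow hq.le (by norm_num), Real.rpow_neg (by norm_num : (0 : ℝ) ≤ 2), div_inv_eq_mul,
    mul_comm]

theorem half_rpow_le {q : ℝ} (hq : 1 / 2 ≤ q) {e : ℝ} (he : 0 ≤ e) : q ^ (-e) ≤ 2 ^ e := by
  calc q ^ (-e) ≤ (1 / 2 : ℝ) ^ (-e) :=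
        Real.rpow_le_rpow_of_nonpos (by norm_num) hq (by linarith)
    _ = 2 ^ e := by rw [div_two_rpow one_pos, Real.one_rpow, mul_one]

/-- The half away from zero contributes at most `2 ^ b / 2`, and the other half reproduces the mean
with factor `2 ^ b / 2 < 1`. The bound `powBound b` solves `P = 2 ^ b + (2 ^ b / 2) * P`, which
leaves enough room for the recursion and for its start. -/
theorem gridMean_rpow_le {b : ℝ} (hb0 : 0 ≤ b) (hb : b < 1) (K : ℕ) :
    gridMean K (fun q => q ^ (-b)) ≤ powBound b := by
  have h1 := two_rpow_lt hb
  have h2 : (0 : ℝ) < 2 ^ b := by positivity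
  have h3 : 0 < 1 - (2 : ℝ) ^ b / 2 := by linarith
  have h4 : powBound b * (1 - 2 ^ b / 2) = 2 ^ b := div_mul_cancel₀ _ h3.ne'
  induction K with
  | zero =>
    have h5 : gridMean 0 (fun q => q ^ (-b)) = 2 ^ b := by
      simp only [gridMean, gridPoint]
      have := div_two_rpow one_pos b
      simpa using this
    rw [h5]
    have := powBound_pos hb
    nlinarith
  | succ K ih =>
    rw [gridMean_succ]
    have h5 : gridMean K (fun q => ((1 + q) / 2) ^ (-b)) ≤ 2 ^ b :=
      (gridMean_mono fun q hq _ => half_rpow_le (by linarith) hb0).trans_eq (gridMean_const _ _)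
    have h6 : gridMean K (fun q => (q / 2) ^ (-b)) ≤ 2 ^ b * powBound b := by
      refine (gridMean_mono fun q hq _ => (div_two_rpow hq b).le).trans ?_
      rw [gridMean_const_mul]
      gcongr
    nlinarith

theorem flipBound_div_two {a q : ℝ} (hq : 0 < q) (κ : ℕ) :
    flipBound a (κ + 1) (q / 2) = 2 ^ a * flipBound a κ q := by
  unfold flipBound
  rw [mul_min_of_nonneg _ _ (by positivity), div_two_rpow hq, ← neg_add', div_two_rpow hq,
    Real.rpow_add_one (by norm_num), pow_succ]
  congr 1
  ring

/-- Near zero, halving `q` and raising the level by one multiplies `flipBound` by `2 ^ a`, hence the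
factor `4 ^ a / 2` per level. The half away from zero is smooth and adds only a term of order `4 ^
(-κ)`. -/
theorem gridMean_flipBound_sq_le {a : ℝ} (ha0 : 0 ≤ a) (ha : a < 1 / 2) {κ K : ℕ} (hκ : κ ≤ K) :
    gridMean K (fun q => flipBound a κ q ^ 2) ≤ (4 ^ a / 2) ^ κ * (powBound (2 * a) + 8) := by
  -- The factor `1 - (1 / 2) ^ κ` leaves room in the induction for the smooth half, which adds `8 *
  -- (1 / 2) ^ (κ + 1)` times at most `(4 ^ a / 2) ^ (κ + 1)`.
  suffices h : gridMean K (fun q => flipBound a κ q ^ 2) ≤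
      (4 ^ a / 2) ^ κ * (powBound (2 * a) + 8 * (1 - (1 / 2) ^ κ)) by
    refine h.trans ?_
    gcongr
    have : (0 : ℝ) < (1 / 2) ^ κ := by positivity
    linarith
  have h4a : ((2 : ℝ) ^ a) ^ 2 = 4 ^ a := by
    rw [← Real.rpow_natCast, ← Real.rpow_mul (by norm_num), mul_comm, Real.rpow_mul (by norm_num)]
    norm_num
  have h4a1 : (1 : ℝ) ≤ 4 ^ a := Real.one_le_rpow (by norm_num) ha0
  have h4a2 : (4 : ℝ) ^ a ≤ 2 := by
    have := Real.rpow_le_rpow_of_exponent_le (by norm_num : (1 : ℝ) ≤ 4) ha.le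
    rw [← Real.sqrt_eq_rpow, show (4 : ℝ) = 2 ^ 2 by norm_num, Real.sqrt_sq (by norm_num)] at this
    convert this using 2
    norm_num
  induction κ generalizing K with
  | zero =>
    simp only [pow_zero, one_mul, sub_self, mul_zero, add_zero]
    refine le_trans (gridMean_mono fun q hq hq1 => ?_)
      (gridMean_rpow_le (by linarith) (by linarith) K)
    have h1 : flipBound a 0 q ≤ q ^ (-a) := min_le_left _ _
    have h2 := flipBound_nonneg (a := a) (κ := 0) hq.le
    calc flipBound a 0 q ^ 2 ≤ (q ^ (-a)) ^ 2 := by gcongr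
      _ = q ^ (-(2 * a)) := by
        rw [← Real.rpow_natCast, ← Real.rpow_mul hq.le]; congr 1; push_cast; ring
  | succ κ ih =>
    obtain ⟨K, rfl⟩ : ∃ K', K = K' + 1 := ⟨K - 1, by omega⟩
    have ih := ih (K := K) (by omega)
    rw [gridMean_succ]
    have h5 : gridMean K (fun q => flipBound a (κ + 1) ((1 + q) / 2) ^ 2) ≤
        16 * ((1 / 2) ^ (κ + 1)) ^ 2 := by
      refine le_trans (gridMean_mono fun q hq _ => ?_) (gridMean_const _ _).le
      have h2 : flipBound a (κ + 1) ((1 + q) / 2) ≤ (1 / 2) ^ (κ + 1) * 4 := by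
        refine (min_le_right _ _).trans ?_
        gcongr
        rw [← neg_add']
        refine (half_rpow_le (by linarith) (by linarith)).trans ?_
        calc (2 : ℝ) ^ (a + 1) ≤ 2 ^ (2 : ℝ) :=
              Real.rpow_le_rpow_of_exponent_le (by norm_num) (by linarith)
          _ = 4 := by norm_num
      calc flipBound a (κ + 1) ((1 + q) / 2) ^ 2 ≤ ((1 / 2) ^ (κ + 1) * 4) ^ 2 := by
            have := flipBound_nonneg (a := a) (κ := κ + 1) (q := (1 + q) / 2) (by linarith)
            gcongr
        _ = _ := by ring
    have h6 : gridMean K (fun q => flipBound a (κ + 1) (q / 2) ^ 2) ≤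
        4 ^ a * ((4 ^ a / 2) ^ κ * (powBound (2 * a) + 8 * (1 - (1 / 2) ^ κ))) := by
      refine (gridMean_mono fun q hq _ => ?_).trans ((gridMean_const_mul K (4 ^ a)
        (fun q => flipBound a κ q ^ 2)).trans_le (by gcongr))
      rw [flipBound_div_two hq, mul_pow, h4a]
    have h7 : ((1 / 2 : ℝ) ^ (κ + 1)) ≤ (4 ^ a / 2) ^ (κ + 1) := by
      gcongr
    have h8 : (0 : ℝ) < (1 / 2) ^ (κ + 1) := by positivity
    have h9 := mul_le_mul_of_nonneg_right h7 h8.le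
    have h10 : ((1 : ℝ) / 2) ^ κ = 2 * (1 / 2) ^ (κ + 1) := by ring
    rw [h10] at h6
    rw [pow_succ ((4 : ℝ) ^ a / 2)] at h9 ⊢
    nlinarith

/-- The distance is one of four numbers, the two points and their reflections. Each of them runs
over the whole grid as `v` varies, whence the factor 4. -/
theorem mean_flipDist_sq_le {a : ℝ} (ha0 : 0 ≤ a) (ha : a < 1 / 2) {κ K : ℕ} (hκ : κ ≤ K) :
    (2 ^ K : ℝ)⁻¹ * ∑ v : Fin K → Bool, flipBound a κ (flipDist K κ (extBits v)) ^ 2 ≤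
      (4 ^ a / 2) ^ κ * (4 * (powBound (2 * a) + 8)) := by
  set g : ℝ → ℝ := fun q => flipBound a κ q ^ 2 with hg
  have h1 : ∀ v : Fin K → Bool, g (flipDist K κ (extBits v)) ≤
      (g (gridPoint K (extBits v)) + g (1 - gridPoint K (extBits v))) +
      (g (gridPoint K (levelFlip κ (extBits v))) + g (1 - gridPoint K (levelFlip κ (extBits v)))) := by
    intro v
    have h0 : ∀ q, 0 ≤ g q := fun q => sq_nonneg _
    have h2 := h0 (gridPoint K (extBits v))
    have h3 := h0 (1 - gridPoint K (extBits v))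
    have h4 := h0 (gridPoint K (levelFlip κ (extBits v)))
    have h5 := h0 (1 - gridPoint K (levelFlip κ (extBits v)))
    unfold flipDist edgeDist
    rcases min_choice (min (gridPoint K (extBits v)) (1 - gridPoint K (extBits v)))
      (min (gridPoint K (levelFlip κ (extBits v))) (1 - gridPoint K (levelFlip κ (extBits v))))
      with h | h <;> rw [h]
    · rcases min_choice (gridPoint K (extBits v)) (1 - gridPoint K (extBits v)) with h' | h' <;>
        rw [h'] <;> linarith
    · rcases min_choice (gridPoint K (levelFlip κ (extBits v)))
        (1 - gridPoint K (levelFlip κ (extBits v))) with h' | h' <;> rw [h'] <;> linarith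
  have h2 := gridMean_flipBound_sq_le ha0 ha hκ
  have h3 := gridMean_one_sub K g
  have h4 := sum_levelFlip hκ g
  have h5 := sum_levelFlip hκ fun q => g (1 - q)
  calc _ ≤ (2 ^ K : ℝ)⁻¹ * ∑ v : Fin K → Bool,
        ((g (gridPoint K (extBits v)) + g (1 - gridPoint K (extBits v))) +
        (g (gridPoint K (levelFlip κ (extBits v))) +
          g (1 - gridPoint K (levelFlip κ (extBits v))))) := by
        gcongr with v _
        exact h1 v
    _ = 4 * gridMean K g := by
        rw [Finset.sum_add_distrib, Finset.sum_add_distrib, Finset.sum_add_distrib, h4, h5]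
        unfold gridMean at h3 ⊢
        linear_combination 2 * h3
    _ ≤ _ := by linarith

section

variable {d : ℕ}

theorem sum_prod_extDigits (K : ℕ) (h : Fin d → (ℕ → Bool) → ℝ) :
    (2 ^ (d * K) : ℝ)⁻¹ * ∑ v : Fin d → Fin K → Bool, ∏ j, h j (extDigits v j) =
      ∏ j, ((2 ^ K : ℝ)⁻¹ * ∑ w : Fin K → Bool, h j (extBits w)) := by
  rw [Finset.prod_mul_distrib, Finset.prod_univ_sum, Fintype.piFinset_univ, Finset.prod_const,
    Finset.card_univ, Fintype.card_fin, inv_pow, ← pow_mul, mul_comm K]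
  rfl

/-- The discretization of a function to the dyadic grid. -/
noncomputable def gridFn (K : ℕ) (φ : (Fin d → ℝ) → ℝ) (x : Digits d) : ℝ :=
  φ fun j => gridPoint K (x j)

theorem firstDigits_gridFn (K : ℕ) (φ : (Fin d → ℝ) → ℝ) : FirstDigits K (gridFn K φ) := by
  intro x x' h
  unfold gridFn
  congr 1
  funext j
  exact gridPoint_congr (h j)

/-- The bound for the mixed difference is a product over the coordinates and the digits are uniform,
so its mean square factorizes into one-dimensional means. The ratio `4 ^ a / 2` is below one because
`a < 1 / 2`. -/
theorem integral_haarProj_gridFn_sq_le {φ : (Fin d → ℝ) → ℝ} {c a : ℝ} (ha0 : 0 ≤ a)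
    (ha : a < 1 / 2) (hc : 0 ≤ c) (hφ : BoundaryGrowth φ c fun _ => a) {K : ℕ} {κ : Fin d → ℕ}
    (hκ : ∀ j, κ j ≤ K) :
    ∫ b, groupAct d (haarProj K κ) (gridFn K φ) (scrambleDigits b 0) ^ 2 ∂scrLaw d ≤
      c ^ 2 * (4 * (powBound (2 * a) + 8)) ^ d * (4 ^ a / 2) ^ (∑ j, κ j) := by
  obtain ⟨D, hD0, -, hderiv, hbound⟩ := hφ
  refine (integral_haarProj_sq_le (firstDigits_gridFn K φ) κ 0).trans ?_
  have h1 : ∀ x : Digits d, groupAct d (∏ j, levelDif j (κ j)) (gridFn K φ) x ^ 2 ≤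
      c ^ 2 * ∏ j, flipBound a (κ j) (flipDist K (κ j) (x j)) ^ 2 := by
    intro x
    have h2 := abs_groupAct_levelDif_le ha0 hc hderiv hbound hκ Finset.univ ∅
      (Finset.disjoint_empty_right _) x 0 (by simp)
    simp only [Finset.mem_univ, if_true] at h2
    have h3 : (fun x' : Digits d => D ∅ fun j => gridPoint K (x' j)) = gridFn K φ :=
      funext fun x' => hD0 _ fun j => gridPoint_mem _ _
    rw [h3] at h2
    rw [Finset.prod_pow, ← mul_pow, ← sq_abs]
    gcongr
  rw [integral_scramble_eq_sum ((firstDigits_gridFn K φ).groupAct _).sq]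
  calc _ ≤ (2 ^ (d * K) : ℝ)⁻¹ * ∑ v : Fin d → Fin K → Bool,
        c ^ 2 * ∏ j, flipBound a (κ j) (flipDist K (κ j) (extDigits v j)) ^ 2 := by
        gcongr with v _
        exact h1 _
    _ = c ^ 2 * ∏ j, ((2 ^ K : ℝ)⁻¹ *
        ∑ w : Fin K → Bool, flipBound a (κ j) (flipDist K (κ j) (extBits w)) ^ 2) := by
        rw [← Finset.mul_sum, mul_left_comm,
          sum_prod_extDigits K fun j s => flipBound a (κ j) (flipDist K (κ j) s) ^ 2]
    _ ≤ c ^ 2 * ∏ j, ((4 ^ a / 2) ^ κ j * (4 * (powBound (2 * a) + 8))) := by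
        refine mul_le_mul_of_nonneg_left (Finset.prod_le_prod (fun j _ => ?_) fun j _ =>
          mean_flipDist_sq_le ha0 ha (hκ j)) (sq_nonneg c)
        positivity
    _ = _ := by
        rw [Finset.prod_mul_distrib, Finset.prod_pow_eq_pow_sum, Finset.prod_const,
          Finset.card_univ, Fintype.card_fin]
        ring

end

/-! ### The error of scrambled Sobol' points for discretized functions -/

/-- The sum of a geometric series of ratio `2 ^ (-δ)`. -/
noncomputable def geomConst (δ : ℝ) : ℝ := (1 - 2 ^ (-δ))⁻¹

theorem two_rpow_neg_lt_one {δ : ℝ} (hδ : 0 < δ) : (2 : ℝ) ^ (-δ) < 1 :=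
  Real.rpow_lt_one_of_one_lt_of_neg (by norm_num) (by linarith)

theorem one_le_geomConst {δ : ℝ} (hδ : 0 < δ) : 1 ≤ geomConst δ := by
  have h1 := two_rpow_neg_lt_one hδ
  have h2 : (0 : ℝ) < 2 ^ (-δ) := by positivity
  exact (one_le_inv₀ (by linarith)).2 (by linarith)

theorem geomConst_anti {δ δ' : ℝ} (hδ : 0 < δ) (h : δ ≤ δ') : geomConst δ' ≤ geomConst δ := by
  have h1 := two_rpow_neg_lt_one hδ
  have h2 : (2 : ℝ) ^ (-δ') ≤ 2 ^ (-δ) := Real.rpow_le_rpow_of_exponent_le (by norm_num) (by linarith)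
  exact inv_anti₀ (by linarith) (by linarith)

theorem sum_pow_le_geomConst {δ : ℝ} (hδ : 0 < δ) (K : ℕ) :
    ∑ i ∈ Finset.range K, ((2 : ℝ) ^ (-δ)) ^ i ≤ geomConst δ := by
  have h1 := two_rpow_neg_lt_one hδ
  have h2 : (0 : ℝ) < 2 ^ (-δ) := by positivity
  rw [geomConst, ← tsum_geometric_of_lt_one h2.le h1]
  exact (summable_geometric_of_lt_one h2.le h1).sum_le_tsum _ fun i _ => by positivity

theorem sum_levelBox_le {d : ℕ} {δ : ℝ} (hδ : 0 < δ) (K : ℕ) :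
    ∑ κ ∈ levelBox d K, ((2 : ℝ) ^ (-δ)) ^ (∑ j, κ j) ≤ geomConst δ ^ d := by
  have h1 : ∑ κ ∈ levelBox d K, ((2 : ℝ) ^ (-δ)) ^ (∑ j, κ j) =
      ∏ _j : Fin d, ∑ i ∈ Finset.range (K + 1), ((2 : ℝ) ^ (-δ)) ^ i := by
    rw [Finset.prod_univ_sum]
    exact Finset.sum_congr rfl fun κ _ => (Finset.prod_pow_eq_pow_sum _ _ _).symm
  rw [h1, Finset.prod_const, Finset.card_univ, Fintype.card_fin]
  exact pow_le_pow_left₀ (Finset.sum_nonneg fun i _ => by positivity) (sum_pow_le_geomConst hδ _) d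

theorem eLpNorm_two_le {Ω : Type*} [MeasurableSpace Ω] {μ : Measure Ω} {G : Ω → ℝ}
    (hG : MemLp G 2 μ) {r : ℝ} (hr : 0 ≤ r) (h : ∫ ω, G ω ^ 2 ∂μ ≤ r ^ 2) :
    eLpNorm G 2 μ ≤ ENNReal.ofReal r := by
  rw [hG.eLpNorm_eq_integral_rpow_norm (by norm_num) (by norm_num)]
  refine ENNReal.ofReal_le_ofReal ?_
  simp only [ENNReal.toReal_ofNat, Real.rpow_ofNat, Real.norm_eq_abs, sq_abs]
  rw [← Real.sqrt_sq hr, ← one_div, ← Real.sqrt_eq_rpow]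
  exact Real.sqrt_le_sqrt h

section

variable {d : ℕ} (S : SobolData d)

/-- The constant for a dyadic block. -/
noncomputable def blockConst (a : ℝ) : ℝ :=
  √(2 ^ (S.quality + d)) * √(4 * (powBound (2 * a) + 8)) ^ d * 2 ^ S.quality *
    geomConst (1 / 2 - a) ^ d

/-- Only levels with `∑ κ j` above `k - q` count. Most of the decay is spent on this threshold, and
a part `2 ^ (-δ)` per level is kept to sum over all the vectors `κ`; this replaces a power of `k` by
the loss `ε` in the exponent. -/
theorem sum_levels_le {a ε : ℝ} (ha₀ : 0 ≤ a) (ha : a < 1 / 2) (hε : 0 < ε) (q k K : ℕ) :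
    ∑ κ ∈ levelBox d K, (if k < ∑ j, κ j + q then √(4 ^ a / 2) ^ (∑ j, κ j) else 0) ≤
      2 ^ q * geomConst (1 / 2 - a) ^ d * geomConst ε ^ d *
        (2 : ℝ) ^ ((k : ℝ) * (a + ε) - k / 2) := by
  set β := 1 / 2 - a with hβ
  have hβ0 : 0 < β := by linarith
  -- The decay kept for summation can exceed neither the total decay `β` nor the allowed loss `ε`.
  set δ := min ε β with hδ
  have hδ0 : 0 < δ := lt_min hε hβ0
  have hδε : δ ≤ ε := min_le_left _ _
  have hδβ : δ ≤ β := min_le_right _ _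
  have hθ : √((4 : ℝ) ^ a / 2) = 2 ^ (-β) := by
    rw [Real.sqrt_eq_iff_mul_self_eq (by positivity) (by positivity), ← Real.rpow_add (by norm_num),
      show (4 : ℝ) = 2 ^ (2 : ℝ) by norm_num, ← Real.rpow_mul (by norm_num)]
    rw [show -β + -β = 2 * a - 1 by rw [hβ]; ring, Real.rpow_sub_one (by norm_num)]
  have hgeo : geomConst δ ^ d ≤ geomConst β ^ d * geomConst ε ^ d := by
    rw [← mul_pow]
    have h1 := one_le_geomConst hε
    have h2 := one_le_geomConst hβ0
    have h3 := one_le_geomConst hδ0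
    refine pow_le_pow_left₀ (by linarith) ?_ d
    rcases min_choice ε β with h | h
    · rw [hδ, h]; nlinarith
    · rw [hδ, h]; nlinarith
  calc _ ≤ ∑ κ ∈ levelBox d K, (2 : ℝ) ^ (-((β - δ) * ((k : ℝ) - q))) *
        ((2 : ℝ) ^ (-δ)) ^ (∑ j, κ j) := by
        refine Finset.sum_le_sum fun κ _ => ?_
        split_ifs with h
        · rw [hθ, ← Real.rpow_natCast, ← Real.rpow_natCast, ← Real.rpow_mul (by norm_num),
            ← Real.rpow_mul (by norm_num), ← Real.rpow_add (by norm_num)]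
          refine Real.rpow_le_rpow_of_exponent_le (by norm_num) ?_
          have h1 : (k : ℝ) ≤ (∑ j, κ j : ℕ) + q := by exact_mod_cast h.le
          nlinarith [mul_le_mul_of_nonneg_left h1 (sub_nonneg.2 hδβ)]
        · positivity
    _ ≤ (2 : ℝ) ^ (-((β - δ) * ((k : ℝ) - q))) * geomConst δ ^ d := by
        rw [← Finset.mul_sum]
        gcongr
        exact sum_levelBox_le hδ0 K
    _ ≤ (2 ^ q * 2 ^ ((k : ℝ) * (a + ε) - k / 2)) * (geomConst β ^ d * geomConst ε ^ d) := by
        have h2 := one_le_geomConst hδ0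
        refine mul_le_mul ?_ hgeo (by positivity) (by positivity)
        rw [← Real.rpow_natCast 2 q, ← Real.rpow_add (by norm_num)]
        refine Real.rpow_le_rpow_of_exponent_le (by norm_num) ?_
        have hk : (0 : ℝ) ≤ k := Nat.cast_nonneg k
        have hq : (0 : ℝ) ≤ q := Nat.cast_nonneg q
        have h3 : β - δ ≤ 1 := by linarith
        nlinarith [mul_le_mul_of_nonneg_left hδε hk, mul_nonneg hq (sub_nonneg.2 h3)]
    _ = _ := by ring

/-- Low levels cancel exactly on the block. For the others the bounds on gain and decay are
combined, and the triangle inequality in `L²` sums the levels. -/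
theorem eLpNorm_block_le {φ : (Fin d → ℝ) → ℝ} {c a ε : ℝ} (ha0 : 0 ≤ a)
    (ha : a < 1 / 2) (hc : 0 ≤ c) (hφ : BoundaryGrowth φ c fun _ => a) (hε : 0 < ε) (K k m : ℕ) :
    eLpNorm (fun b => ∑ n ∈ dyadicBlock k m, (gridFn K φ (scrambleDigits b (S.digits n)) -
      ∫ b', gridFn K φ (scrambleDigits b' 0) ∂scrLaw d)) 2 (scrLaw d) ≤
      ENNReal.ofReal (c * blockConst S a * geomConst ε ^ d * ((2 : ℝ) ^ (a + ε)) ^ k) := by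
  set F := gridFn K φ with hF
  have hFd := firstDigits_gridFn K φ
  have hzero : (0 : Fin d → ℕ) ∈ levelBox d K := by simp [levelBox]
  have h1 : ∀ b, ∑ n ∈ dyadicBlock k m, (F (scrambleDigits b (S.digits n)) -
      ∫ b', F (scrambleDigits b' 0) ∂scrLaw d) = ∑ κ ∈ (levelBox d K).erase 0,
      ∑ n ∈ dyadicBlock k m, groupAct d (haarProj K κ) F (scrambleDigits b (S.digits n)) := by
    intro b
    rw [Finset.sum_comm]
    refine Finset.sum_congr rfl fun n _ => ?_
    rw [← groupAct_haarProj_zero hFd (scrambleDigits b (S.digits n)),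
      ← sum_groupAct_haarProj K F (scrambleDigits b (S.digits n)), ← Finset.add_sum_erase _ _ hzero,
      ← hF, add_sub_cancel_left]
  have hmem : ∀ κ, MemLp (fun b => ∑ n ∈ dyadicBlock k m,
      groupAct d (haarProj K κ) F (scrambleDigits b (S.digits n))) 2 (scrLaw d) := fun κ =>
    memLp_finsetSum _ fun n _ => (hFd.groupAct _).memLp _ 2
  set T := c * √(4 * (powBound (2 * a) + 8)) ^ d * √(2 ^ (S.quality + d)) * √2 ^ k with hT
  have hT0 : 0 ≤ T := by positivity
  have h2 : ∀ κ ∈ (levelBox d K).erase 0, eLpNorm (fun b => ∑ n ∈ dyadicBlock k m,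
      groupAct d (haarProj K κ) F (scrambleDigits b (S.digits n))) 2 (scrLaw d) ≤
      ENNReal.ofReal (T * if k < ∑ j, κ j + S.quality then √(4 ^ a / 2) ^ (∑ j, κ j) else 0) := by
    intro κ hκ
    have hne := Finset.ne_of_mem_erase hκ
    have hκK : ∀ j, κ j ≤ K := fun j => by
      have := Fintype.mem_piFinset.1 (Finset.mem_of_mem_erase hκ) j
      have := Finset.mem_range.1 this
      omega
    have hH := isHaar_haarProj (κ := κ) hFd
    split_ifs with h
    · refine eLpNorm_two_le (hmem κ) (by positivity) ((hH.integral_sum_sq_le S h m).trans ?_)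
      have h3 := integral_haarProj_gridFn_sq_le ha0 ha hc hφ hκK
      have hpb := powBound_pos (b := 2 * a) (by linarith)
      calc _ ≤ 2 ^ k * 2 ^ (S.quality + d) *
            (c ^ 2 * (4 * (powBound (2 * a) + 8)) ^ d * (4 ^ a / 2) ^ (∑ j, κ j)) := by gcongr
        _ = _ := by
          rw [hT]
          simp only [mul_pow]
          rw [pow_right_comm _ d 2, pow_right_comm _ k 2, pow_right_comm _ (∑ j, κ j) 2,
            Real.sq_sqrt (by positivity), Real.sq_sqrt (by positivity),
            Real.sq_sqrt (by positivity), Real.sq_sqrt (by positivity)]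
          simp only [mul_pow]
          ring
    · have h3 : (fun b => ∑ n ∈ dyadicBlock k m,
          groupAct d (haarProj K κ) F (scrambleDigits b (S.digits n))) = 0 := by
        funext b
        exact hH.sum_dyadicBlock_eq_zero S hne (not_lt.1 h) m b
      rw [h3]; simp
  calc _ = eLpNorm (∑ κ ∈ (levelBox d K).erase 0, fun b => ∑ n ∈ dyadicBlock k m,
        groupAct d (haarProj K κ) F (scrambleDigits b (S.digits n))) 2 (scrLaw d) := by
        congr 1
        funext b
        rw [h1, Finset.sum_apply]
    _ ≤ ∑ κ ∈ (levelBox d K).erase 0, eLpNorm (fun b => ∑ n ∈ dyadicBlock k m,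
        groupAct d (haarProj K κ) F (scrambleDigits b (S.digits n))) 2 (scrLaw d) :=
        eLpNorm_sum_le (fun κ _ => (hmem κ).1) (by norm_num)
    _ ≤ ∑ κ ∈ (levelBox d K).erase 0, ENNReal.ofReal
        (T * if k < ∑ j, κ j + S.quality then √(4 ^ a / 2) ^ (∑ j, κ j) else 0) :=
        Finset.sum_le_sum h2
    _ = ENNReal.ofReal (∑ κ ∈ (levelBox d K).erase 0,
        (T * if k < ∑ j, κ j + S.quality then √(4 ^ a / 2) ^ (∑ j, κ j) else 0)) := by
        rw [ENNReal.ofReal_sum_of_nonneg]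
        intro κ _
        split_ifs <;> positivity
    _ ≤ _ := by
        refine ENNReal.ofReal_le_ofReal ?_
        rw [← Finset.mul_sum]
        calc _ ≤ T * ∑ κ ∈ levelBox d K,
              (if k < ∑ j, κ j + S.quality then √(4 ^ a / 2) ^ (∑ j, κ j) else 0) := by
              refine mul_le_mul_of_nonneg_left (Finset.sum_le_sum_of_subset_of_nonneg
                (Finset.erase_subset _ _) fun κ _ _ => ?_) hT0
              split_ifs <;> positivity
          _ ≤ T * (2 ^ S.quality * geomConst (1 / 2 - a) ^ d * geomConst ε ^ d *
              (2 : ℝ) ^ ((k : ℝ) * (a + ε) - k / 2)) := by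
              gcongr
              exact sum_levels_le ha0 ha hε _ _ _
          _ = _ := by
              have h4 : √2 ^ k * (2 : ℝ) ^ ((k : ℝ) * (a + ε) - k / 2) = ((2 : ℝ) ^ (a + ε)) ^ k := by
                rw [Real.sqrt_eq_rpow, ← Real.rpow_natCast, ← Real.rpow_natCast,
                  ← Real.rpow_mul (by norm_num), ← Real.rpow_mul (by norm_num),
                  ← Real.rpow_add (by norm_num)]
                congr 1; ring
              rw [← h4, hT, blockConst]
              ring

/-- The range is cut along the binary digits of `N`: each odd remainder splits off one dyadic block,
and halving `N` doubles the block length. -/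
theorem eLpNorm_sum_range_le {Y : ℕ → (Fin d × List Bool → Bool) → ℝ}
    (hY : ∀ n, MemLp (Y n) 2 (scrLaw d)) {W r : ℝ} (hW : 0 ≤ W) (hr : 0 ≤ r)
    (hblock : ∀ k m, eLpNorm (fun b => ∑ n ∈ dyadicBlock k m, Y n b) 2 (scrLaw d) ≤
      ENNReal.ofReal (W * r ^ k)) (l : ℕ) : ∀ N k, N < 2 ^ l →
    eLpNorm (fun b => ∑ n ∈ Finset.range (N * 2 ^ k), Y n b) 2 (scrLaw d) ≤
      ENNReal.ofReal (W * ∑ i ∈ Finset.range l, r ^ (k + i)) := by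
  induction l with
  | zero =>
    intro N k hN
    obtain rfl : N = 0 := by simpa using hN
    simp
  | succ l ih =>
    intro N k hN
    have h1 := ih (N / 2) (k + 1) (by rw [pow_succ] at hN; omega)
    have h2 : W * ∑ i ∈ Finset.range (l + 1), r ^ (k + i) =
        W * ∑ i ∈ Finset.range l, r ^ (k + 1 + i) + W * r ^ k := by
      rw [Finset.sum_range_succ', ← mul_add]
      congr 2
      exact Finset.sum_congr rfl fun i _ => by congr 1; ring
    rw [h2, ENNReal.ofReal_add (by positivity) (by positivity)]
    have hm : ∀ s : Finset ℕ, AEStronglyMeasurable (fun b => ∑ n ∈ s, Y n b) (scrLaw d) := fun s =>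
      (memLp_finsetSum s fun n _ => hY n).1
    rcases Nat.mod_two_eq_zero_or_one N with hmod | hmod
    · have h3 : N * 2 ^ k = N / 2 * 2 ^ (k + 1) := by
        rw [pow_succ, mul_comm (2 ^ k), ← mul_assoc]
        congr 1; omega
      rw [h3]
      exact h1.trans le_self_add
    · have h3 : N / 2 * 2 ^ (k + 1) = (N / 2 * 2) * 2 ^ k := by rw [pow_succ]; ring
      have h4 : N = N / 2 * 2 + 1 := by omega
      have h5 : ∀ b, ∑ n ∈ Finset.range (N * 2 ^ k), Y n b =
          ∑ n ∈ Finset.range (N / 2 * 2 ^ (k + 1)), Y n b +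
          ∑ n ∈ dyadicBlock k (N / 2 * 2), Y n b := by
        intro b
        rw [dyadicBlock, ← h4, h3, Finset.sum_range_add_sum_Ico]
        gcongr
        omega
      simp_rw [h5]
      refine (eLpNorm_add_le (hm _) (hm _) (by norm_num)).trans (add_le_add h1 (hblock _ _))

/-- The constant in the error bound for scrambled Sobol' points. -/
noncomputable def errorConst (a : ℝ) : ℝ := blockConst S a * geomConst a

theorem eLpNorm_gridFn_error_le {φ : (Fin d → ℝ) → ℝ} {c a ε : ℝ} (ha0 : 0 < a)
    (ha : a < 1 / 2) (hc : 0 ≤ c) (hφ : BoundaryGrowth φ c fun _ => a) (hε : 0 < ε) (K : ℕ) {N : ℕ}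
    (hN : 1 ≤ N) :
    eLpNorm (fun b => 1 / (N : ℝ) * ∑ n ∈ Finset.range N, gridFn K φ (scrambleDigits b (S.digits n)) -
      ∫ b', gridFn K φ (scrambleDigits b' 0) ∂scrLaw d) 2 (scrLaw d) ≤
      ENNReal.ofReal (c * errorConst S a * geomConst ε ^ d * (N : ℝ) ^ (a + ε - 1)) := by
  set I := ∫ b', gridFn K φ (scrambleDigits b' 0) ∂scrLaw d with hI
  have hN0 : (0 : ℝ) < N := by exact_mod_cast hN
  set α := a + ε with hα
  have hα0 : 0 < α := by positivity
  set r : ℝ := 2 ^ α with hr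
  have hg1 := one_le_geomConst hε
  have hg2 := one_le_geomConst (δ := 1 / 2 - a) (by linarith)
  set W := c * blockConst S a * geomConst ε ^ d with hW
  have hW0 : 0 ≤ W := by unfold W blockConst; positivity
  have h1 := eLpNorm_sum_range_le (Y := fun n b => gridFn K φ (scrambleDigits b (S.digits n)) - I)
    (fun n => ((firstDigits_gridFn K φ).memLp _ 2).sub (memLp_const _)) hW0 (r := r) (by positivity)
    (fun k m => eLpNorm_block_le S ha0.le ha hc hφ hε K k m) (Nat.log 2 N + 1) N 0
    (Nat.lt_pow_succ_log_self (by norm_num) N)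
  rw [pow_zero, mul_one] at h1
  have h2 : (fun b => 1 / (N : ℝ) * ∑ n ∈ Finset.range N,
      gridFn K φ (scrambleDigits b (S.digits n)) - I) = (1 / (N : ℝ)) • fun b =>
      ∑ n ∈ Finset.range N, (gridFn K φ (scrambleDigits b (S.digits n)) - I) := by
    funext b
    rw [Pi.smul_apply, smul_eq_mul, Finset.sum_sub_distrib, Finset.sum_const, Finset.card_range,
      nsmul_eq_mul]
    field_simp
  have h3 : ∑ i ∈ Finset.range (Nat.log 2 N + 1), r ^ (0 + i) ≤ geomConst a * (N : ℝ) ^ α := by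
    have h4 : ∀ i ∈ Finset.range (Nat.log 2 N + 1), r ^ (0 + i) =
        r ^ Nat.log 2 N * ((2 : ℝ) ^ (-α)) ^ (Nat.log 2 N - i) := by
      intro i hi
      have hi := Finset.mem_range.1 hi
      obtain ⟨m, hm⟩ : ∃ m, Nat.log 2 N = i + m := ⟨Nat.log 2 N - i, by omega⟩
      rw [hm, Nat.add_sub_cancel_left, zero_add, pow_add, mul_assoc, ← mul_pow, hr,
        ← Real.rpow_add (by norm_num)]
      simp
    rw [Finset.sum_congr rfl h4, ← Finset.mul_sum]
    have h5 := Finset.sum_range_reflect (fun i => ((2 : ℝ) ^ (-α)) ^ i) (Nat.log 2 N + 1)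
    simp only [Nat.add_sub_cancel] at h5
    rw [h5, mul_comm]
    -- Weakening `geomConst (a + ε)` to `geomConst a` keeps the constant of the exponents free of
    -- `ε`.
    refine mul_le_mul ((sum_pow_le_geomConst hα0 _).trans (geomConst_anti ha0 (by linarith))) ?_
      (by positivity) (by linarith [one_le_geomConst ha0])
    rw [hr, ← Real.rpow_natCast, ← Real.rpow_mul (by norm_num), mul_comm,
      Real.rpow_mul (by norm_num), Real.rpow_natCast]
    refine Real.rpow_le_rpow (by positivity) ?_ hα0.le
    exact_mod_cast Nat.pow_log_le_self 2 (by omega)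
  rw [h2, eLpNorm_const_smul]
  calc _ ≤ ENNReal.ofReal (1 / N) * ENNReal.ofReal (W * (geomConst a * (N : ℝ) ^ α)) := by
        gcongr
        · rw [Real.enorm_eq_ofReal (by positivity)]
        · exact h1.trans (ENNReal.ofReal_le_ofReal (by gcongr))
    _ = _ := by
        rw [← ENNReal.ofReal_mul (by positivity), Real.rpow_sub_one hN0.ne', errorConst, hW]
        congr 1
        ring

end

/-! ### Scrambled points and the passage to the limit -/

/-- The number in `[0,1]` with the given binary digits. -/
noncomputable def bitsVal (s : ℕ → Bool) : ℝ := ∑' i : ℕ, if s i then ((1 : ℝ) / 2) ^ (i + 1) else 0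

theorem summable_bits (s : ℕ → Bool) :
    Summable fun i : ℕ => if s i then ((1 : ℝ) / 2) ^ (i + 1) else 0 := by
  refine Summable.of_nonneg_of_le (fun i => ?_) (fun i => ?_)
    ((summable_nat_add_iff 1).2 (summable_geometric_of_lt_one (by norm_num)
      (by norm_num : (1 / 2 : ℝ) < 1)))
  · split_ifs <;> positivity
  · split_ifs
    · exact le_rfl
    · positivity

theorem tendsto_gridPoint (s : ℕ → Bool) :
    Tendsto (fun K => gridPoint K s) atTop (𝓝 (bitsVal s)) := by
  have h1 := (summable_bits s).hasSum.tendsto_sum_nat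
  have h2 : Tendsto (fun K : ℕ => ((1 : ℝ) / 2) ^ (K + 1)) atTop (𝓝 0) :=
    (tendsto_add_atTop_iff_nat 1).2
      (tendsto_pow_atTop_nhds_zero_of_lt_one (by norm_num) (by norm_num))
  simpa [gridPoint, bitsVal] using h1.add h2

/-- The upper ends of the nested dyadic intervals, `gridPoint K s + (1 / 2) ^ (K + 1)`, never
increase. -/
theorem sum_add_le_gridPoint (s : ℕ → Bool) {K L : ℕ} (h : K ≤ L) :
    gridPoint L s ≤ gridPoint K s + (1 / 2) ^ (K + 1) := by
  induction L, h using Nat.le_induction with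
  | base => linarith [show (0 : ℝ) < (1 / 2) ^ (K + 1) by positivity]
  | succ L hL ih =>
    have key : ∀ L, K ≤ L → gridPoint L s + (1 / 2) ^ (L + 1) ≤ gridPoint K s + (1 / 2) ^ (K + 1) := by
      intro L hL
      induction L, hL using Nat.le_induction with
      | base => exact le_rfl
      | succ L _ ih2 =>
        refine le_trans ?_ ih2
        unfold gridPoint
        rw [Finset.sum_range_succ]
        have h1 : ((1 : ℝ) / 2) ^ (L + 1 + 1) = (1 / 2) ^ (L + 1) / 2 := by ring
        have h2 : (0 : ℝ) < (1 / 2) ^ (L + 1) := by positivity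
        rw [h1]
        split_ifs <;> linarith
    have := key (L + 1) (by omega)
    linarith [show (0 : ℝ) < (1 / 2) ^ (L + 1 + 1) by positivity]

theorem bitsVal_le_two_mul (s : ℕ → Bool) (K : ℕ) : bitsVal s ≤ 2 * gridPoint K s := by
  have h1 : bitsVal s ≤ gridPoint K s + (1 / 2) ^ (K + 1) :=
    le_of_tendsto (tendsto_gridPoint s)
      (eventually_atTop.2 ⟨K, fun L hL => sum_add_le_gridPoint s hL⟩)
  have h2 : (1 / 2 : ℝ) ^ (K + 1) ≤ gridPoint K s := by
    unfold gridPoint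
    have : 0 ≤ ∑ i ∈ Finset.range K, (if s i then ((1 : ℝ) / 2) ^ (i + 1) else 0) :=
      Finset.sum_nonneg fun i _ => by split_ifs <;> positivity
    linarith
  linarith

theorem bitsVal_compl (s : ℕ → Bool) : bitsVal (fun i => !s i) = 1 - bitsVal s := by
  refine tendsto_nhds_unique (tendsto_gridPoint _) ?_
  simp_rw [gridPoint_compl]
  exact (tendsto_gridPoint s).const_sub 1

theorem bitsVal_pos {s : ℕ → Bool} {i : ℕ} (hi : s i = true) : 0 < bitsVal s := by
  refine (summable_bits s).tsum_pos (fun i => ?_) i ?_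
  · split_ifs <;> positivity
  · rw [if_pos hi]; positivity

/-- This comparison lets the weight at the limit point dominate its values along the grids. -/
theorem edgeDist_bitsVal_le (s : ℕ → Bool) (K : ℕ) :
    edgeDist (bitsVal s) / 2 ≤ edgeDist (gridPoint K s) := by
  have h1 := bitsVal_le_two_mul s K
  have h2 := bitsVal_le_two_mul (fun i => !s i) K
  rw [bitsVal_compl, gridPoint_compl] at h2
  have h3 : edgeDist (bitsVal s) ≤ bitsVal s := min_le_left _ _
  have h4 : edgeDist (bitsVal s) ≤ 1 - bitsVal s := min_le_right _ _
  exact le_min (by linarith) (by linarith)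

section

variable {d : ℕ}

theorem pointOfDigits_apply (x : Digits d) (j : Fin d) : pointOfDigits x j = bitsVal (x j) := rfl

theorem gridPoint_mem_openCube (K : ℕ) (x : Digits d) :
    (fun j => gridPoint K (x j)) ∈ openCube d := fun _ => gridPoint_mem _ _

theorem measurable_gridPoint (K : ℕ) (j : Fin d) :
    Measurable fun x : Digits d => gridPoint K (x j) :=
  FirstDigits.measurable (K := K) fun _ _ h => gridPoint_congr (h j)

theorem measurable_pointOfDigits : Measurable (pointOfDigits : Digits d → Fin d → ℝ) :=
  measurable_pi_lambda _ fun j => measurable_of_tendsto_metrizable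
    (fun K => measurable_gridPoint K j) (tendsto_pi_nhds.2 fun x => tendsto_gridPoint (x j))

/-! ### Scrambled points avoid the faces of the cube -/

theorem integral_bits_eq (K : ℕ) (j : Fin d) (c : Bool) (x : Digits d) :
    ∫ b, (if ∀ i < K, scrambleDigits b x j i = c then (1 : ℝ) else 0) ∂scrLaw d = (2 ^ K)⁻¹ := by
  classical
  have hF : FirstDigits K fun z : Digits d => if ∀ i < K, z j i = c then (1 : ℝ) else 0 := by
    intro z z' h
    have : (∀ i < K, z j i = c) ↔ ∀ i < K, z' j i = c :=
      forall₂_congr fun i hi => by rw [h j i hi]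
    simp only [this]
  rw [integral_scramble_eq_sum hF]
  have h1 := sum_prod_extDigits (d := d) K fun j' s =>
    if j' = j then (if ∀ i < K, s i = c then (1 : ℝ) else 0) else 1
  have h2 : ∀ z : Digits d, (∏ j', if j' = j then (if ∀ i < K, z j' i = c then (1 : ℝ) else 0) else 1)
      = if ∀ i < K, z j i = c then (1 : ℝ) else 0 := by
    intro z
    rw [Finset.prod_eq_single j]
    · rw [if_pos rfl]
    · intro j' _ h; rw [if_neg h]
    · simp
  simp only [h2] at h1
  rw [h1, Finset.prod_eq_single j]
  · simp only [if_true]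
    rw [Finset.sum_eq_single fun _ => c]
    · simp +contextual [extBits]
    · intro w _ hw
      rw [if_neg]
      intro h
      exact hw (funext fun i => by simpa [extBits] using h i i.2)
    · simp
  · intro j' _ h; simp [h]
  · simp

/-- The first `K` digits all equal `c` with probability `2 ^ (-K)`, which tends to zero. -/
theorem ae_exists_bit (j : Fin d) (c : Bool) (x : Digits d) :
    ∀ᵐ b ∂scrLaw d, ∃ i, scrambleDigits b x j i = !c := by
  have hms : ∀ i, MeasurableSet {b | scrambleDigits b x j i = c} := fun i =>
    ((measurable_pi_apply i).comp ((measurable_pi_apply j).comp (measurable_scrambleDigits x)))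
      (measurableSet_singleton c)
  have h1 : ∀ K, scrLaw d {b | ∀ i, scrambleDigits b x j i = c} ≤ ENNReal.ofReal ((1 / 2) ^ K) := by
    intro K
    have hm : MeasurableSet {b | ∀ i < K, scrambleDigits b x j i = c} := by
      have : {b | ∀ i < K, scrambleDigits b x j i = c} =
          ⋂ i, ⋂ _ : i < K, {b | scrambleDigits b x j i = c} := by ext; simp
      rw [this]
      exact MeasurableSet.iInter fun i => MeasurableSet.iInter fun _ => hms i
    have h2 : (scrLaw d).real {b | ∀ i < K, scrambleDigits b x j i = c} = (1 / 2) ^ K := by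
      rw [← integral_indicator_one hm, one_div, inv_pow, ← integral_bits_eq K j c x]
      refine integral_congr_ae (Eventually.of_forall fun b => ?_)
      simp only [Set.indicator_apply, Pi.one_apply, Set.mem_ofPred_eq]
    rw [← h2, ofReal_measureReal]
    exact measure_mono fun b hb i _ => hb i
  have h2 : scrLaw d {b | ∀ i, scrambleDigits b x j i = c} = 0 := by
    have h3 : Tendsto (fun K : ℕ => ENNReal.ofReal ((1 / 2) ^ K)) atTop (𝓝 (ENNReal.ofReal 0)) :=
      ENNReal.tendsto_ofReal
        (tendsto_pow_atTop_nhds_zero_of_lt_one (by norm_num) (by norm_num))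
    rw [ENNReal.ofReal_zero] at h3
    exact le_antisymm (ge_of_tendsto' h3 h1) bot_le
  rw [ae_iff, ← h2]
  congr 1
  ext b
  simp

theorem ae_mem_openCube (x : Digits d) :
    ∀ᵐ b ∂scrLaw d, pointOfDigits (scrambleDigits b x) ∈ openCube d := by
  have h : ∀ᵐ b ∂scrLaw d, ∀ j c, ∃ i, scrambleDigits b x j i = !c :=
    ae_all_iff.2 fun j => ae_all_iff.2 fun c => ae_exists_bit j c x
  filter_upwards [h] with b hb j
  rw [pointOfDigits_apply]
  obtain ⟨i, hi⟩ := hb j false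
  obtain ⟨i', hi'⟩ := hb j true
  refine ⟨bitsVal_pos (i := i) hi, ?_⟩
  have := bitsVal_pos (s := fun i => !scrambleDigits b x j i) (i := i') (by simp [hi'])
  rw [bitsVal_compl] at this
  linarith

theorem tendsto_gridFn {φ : (Fin d → ℝ) → ℝ} (hφ : ContinuousOn φ (openCube d)) {x : Digits d}
    (hx : pointOfDigits x ∈ openCube d) :
    Tendsto (fun K => gridFn K φ x) atTop (𝓝 (φ (pointOfDigits x))) := by
  refine (hφ _ hx).tendsto.comp (tendsto_nhdsWithin_iff.2 ⟨?_, ?_⟩)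
  · exact tendsto_pi_nhds.2 fun j => tendsto_gridPoint (x j)
  · exact Eventually.of_forall fun K => gridPoint_mem_openCube K x

theorem aestronglyMeasurable_comp_point {φ : (Fin d → ℝ) → ℝ} (hφ : ContinuousOn φ (openCube d))
    (x : Digits d) :
    AEStronglyMeasurable (fun b => φ (pointOfDigits (scrambleDigits b x))) (scrLaw d) := by
  refine aestronglyMeasurable_of_tendsto_ae atTop (f := fun K b => gridFn K φ (scrambleDigits b x))
    (fun K => ((firstDigits_gridFn K φ).memLp x 2).1) ?_
  filter_upwards [ae_mem_openCube x] with b hb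
  exact tendsto_gridFn hφ hb

theorem continuousOn_edgeWeight (A : Fin d → ℝ) : ContinuousOn (edgeWeight A ∅) (openCube d) := by
  refine continuousOn_finsetProd _ fun i _ => ContinuousOn.rpow_const ?_ fun y hy => ?_
  · fun_prop
  · exact Or.inl (edgeDist_pos (hy i)).ne'

theorem edgeWeight_nonneg (A : Fin d → ℝ) (u : Finset (Fin d)) {y : Fin d → ℝ}
    (hy : y ∈ openCube d) : 0 ≤ edgeWeight A u y :=
  Finset.prod_nonneg fun i _ => Real.rpow_nonneg (edgeDist_pos (hy i)).le _

theorem le_maxExp (A : Fin d → ℝ) (i : Fin d) : A i ≤ maxExp A :=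
  le_ciSup (Set.finite_range A).bddAbove i

theorem edgeWeight_le (A : Fin d → ℝ) (u : Finset (Fin d)) {y : Fin d → ℝ} (hy : y ∈ openCube d) :
    edgeWeight A u y ≤ edgeWeight (fun _ => maxExp A) u y := by
  refine Finset.prod_le_prod (fun i _ => Real.rpow_nonneg (edgeDist_pos (hy i)).le _) fun i _ => ?_
  refine Real.rpow_le_rpow_of_exponent_ge (edgeDist_pos (hy i))
    ((edgeDist_le_half _).trans (by norm_num)) ?_
  have := le_maxExp A i
  linarith

/-- Distances to the ends are below one, so raising all exponents to the largest one only weakens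
the bound. -/
theorem BoundaryGrowth.to_maxExp {φ : (Fin d → ℝ) → ℝ} {c : ℝ} {A : Fin d → ℝ} (hc : 0 ≤ c)
    (h : BoundaryGrowth φ c A) : BoundaryGrowth φ c fun _ => maxExp A := by
  obtain ⟨D, h1, h2, h3, h4⟩ := h
  exact ⟨D, h1, h2, h3, fun u y hy => (h4 u y hy).trans
    (mul_le_mul_of_nonneg_left (edgeWeight_le A u hy) hc)⟩

theorem BoundaryGrowth.continuousOn {φ : (Fin d → ℝ) → ℝ} {c : ℝ} {A : Fin d → ℝ}
    (h : BoundaryGrowth φ c A) : ContinuousOn φ (openCube d) := by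
  obtain ⟨D, h1, h2, -, -⟩ := h
  exact (h2 ∅).congr fun y hy => (h1 y hy).symm

theorem BoundaryGrowth.valueGrowth {φ : (Fin d → ℝ) → ℝ} {c : ℝ} {A : Fin d → ℝ}
    (h : BoundaryGrowth φ c A) : ValueGrowth φ c A := by
  obtain ⟨D, h1, -, -, h4⟩ := h
  intro y hy
  rw [← h1 y hy]
  exact h4 ∅ y hy

/-! ### Integrability of the boundary weight and the limit of fine grids -/

theorem edgeWeight_gridPoint_le {a : ℝ} (ha : 0 ≤ a) {x : Digits d}
    (hx : pointOfDigits x ∈ openCube d) (K : ℕ) :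
    edgeWeight (fun _ => a) ∅ (fun j => gridPoint K (x j)) ≤
      (2 ^ a) ^ d * edgeWeight (fun _ => a) ∅ (pointOfDigits x) := by
  have h1 : ((2 : ℝ) ^ a) ^ d = ∏ _j : Fin d, (2 : ℝ) ^ a := by simp
  rw [edgeWeight, edgeWeight, h1, ← Finset.prod_mul_distrib]
  refine Finset.prod_le_prod (fun j _ => Real.rpow_nonneg (edgeDist_pos (gridPoint_mem _ _)).le _)
    fun j _ => ?_
  simp only [Finset.notMem_empty, if_false, sub_zero]
  have h2 := edgeDist_pos (hx j)
  change edgeDist _ ^ (-a) ≤ 2 ^ a * edgeDist _ ^ (-a)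
  rw [← div_two_rpow h2]
  exact Real.rpow_le_rpow_of_nonpos (by linarith) (edgeDist_bitsVal_le (x j) K) (by linarith)

/-- On the grids the weight is a product of one-dimensional means bounded uniformly in `K`; Fatou's
lemma carries the bound to the limit. -/
theorem lintegral_edgeWeight_le {a : ℝ} (ha0 : 0 ≤ a) (ha : a < 1) (x : Digits d) :
    ∫⁻ b, ENNReal.ofReal (edgeWeight (fun _ => a) ∅ (pointOfDigits (scrambleDigits b x))) ∂scrLaw d ≤
      ENNReal.ofReal ((2 * powBound a) ^ d) := by
  set w := edgeWeight (d := d) (fun _ => a) ∅ with hw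
  have hF : ∀ K, FirstDigits K (gridFn K w) := fun K => firstDigits_gridFn K w
  have h1 : ∀ K, ∫⁻ b, ENNReal.ofReal (gridFn K w (scrambleDigits b x)) ∂scrLaw d ≤
      ENNReal.ofReal ((2 * powBound a) ^ d) := by
    intro K
    rw [← ofReal_integral_eq_lintegral_ofReal ((hF K).integrable x)
      (Eventually.of_forall fun b => edgeWeight_nonneg _ _ (gridPoint_mem_openCube K _)),
      integral_scramble_eq_sum (hF K)]
    refine ENNReal.ofReal_le_ofReal ?_
    have h2 := sum_prod_extDigits (d := d) K fun _ s => edgeDist (gridPoint K s) ^ (-a)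
    have h3 : ∀ z : Digits d, gridFn K w z = ∏ j, edgeDist (gridPoint K (z j)) ^ (-a) := by
      intro z; simp [gridFn, hw, edgeWeight, edgeDist]
    simp only [h3]
    rw [h2, Finset.prod_const, Finset.card_univ, Fintype.card_fin]
    refine pow_le_pow_left₀ (mul_nonneg (by positivity) (Finset.sum_nonneg fun v _ =>
      Real.rpow_nonneg (edgeDist_pos (gridPoint_mem _ _)).le _)) ?_ d
    have h4 := gridMean_rpow_le ha0 ha K
    have h5 := gridMean_one_sub K fun q => q ^ (-a)
    calc _ ≤ (2 ^ K : ℝ)⁻¹ * ∑ v : Fin K → Bool,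
          (gridPoint K (extBits v) ^ (-a) + (1 - gridPoint K (extBits v)) ^ (-a)) := by
          gcongr with v _
          have hq := gridPoint_mem K (extBits v)
          have h6 : 0 ≤ gridPoint K (extBits v) ^ (-a) := Real.rpow_nonneg hq.1.le _
          have h7 : 0 ≤ (1 - gridPoint K (extBits v)) ^ (-a) :=
            Real.rpow_nonneg (by linarith [hq.2]) _
          rcases min_choice (gridPoint K (extBits v)) (1 - gridPoint K (extBits v)) with h | h <;>
            rw [edgeDist, h] <;> linarith
      _ ≤ 2 * powBound a := by
          rw [Finset.sum_add_distrib, mul_add]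
          unfold gridMean at h4 h5
          linarith
  calc _ ≤ ∫⁻ b, liminf (fun K => ENNReal.ofReal (gridFn K w (scrambleDigits b x))) atTop
        ∂scrLaw d := by
        refine lintegral_mono_ae ?_
        filter_upwards [ae_mem_openCube x] with b hb
        exact ((ENNReal.continuous_ofReal.tendsto _).comp
          (tendsto_gridFn (continuousOn_edgeWeight _) hb)).liminf_eq.ge
    _ ≤ liminf (fun K => ∫⁻ b, ENNReal.ofReal (gridFn K w (scrambleDigits b x)) ∂scrLaw d) atTop :=
        lintegral_liminf_le fun K => ENNReal.measurable_ofReal.comp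
          ((hF K).measurable.comp (measurable_scrambleDigits x))
    _ ≤ _ := by
        refine liminf_le_of_le (by isBoundedDefault) fun c hc => ?_
        obtain ⟨K, hK⟩ := hc.exists
        exact hK.trans (h1 K)

theorem integrable_edgeWeight {a : ℝ} (ha0 : 0 ≤ a) (ha : a < 1) (x : Digits d) :
    Integrable (fun b => edgeWeight (fun _ => a) ∅ (pointOfDigits (scrambleDigits b x)))
      (scrLaw d) := by
  refine ⟨aestronglyMeasurable_comp_point (continuousOn_edgeWeight _) x, ?_⟩
  rw [hasFiniteIntegral_iff_ofReal]
  · exact (lintegral_edgeWeight_le ha0 ha x).trans_lt ENNReal.ofReal_lt_top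
  · filter_upwards [ae_mem_openCube x] with b hb using edgeWeight_nonneg _ _ hb

theorem integral_edgeWeight_le {a : ℝ} (ha0 : 0 ≤ a) (ha : a < 1) (x : Digits d) :
    ∫ b, edgeWeight (fun _ => a) ∅ (pointOfDigits (scrambleDigits b x)) ∂scrLaw d ≤
      (2 * powBound a) ^ d := by
  have hp := powBound_pos ha
  have h1 := lintegral_edgeWeight_le (d := d) ha0 ha x
  rw [← ofReal_integral_eq_lintegral_ofReal (integrable_edgeWeight ha0 ha x)] at h1
  · exact (ENNReal.ofReal_le_ofReal_iff (by positivity)).1 h1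
  · filter_upwards [ae_mem_openCube x] with b hb using edgeWeight_nonneg _ _ hb

/-- The mean of a function over the unit cube, as the mean over a scrambled point. -/
noncomputable def cubeMean (φ : (Fin d → ℝ) → ℝ) : ℝ :=
  ∫ b, φ (pointOfDigits (scrambleDigits b 0)) ∂scrLaw d

theorem BoundaryGrowth.integrable {φ : (Fin d → ℝ) → ℝ} {c : ℝ} {A : Fin d → ℝ} (hc : 0 ≤ c)
    (h : BoundaryGrowth φ c A) (hA0 : 0 ≤ maxExp A) (hA : maxExp A < 1) (x : Digits d) :
    Integrable (fun b => φ (pointOfDigits (scrambleDigits b x))) (scrLaw d) := by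
  refine ((integrable_edgeWeight hA0 hA x).const_mul c).mono'
    (aestronglyMeasurable_comp_point h.continuousOn x) ?_
  filter_upwards [ae_mem_openCube x] with b hb
  exact (h.to_maxExp hc).valueGrowth _ hb

theorem tendsto_integral_gridFn {φ : (Fin d → ℝ) → ℝ} {c a : ℝ} (hc : 0 ≤ c)
    (h : BoundaryGrowth φ c fun _ => a) (ha0 : 0 ≤ a) (ha : a < 1) :
    Tendsto (fun K => ∫ b, gridFn K φ (scrambleDigits b 0) ∂scrLaw d) atTop
      (𝓝 (cubeMean φ)) := by
  refine tendsto_integral_of_dominated_convergence (fun b => c * ((2 ^ a) ^ d *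
    edgeWeight (fun _ => a) ∅ (pointOfDigits (scrambleDigits b 0))))
    (fun K => ((firstDigits_gridFn K φ).memLp 0 2).1)
    (((integrable_edgeWeight ha0 ha 0).const_mul _).const_mul c) (fun K => ?_) ?_
  · filter_upwards [ae_mem_openCube 0] with b hb
    exact (h.valueGrowth _ (gridPoint_mem_openCube K _)).trans
      (mul_le_mul_of_nonneg_left (edgeWeight_gridPoint_le ha0 hb K) hc)
  · filter_upwards [ae_mem_openCube 0] with b hb using tendsto_gridFn h.continuousOn hb

/-- The root mean square error of scrambled Sobol' points for functions with boundary growth. -/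
theorem eLpNorm_error_le (S : SobolData d) {φ : (Fin d → ℝ) → ℝ} {c ε : ℝ} {A : Fin d → ℝ}
    (hA0 : 0 < maxExp A) (hA : maxExp A < 1 / 2) (hc : 0 ≤ c) (hφ : BoundaryGrowth φ c A)
    (hε : 0 < ε) {N : ℕ} (hN : 1 ≤ N) :
    eLpNorm (fun b => 1 / (N : ℝ) * ∑ n ∈ Finset.range N, φ (S.scrambled b n) - cubeMean φ) 2
      (scrLaw d) ≤
      ENNReal.ofReal (c * errorConst S (maxExp A) * geomConst ε ^ d *
        (N : ℝ) ^ (maxExp A + ε - 1)) := by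
  have h := hφ.to_maxExp hc
  -- Lower semicontinuity of the `L²` norm suffices, since the grid bound does not depend on `K`.
  refine (Lp.eLpNorm_lim_le_liminf_eLpNorm (f := fun K b => 1 / (N : ℝ) * ∑ n ∈ Finset.range N,
    gridFn K φ (scrambleDigits b (S.digits n)) - ∫ b', gridFn K φ (scrambleDigits b' 0) ∂scrLaw d)
    (fun K => ?_) _ ?_).trans ?_
  · exact (((memLp_finsetSum _ fun n _ => (firstDigits_gridFn K φ).memLp (S.digits n) 2).const_mul
      _).sub (memLp_const _)).1
  · filter_upwards [ae_all_iff.2 fun n => ae_mem_openCube (S.digits n)] with b hb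
    exact ((tendsto_finsetSum _ fun n _ => tendsto_gridFn h.continuousOn (hb n)).const_mul _).sub
      (tendsto_integral_gridFn hc h hA0.le (by linarith))
  · refine liminf_le_of_le (by isBoundedDefault) fun C hC => ?_
    obtain ⟨K, hK⟩ := hC.exists
    exact hK.trans (eLpNorm_gridFn_error_le S hA0 hA hc h hε K hN)

end

/-! ### Independent scramblings -/

theorem IsFairBits.map_prod {Ω ι κ : Type*} [MeasurableSpace Ω] {P : Measure Ω}
    [IsProbabilityMeasure P] {τ : ι → Ω → Bool} {ρ : κ → Ω → Bool}
    (h : IsFairBits (Sum.elim τ ρ) P) :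
    P.map (fun ω => ((fun i => τ i ω), fun i => ρ i ω)) =
      (coinLaw ι).prod (P.map fun ω i => ρ i ω) := by
  have hτ : ∀ i, Measurable (τ i) := fun i => h.1 (Sum.inl i)
  have hρ : ∀ i, Measurable (ρ i) := fun i => h.1 (Sum.inr i)
  have hind : IndepFun (fun ω i => τ i ω) (fun ω i => ρ i ω) P := by
    have h1 := indep_iSup_of_disjoint (S := Set.range Sum.inl) (T := Set.range Sum.inr)
      (fun i => (h.1 i).comap_le) h.2.2 Set.isCompl_range_inl_range_inr.disjoint
    rw [IndepFun_iff_Indep]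
    rw [iSup_range, iSup_range] at h1
    convert h1 using 1 <;>
    · rw [MeasurableSpace.pi, MeasurableSpace.comap_iSup]
      simp only [MeasurableSpace.comap_comp]
      rfl
  have hτi : iIndepFun τ P := by
    have := h.2.2.precomp (g := Sum.inl) Sum.inl_injective
    exact this
  rw [(indepFun_iff_map_prod_eq_prod_map_map (measurable_pi_lambda _ hτ).aemeasurable
    (measurable_pi_lambda _ hρ).aemeasurable).1 hind]
  congr 1
  exact isFairBits_map ⟨hτ, fun i => h.2.1 (Sum.inl i), hτi⟩

theorem eLpNorm_two_le_iff {Ω : Type*} [MeasurableSpace Ω] {μ : Measure Ω} {G : Ω → ℝ}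
    {C : ENNReal} : eLpNorm G 2 μ ≤ C ↔ ∫⁻ ω, ‖G ω‖ₑ ^ (2 : ℝ) ∂μ ≤ C ^ (2 : ℝ) := by
  rw [eLpNorm_eq_lintegral_rpow_enorm_toReal (by norm_num) (by norm_num)]
  rw [ENNReal.toReal_ofNat, one_div, ENNReal.rpow_inv_le_iff (by norm_num)]

/-- Tonelli's theorem for the product law: a uniform bound on conditional second moments bounds the
unconditional one. -/
theorem eLpNorm_two_le_of_conditional {Ω α β : Type*} [MeasurableSpace Ω] [MeasurableSpace α]
    [MeasurableSpace β] {P : Measure Ω} [IsProbabilityMeasure P] {μ : Measure α}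
    [IsProbabilityMeasure μ] {T : Ω → α} {R : Ω → β} (hT : Measurable T) (hR : Measurable R)
    (hmap : P.map (fun ω => (T ω, R ω)) = μ.prod (P.map R)) {Z : α × β → ℝ} (hZ : Measurable Z)
    {C : ENNReal} (h : ∀ᵐ ω ∂P, eLpNorm (fun a => Z (a, R ω)) 2 μ ≤ C) :
    eLpNorm (fun ω => Z (T ω, R ω)) 2 P ≤ C := by
  rw [eLpNorm_two_le_iff]
  have hp : IsProbabilityMeasure (P.map R) := Measure.isProbabilityMeasure_map hR.aemeasurable
  have hm : Measurable fun q => ‖Z q‖ₑ ^ (2 : ℝ) := hZ.enorm.pow_const _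
  calc ∫⁻ ω, ‖Z (T ω, R ω)‖ₑ ^ (2 : ℝ) ∂P
      = ∫⁻ q, ‖Z q‖ₑ ^ (2 : ℝ) ∂(P.map fun ω => (T ω, R ω)) :=
        (lintegral_map hm (hT.prodMk hR)).symm
    _ = ∫⁻ r, ∫⁻ a, ‖Z (a, r)‖ₑ ^ (2 : ℝ) ∂μ ∂(P.map R) := by
        rw [hmap, lintegral_prod_symm _ hm.aemeasurable]
    _ = ∫⁻ ω, ∫⁻ a, ‖Z (a, R ω)‖ₑ ^ (2 : ℝ) ∂μ ∂P :=
        lintegral_map (hm.lintegral_prod_left') hR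
    _ ≤ ∫⁻ _, C ^ (2 : ℝ) ∂P := by
        refine lintegral_mono_ae ?_
        filter_upwards [h] with ω hω using eLpNorm_two_le_iff.1 hω
    _ = C ^ (2 : ℝ) := by simp

/-- The constant `c` need not be the mean of `X`, so any convenient reference value can be used. -/
theorem variance_le_of_eLpNorm_sub {Ω : Type*} [MeasurableSpace Ω] {P : Measure Ω}
    [IsProbabilityMeasure P] {X : Ω → ℝ} (hX : AEStronglyMeasurable X P) {c r : ℝ} (hr : 0 ≤ r)
    (h : eLpNorm (fun ω => X ω - c) 2 P ≤ ENNReal.ofReal r) :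
    MemLp X 2 P ∧ variance X P ≤ r ^ 2 := by
  have hm : AEStronglyMeasurable (fun ω => X ω - c) P := hX.sub aestronglyMeasurable_const
  have hs : MemLp (fun ω => X ω - c) 2 P := ⟨hm, h.trans_lt ENNReal.ofReal_lt_top⟩
  have hXm : MemLp X 2 P := by
    have := hs.add (memLp_const c)
    convert this using 1
    funext ω
    simp
  refine ⟨hXm, ?_⟩
  rw [← variance_sub_const hX c]
  refine (variance_le_expectation_sq hm).trans ?_
  have h1 := hs.eLpNorm_eq_integral_rpow_norm (by norm_num) (by norm_num)
  rw [h1, ENNReal.ofReal_le_ofReal_iff hr] at h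
  simp only [ENNReal.toReal_ofNat, Real.rpow_ofNat, Real.norm_eq_abs, sq_abs] at h
  rw [← one_div, ← Real.sqrt_eq_rpow, Real.sqrt_le_left hr] at h
  simpa using h

/-! ### Taylor expansion around the inner integral -/

/-- Along the segment from `c` to `a`, the function `s ↦ f + (1 - s) (a - c) f'` has exactly the
integrand of the remainder as derivative. -/
theorem taylor_linearPart_remainderPart {U : Set ℝ} (hU : IsOpen U) (hUc : Convex ℝ U) {f : ℝ → ℝ}
    (hf : ContDiffOn ℝ 2 f U) {d : ℕ} {c a : (Fin d → ℝ) → ℝ} {y : Fin d → ℝ} (hc : c y ∈ U)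
    (ha : a y ∈ U) : f (a y) - f (c y) = linearPart f c a y + remainderPart f c a y := by
  unfold linearPart remainderPart
  generalize c y = c at *
  generalize a y = a at *
  have hf' : ContDiffOn ℝ 1 (deriv f) U := hf.deriv_of_isOpen hU (by norm_num)
  have hf'' : ContinuousOn (deriv (deriv f)) U := hf'.continuousOn_deriv_of_isOpen hU (by norm_num)
  have hmem : ∀ s ∈ Set.Icc (0 : ℝ) 1, c + s * (a - c) ∈ U := by
    intro s hs
    have := hUc hc ha (sub_nonneg.2 hs.2) hs.1 (by ring)
    simp only [smul_eq_mul] at this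
    convert this using 1; ring
  have hd1 : ∀ u ∈ U, HasDerivAt f (deriv f u) u := fun u hu =>
    ((hf.differentiableOn (by norm_num)).differentiableAt (hU.mem_nhds hu)).hasDerivAt
  have hd2 : ∀ u ∈ U, HasDerivAt (deriv f) (deriv (deriv f) u) u := fun u hu =>
    ((hf'.differentiableOn (by norm_num)).differentiableAt (hU.mem_nhds hu)).hasDerivAt
  have hline : ∀ s : ℝ, HasDerivAt (fun s => c + s * (a - c)) (a - c) s := fun s => by
    simpa using ((hasDerivAt_id s).mul_const (a - c)).const_add c
  have hG : ∀ s ∈ Set.uIcc (0 : ℝ) 1, HasDerivAt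
      (fun s => f (c + s * (a - c)) + (1 - s) * ((a - c) * deriv f (c + s * (a - c))))
      ((a - c) ^ 2 * (deriv (deriv f) (c + s * (a - c)) * (1 - s))) s := by
    intro s hs
    rw [Set.uIcc_of_le zero_le_one] at hs
    have h1 := (hd1 _ (hmem s hs)).comp s (hline s)
    have h2 := ((hd2 _ (hmem s hs)).comp s (hline s)).const_mul (a - c)
    have h3 := h1.add (((hasDerivAt_id s).const_sub 1).mul h2)
    refine h3.congr_deriv ?_
    simp only [Function.comp, id]
    ring
  have hcont : ContinuousOn (fun s => (a - c) ^ 2 * (deriv (deriv f) (c + s * (a - c)) * (1 - s)))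
      (Set.uIcc (0 : ℝ) 1) := by
    rw [Set.uIcc_of_le zero_le_one]
    refine continuousOn_const.mul (ContinuousOn.mul (hf''.comp (by fun_prop) hmem) (by fun_prop))
  have h := intervalIntegral.integral_eq_sub_of_hasDerivAt hG hcont.intervalIntegrable
  rw [intervalIntegral.integral_const_mul] at h
  rw [h]
  simp
  ring

/-- A mean outside the interval would have all the values strictly on one side of it, so a strictly
signed function would have integral zero. -/
theorem integral_mem_of_convex_isOpen {Ω : Type*} [MeasurableSpace Ω] {μ : Measure Ω}
    [IsProbabilityMeasure μ] {U : Set ℝ} (hUc : Convex ℝ U) {G : Ω → ℝ}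
    (hG : Integrable G μ) (h : ∀ᵐ ω ∂μ, G ω ∈ U) : ∫ ω, G ω ∂μ ∈ U := by
  set m := ∫ ω, G ω ∂μ with hm
  by_contra hcon
  have key : ∀ H : Ω → ℝ, Integrable H μ → (∀ᵐ ω ∂μ, 0 < H ω) → ∫ ω, H ω ∂μ ≠ 0 := by
    intro H hH hpos h0
    rw [integral_eq_zero_iff_of_nonneg_ae (hpos.mono fun _ h => h.le) hH] at h0
    obtain ⟨ω, h1, h2⟩ := (hpos.and h0).exists
    exact h1.ne' h2
  have h0 : ∫ ω, (G ω - m) ∂μ = 0 := by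
    rw [integral_sub hG (integrable_const m)]; simp [hm]
  have h0' : ∫ ω, (m - G ω) ∂μ = 0 := by
    rw [integral_sub (integrable_const m) hG]; simp [hm]
  by_cases hex : ∃ u ∈ U, u < m
  · obtain ⟨u, hu, hum⟩ := hex
    refine key _ ((integrable_const m).sub hG) ?_ h0'
    filter_upwards [h] with ω hω
    rw [Pi.sub_apply, sub_pos]
    by_contra! hle
    exact hcon (hUc.ordConnected.out hu hω ⟨hum.le, hle⟩)
  · push Not at hex
    refine key _ (hG.sub (integrable_const m)) ?_ h0
    filter_upwards [h] with ω hω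
    rw [Pi.sub_apply, sub_pos]
    exact lt_of_le_of_ne (hex _ hω) fun he => hcon (he ▸ hω)

section

variable {d₁ d₂ : ℕ}

theorem volume_Icc_zero_one (d : ℕ) : volume (Set.Icc (0 : Fin d → ℝ) 1) = 1 := by
  simp [Real.volume_Icc_pi]

theorem AdmissibleIntegrand.innerIntegral_mem {U : Set ℝ} (hUc : Convex ℝ U)
    {G : (Fin d₁ → ℝ) → (Fin d₂ → ℝ) → ℝ} (hG : AdmissibleIntegrand U G) {y : Fin d₁ → ℝ}
    (hy : y ∈ openCube d₁) : innerIntegral G y ∈ U := by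
  have hp : IsProbabilityMeasure (volume.restrict (Set.Icc (0 : Fin d₂ → ℝ) 1)) :=
    ⟨by rw [Measure.restrict_apply_univ, volume_Icc_zero_one]⟩
  refine integral_mem_of_convex_isOpen hUc (hG.2.2 y hy) ?_
  filter_upwards [ae_restrict_mem measurableSet_Icc] with x hx using hG.2.1 y hy x hx

theorem pointOfDigits_mem_Icc (x : Digits d₂) : pointOfDigits x ∈ Set.Icc (0 : Fin d₂ → ℝ) 1 :=
  ⟨fun j => ge_of_tendsto' (tendsto_gridPoint (x j)) fun K => (gridPoint_pos K _).le,
    fun j => le_of_tendsto' (tendsto_gridPoint (x j)) fun K => (gridPoint_lt_one K _).le⟩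

theorem AdmissibleIntegrand.innerMean_mem {U : Set ℝ} (hUc : Convex ℝ U)
    {G : (Fin d₁ → ℝ) → (Fin d₂ → ℝ) → ℝ} (hG : AdmissibleIntegrand U G) {y : Fin d₁ → ℝ}
    (hy : y ∈ openCube d₁) {M : ℕ} (hM : 0 < M) {x : ℕ → Fin d₂ → ℝ}
    (hx : ∀ m, x m ∈ Set.Icc (0 : Fin d₂ → ℝ) 1) : innerMean G M x y ∈ U := by
  unfold innerMean
  rw [Finset.mul_sum]
  refine hUc.sum_mem (fun _ _ => by positivity) ?_ fun m _ => hG.2.1 y hy _ (hx m)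
  rw [Finset.sum_const, Finset.card_range, nsmul_eq_mul]
  have : (M : ℝ) ≠ 0 := by positivity
  field_simp

theorem AdmissibleIntegrand.measurable_doubleLoop {U : Set ℝ}
    {G : (Fin d₁ → ℝ) → (Fin d₂ → ℝ) → ℝ} (hG : AdmissibleIntegrand U G) {f : ℝ → ℝ}
    (hf : Measurable f) (N M : ℕ) {α : Type*} [MeasurableSpace α] {y : α → ℕ → Fin d₁ → ℝ}
    {x : α → ℕ → Fin d₂ → ℝ} (hy : ∀ n, Measurable fun q => y q n)
    (hx : ∀ m, Measurable fun q => x q m) :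
    Measurable fun q => doubleLoop f G N M (y q) (x q) := by
  unfold doubleLoop innerMean
  refine (Finset.measurable_sum _ fun n _ => hf.comp
    ((Finset.measurable_sum _ fun m _ => ?_).const_mul _)).const_mul _
  exact hG.1.comp ((hy n).prodMk (hx m))

theorem measurable_scrambled (S : SobolData d₁) (n : ℕ) :
    Measurable fun b : Fin d₁ × List Bool → Bool => S.scrambled b n :=
  measurable_pointOfDigits.comp (measurable_scrambleDigits _)

end

/-! ### The variance of the finest difference -/

section

variable {d : ℕ}

/-- The factor of the growth constant in the error bound. -/
noncomputable def errorFactor (S : SobolData d) (a ε : ℝ) (N : ℕ) : ℝ :=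
  errorConst S a * geomConst ε ^ d * (N : ℝ) ^ (a + ε - 1)

theorem errorConst_nonneg (S : SobolData d) {a : ℝ} (ha0 : 0 < a) (ha : a < 1 / 2) :
    0 ≤ errorConst S a := by
  have h1 := one_le_geomConst ha0
  have h2 := one_le_geomConst (δ := 1 / 2 - a) (by linarith)
  unfold errorConst blockConst
  positivity

theorem errorFactor_nonneg (S : SobolData d) {a ε : ℝ} (ha0 : 0 < a) (ha : a < 1 / 2) (hε : 0 < ε)
    (N : ℕ) : 0 ≤ errorFactor S a ε N := by
  have h1 := errorConst_nonneg S ha0 ha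
  have h2 := one_le_geomConst hε
  unfold errorFactor
  positivity

theorem eLpNorm_error_le_of_decomposition (S : SobolData d) {F φ₁ φ₂ φ₃ φ₄ : (Fin d → ℝ) → ℝ}
    {c₁ c₂ c₃ c₄ ε : ℝ} {A₁ A₂ : Fin d → ℝ} (hA₁ : 0 < maxExp A₁ ∧ maxExp A₁ < 1 / 2)
    (hA₂ : 0 < maxExp A₂ ∧ maxExp A₂ < 1 / 2) (hc₁ : 0 ≤ c₁) (hc₂ : 0 ≤ c₂) (hc₃ : 0 ≤ c₃)
    (hc₄ : 0 ≤ c₄) (h₁ : BoundaryGrowth φ₁ c₁ A₁) (h₂ : BoundaryGrowth φ₂ c₂ A₂)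
    (h₃ : BoundaryGrowth φ₃ c₃ A₁) (h₄ : BoundaryGrowth φ₄ c₄ A₂)
    (hF : ∀ y ∈ openCube d, F y = φ₁ y + φ₂ y - φ₃ y - φ₄ y) (hε : 0 < ε) {N : ℕ} (hN : 1 ≤ N) :
    Integrable (fun b => F (pointOfDigits (scrambleDigits b 0))) (scrLaw d) ∧
    eLpNorm (fun b => 1 / (N : ℝ) * ∑ n ∈ Finset.range N, F (S.scrambled b n) - cubeMean F) 2
      (scrLaw d) ≤
      ENNReal.ofReal ((c₁ + c₃) * errorFactor S (maxExp A₁) ε N +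
        (c₂ + c₄) * errorFactor S (maxExp A₂) ε N) := by
  have i₁ := h₁.integrable hc₁ hA₁.1.le (by linarith [hA₁.2]) 0
  have i₂ := h₂.integrable hc₂ hA₂.1.le (by linarith [hA₂.2]) 0
  have i₃ := h₃.integrable hc₃ hA₁.1.le (by linarith [hA₁.2]) 0
  have i₄ := h₄.integrable hc₄ hA₂.1.le (by linarith [hA₂.2]) 0
  have e₁ := eLpNorm_error_le S hA₁.1 hA₁.2 hc₁ h₁ hε hN
  have e₂ := eLpNorm_error_le S hA₂.1 hA₂.2 hc₂ h₂ hε hN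
  have e₃ := eLpNorm_error_le S hA₁.1 hA₁.2 hc₃ h₃ hε hN
  have e₄ := eLpNorm_error_le S hA₂.1 hA₂.2 hc₄ h₄ hε hN
  have hae : (fun b => φ₁ (pointOfDigits (scrambleDigits b 0)) +
      φ₂ (pointOfDigits (scrambleDigits b 0)) - φ₃ (pointOfDigits (scrambleDigits b 0)) -
      φ₄ (pointOfDigits (scrambleDigits b 0))) =ᵐ[scrLaw d]
      fun b => F (pointOfDigits (scrambleDigits b 0)) := by
    filter_upwards [ae_mem_openCube 0] with b hb using (hF _ hb).symm
  have hint := ((i₁.add i₂).sub i₃).sub i₄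
  refine ⟨hint.congr hae, ?_⟩
  have hmean : cubeMean F = cubeMean φ₁ + cubeMean φ₂ - cubeMean φ₃ - cubeMean φ₄ := by
    unfold cubeMean
    rw [← integral_congr_ae hae]
    refine (integral_sub ((i₁.add i₂).sub i₃) i₄).trans ?_
    congr 1
    refine (integral_sub (i₁.add i₂) i₃).trans ?_
    congr 1
    exact integral_add i₁ i₂
  set E : ((Fin d → ℝ) → ℝ) → (Fin d × List Bool → Bool) → ℝ := fun φ b =>
    1 / (N : ℝ) * ∑ n ∈ Finset.range N, φ (S.scrambled b n) - cubeMean φ with hE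
  have hsum : (fun b => 1 / (N : ℝ) * ∑ n ∈ Finset.range N, F (S.scrambled b n) - cubeMean F)
      =ᵐ[scrLaw d] E φ₁ + E φ₂ - E φ₃ - E φ₄ := by
    filter_upwards [ae_all_iff.2 fun n => ae_mem_openCube (S.digits n)] with b hb
    simp only [Pi.sub_apply, Pi.add_apply, hE, hmean]
    rw [Finset.sum_congr rfl fun n _ => hF (S.scrambled b n) (hb n)]
    simp only [Finset.sum_sub_distrib, Finset.sum_add_distrib]
    ring
  have hm : ∀ {φ : (Fin d → ℝ) → ℝ}, ContinuousOn φ (openCube d) →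
      AEStronglyMeasurable (E φ) (scrLaw d) := by
    intro φ hφ
    refine AEStronglyMeasurable.sub ?_ aestronglyMeasurable_const
    refine AEStronglyMeasurable.const_mul ?_ _
    exact Finset.aestronglyMeasurable_fun_sum _ fun n _ => aestronglyMeasurable_comp_point hφ _
  have m₁ := hm h₁.continuousOn
  have m₂ := hm h₂.continuousOn
  have m₃ := hm h₃.continuousOn
  have m₄ := hm h₄.continuousOn
  rw [eLpNorm_congr_ae hsum]
  have f₁ := errorFactor_nonneg S hA₁.1 hA₁.2 hε N
  have f₂ := errorFactor_nonneg S hA₂.1 hA₂.2 hε N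
  have hconv : ∀ c a : ℝ, c * errorConst S a * geomConst ε ^ d * (N : ℝ) ^ (a + ε - 1) =
      c * errorFactor S a ε N := fun c a => by rw [errorFactor]; ring
  simp only [hconv] at e₁ e₂ e₃ e₄
  calc eLpNorm (E φ₁ + E φ₂ - E φ₃ - E φ₄) 2 (scrLaw d)
      ≤ eLpNorm (E φ₁) 2 (scrLaw d) + eLpNorm (E φ₂) 2 (scrLaw d) + eLpNorm (E φ₃) 2 (scrLaw d) +
        eLpNorm (E φ₄) 2 (scrLaw d) := by
        refine (eLpNorm_sub_le ((m₁.add m₂).sub m₃) m₄ (by norm_num)).trans ?_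
        gcongr
        refine (eLpNorm_sub_le (m₁.add m₂) m₃ (by norm_num)).trans ?_
        gcongr
        exact eLpNorm_add_le m₁ m₂ (by norm_num)
    _ ≤ ENNReal.ofReal (c₁ * errorFactor S (maxExp A₁) ε N) +
        ENNReal.ofReal (c₂ * errorFactor S (maxExp A₂) ε N) +
        ENNReal.ofReal (c₃ * errorFactor S (maxExp A₁) ε N) +
        ENNReal.ofReal (c₄ * errorFactor S (maxExp A₂) ε N) := by gcongr
    _ = _ := by
        rw [← ENNReal.ofReal_add (by positivity) (by positivity),
          ← ENNReal.ofReal_add (by positivity) (by positivity),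
          ← ENNReal.ofReal_add (by positivity) (by positivity)]
        congr 1
        ring

/-- Only values are compared here, without any gain from cancellation, so integrability of the
weight, that is exponents below one, is enough. -/
theorem abs_cubeMean_sub_le {F F' : (Fin d → ℝ) → ℝ}
    (hF : Integrable (fun b => F (pointOfDigits (scrambleDigits b 0))) (scrLaw d))
    (hF' : Integrable (fun b => F' (pointOfDigits (scrambleDigits b 0))) (scrLaw d))
    {k₃ k₄ : ℝ} (hk₃ : 0 ≤ k₃) (hk₄ : 0 ≤ k₄) {A₃ A₄ : Fin d → ℝ}
    (hA₃ : 0 < maxExp A₃ ∧ maxExp A₃ < 1) (hA₄ : 0 < maxExp A₄ ∧ maxExp A₄ < 1)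
    (h : ∀ y ∈ openCube d, |F y - F' y| ≤ k₃ * edgeWeight A₃ ∅ y + k₄ * edgeWeight A₄ ∅ y) :
    |cubeMean F - cubeMean F'| ≤
      k₃ * (2 * powBound (maxExp A₃)) ^ d + k₄ * (2 * powBound (maxExp A₄)) ^ d := by
  have w₃ := integrable_edgeWeight (d := d) hA₃.1.le hA₃.2 0
  have w₄ := integrable_edgeWeight (d := d) hA₄.1.le hA₄.2 0
  unfold cubeMean
  rw [← integral_sub hF hF', ← Real.norm_eq_abs]
  refine (norm_integral_le_of_norm_le ((w₃.const_mul k₃).add (w₄.const_mul k₄)) ?_).trans ?_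
  · filter_upwards [ae_mem_openCube 0] with b hb
    refine (h _ hb).trans ?_
    exact add_le_add (mul_le_mul_of_nonneg_left (edgeWeight_le A₃ ∅ hb) hk₃)
      (mul_le_mul_of_nonneg_left (edgeWeight_le A₄ ∅ hb) hk₄)
  · simp only [Pi.add_apply]
    rw [integral_add (w₃.const_mul k₃) (w₄.const_mul k₄), integral_const_mul, integral_const_mul]
    exact add_le_add (mul_le_mul_of_nonneg_left (integral_edgeWeight_le hA₃.1.le hA₃.2 0) hk₃)
      (mul_le_mul_of_nonneg_left (integral_edgeWeight_le hA₄.1.le hA₄.2 0) hk₄)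

end

theorem AdmissibleIntegrand.measurable_doubleLoop_prod {d₁ d₂ : ℕ} {U : Set ℝ}
    {G : (Fin d₁ → ℝ) → (Fin d₂ → ℝ) → ℝ} (hG : AdmissibleIntegrand U G) {f : ℝ → ℝ}
    (hf : Measurable f) (N M : ℕ) {α β : Type*} [MeasurableSpace α] [MeasurableSpace β]
    {y : α → ℕ → Fin d₁ → ℝ} {x : β → ℕ → Fin d₂ → ℝ} (hy : ∀ n, Measurable fun b => y b n)
    (hx : ∀ m, Measurable fun r => x r m) :
    Measurable fun q : α × β => doubleLoop f G N M (y q.1) (x q.2) := by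
  have h₁ : ∀ n, Measurable fun q : α × β => y q.1 n := fun n =>
    Measurable.comp (g := fun b => y b n) (hy n) measurable_fst
  have h₂ : ∀ n, Measurable fun q : α × β => x q.2 n := fun n =>
    Measurable.comp (g := fun r => x r n) (hx n) measurable_snd
  exact hG.measurable_doubleLoop hf N M (y := fun q : α × β => y q.1)
    (x := fun q : α × β => x q.2) h₁ h₂

theorem measurable_doubleLoop_point {d₁ d₂ : ℕ} (S₁ : SobolData d₁) (x : ℕ → Fin d₂ → ℝ)
    {U : Set ℝ} {G : (Fin d₁ → ℝ) → (Fin d₂ → ℝ) → ℝ} (hG : AdmissibleIntegrand U G) {f : ℝ → ℝ}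
    (hf : Measurable f) (N M : ℕ) :
    Measurable fun b : Fin d₁ × List Bool → Bool => doubleLoop f G N M (S₁.scrambled b) x :=
  hG.measurable_doubleLoop hf N M (y := fun b => S₁.scrambled b) (x := fun _ => x)
    (fun n => measurable_scrambled S₁ n) fun _ => measurable_const

-- Given the inner scrambling, the distance of the difference to a constant `c` splits into the
-- outer sampling error, at most `r₁` in `L²`, and the drift of the conditional mean away from `c`,
-- at most `r₂`.
set_option maxHeartbeats 600000 in
theorem variance_finest_le {d₁ d₂ : ℕ} (S₁ : SobolData d₁) (S₂ : SobolData d₂) {N ML MC : ℕ}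
    (hN : 1 ≤ N) (hML : 0 < ML) (hMC : 0 < MC) {U : Set ℝ} (hU : IsOpen U) (hUc : Convex ℝ U)
    {f : ℝ → ℝ} (hf : ContDiffOn ℝ 2 f U) {g Gf Gc : (Fin d₁ → ℝ) → (Fin d₂ → ℝ) → ℝ}
    (hg : AdmissibleIntegrand U g) (hGf : AdmissibleIntegrand U Gf)
    (hGc : AdmissibleIntegrand U Gc) {Ω : Type*} [MeasurableSpace Ω] (P : Measure Ω)
    [IsProbabilityMeasure P] {τ : Fin d₁ × List Bool → Ω → Bool}
    {ρ : Fin d₂ × List Bool → Ω → Bool} (hfair : IsFairBits (Sum.elim τ ρ) P)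
    {ε c₁ c₂ c₃ c₄ k₃ k₄ : ℝ} (hε : 0 < ε) (hc₁ : 0 ≤ c₁) (hc₂ : 0 ≤ c₂) (hc₃ : 0 ≤ c₃)
    (hc₄ : 0 ≤ c₄) (hk₃ : 0 ≤ k₃) (hk₄ : 0 ≤ k₄) {A₁ A₂ A₃ A₄ : Fin d₁ → ℝ}
    (hA₁ : 0 < maxExp A₁ ∧ maxExp A₁ < 1 / 2) (hA₂ : 0 < maxExp A₂ ∧ maxExp A₂ < 1 / 2)
    (hA₃ : 0 < maxExp A₃ ∧ maxExp A₃ < 1) (hA₄ : 0 < maxExp A₄ ∧ maxExp A₄ < 1)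
    (hC₁ : BoundaryGrowth (linearPart f (innerIntegral g) (innerMean Gc MC S₂.point)) c₃ A₁)
    (hC₂ : BoundaryGrowth (remainderPart f (innerIntegral g) (innerMean Gc MC S₂.point)) c₄ A₂)
    (hL₁ : ∀ᵐ ω ∂P, BoundaryGrowth (linearPart f (innerIntegral g)
      (innerMean Gf ML (S₂.scrambled fun q => ρ q ω))) c₁ A₁)
    (hL₂ : ∀ᵐ ω ∂P, BoundaryGrowth (remainderPart f (innerIntegral g)
      (innerMean Gf ML (S₂.scrambled fun q => ρ q ω))) c₂ A₂)
    (hL₃ : ∀ᵐ ω ∂P, ValueGrowth (linearPart f (innerIntegral Gf)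
      (innerMean Gf ML (S₂.scrambled fun q => ρ q ω))) k₃ A₃)
    (hL₄ : ∀ᵐ ω ∂P, ValueGrowth (remainderPart f (innerIntegral Gf)
      (innerMean Gf ML (S₂.scrambled fun q => ρ q ω))) k₄ A₄)
    {X : Ω → ℝ} (hX : X = fun ω =>
      doubleLoop f Gf N ML (S₁.scrambled fun q => τ q ω) (S₂.scrambled fun q => ρ q ω) -
        doubleLoop f Gc N MC (S₁.scrambled fun q => τ q ω) S₂.point) :
    MemLp X 2 P ∧ variance X P ≤
      ((c₁ + c₃) * errorFactor S₁ (maxExp A₁) ε N + (c₂ + c₄) * errorFactor S₁ (maxExp A₂) ε N +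
        2 * (k₃ * (2 * powBound (maxExp A₃)) ^ d₁ + k₄ * (2 * powBound (maxExp A₄)) ^ d₁)) ^ 2 := by
  classical
  have hxL : ∀ r m, S₂.scrambled r m ∈ Set.Icc (0 : Fin d₂ → ℝ) 1 := fun r m =>
    pointOfDigits_mem_Icc _
  have hxC : ∀ m, S₂.point m ∈ Set.Icc (0 : Fin d₂ → ℝ) 1 := fun m => pointOfDigits_mem_Icc _
  let F : Ω → (Fin d₁ → ℝ) → ℝ := fun ω y =>
    f (innerMean Gf ML (S₂.scrambled fun q => ρ q ω) y) - f (innerMean Gc MC S₂.point y)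
  have hdec : ∀ ω, ∀ y ∈ openCube d₁, F ω y =
      linearPart f (innerIntegral g) (innerMean Gf ML (S₂.scrambled fun q => ρ q ω)) y +
      remainderPart f (innerIntegral g) (innerMean Gf ML (S₂.scrambled fun q => ρ q ω)) y -
      linearPart f (innerIntegral g) (innerMean Gc MC S₂.point) y -
      remainderPart f (innerIntegral g) (innerMean Gc MC S₂.point) y := by
    intro ω y hy
    have h1 := taylor_linearPart_remainderPart hU hUc hf (c := innerIntegral g)
      (hg.innerIntegral_mem hUc hy)
      (hGf.innerMean_mem hUc hy hML (hxL fun q => ρ q ω))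
    have h2 := taylor_linearPart_remainderPart hU hUc hf (c := innerIntegral g)
      (hg.innerIntegral_mem hUc hy) (hGc.innerMean_mem hUc hy hMC hxC)
    simp only [F]
    linarith
  have hmean : ∀ ω, BoundaryGrowth (linearPart f (innerIntegral g)
      (innerMean Gf ML (S₂.scrambled fun q => ρ q ω))) c₁ A₁ →
      BoundaryGrowth (remainderPart f (innerIntegral g)
      (innerMean Gf ML (S₂.scrambled fun q => ρ q ω))) c₂ A₂ → _ := fun ω h₁ h₂ =>
    eLpNorm_error_le_of_decomposition S₁ hA₁ hA₂ hc₁ hc₂ hc₃ hc₄ h₁ h₂ hC₁ hC₂ (hdec ω) hε hN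
  -- A reference scrambling with all the almost sure bounds; its conditional mean serves as the
  -- constant `c`.
  obtain ⟨ω₀, ⟨⟨h₁₀, h₂₀⟩, h₃₀⟩, h₄₀⟩ := (((hL₁.and hL₂).and hL₃).and hL₄).exists
  set c := cubeMean (F ω₀) with hc
  set r₁ := (c₁ + c₃) * errorFactor S₁ (maxExp A₁) ε N +
    (c₂ + c₄) * errorFactor S₁ (maxExp A₂) ε N with hr₁
  set r₂ := 2 * (k₃ * (2 * powBound (maxExp A₃)) ^ d₁ + k₄ * (2 * powBound (maxExp A₄)) ^ d₁)
    with hr₂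
  have hr₁0 : 0 ≤ r₁ := by
    have f₁ := errorFactor_nonneg S₁ hA₁.1 hA₁.2 hε N
    have f₂ := errorFactor_nonneg S₁ hA₂.1 hA₂.2 hε N
    positivity
  have hr₂0 : 0 ≤ r₂ := by
    have p₃ := powBound_pos hA₃.2
    have p₄ := powBound_pos hA₄.2
    positivity
  have hH : ∀ ω, ValueGrowth (linearPart f (innerIntegral Gf)
      (innerMean Gf ML (S₂.scrambled fun q => ρ q ω))) k₃ A₃ →
      ValueGrowth (remainderPart f (innerIntegral Gf)
      (innerMean Gf ML (S₂.scrambled fun q => ρ q ω))) k₄ A₄ → ∀ y ∈ openCube d₁,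
      |f (innerMean Gf ML (S₂.scrambled fun q => ρ q ω) y) - f (innerIntegral Gf y)| ≤
        k₃ * edgeWeight A₃ ∅ y + k₄ * edgeWeight A₄ ∅ y := by
    intro ω h₃ h₄ y hy
    rw [taylor_linearPart_remainderPart hU hUc hf (c := innerIntegral Gf)
      (hGf.innerIntegral_mem hUc hy)
      (hGf.innerMean_mem hUc hy hML (hxL fun q => ρ q ω))]
    exact (abs_add_le _ _).trans (add_le_add (h₃ y hy) (h₄ y hy))
  -- Off `U` nothing is known about `f`. This extension is measurable, as Tonelli's theorem
  -- requires, and changes nothing when the outer points lie in the open cube.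
  set f' : ℝ → ℝ := U.piecewise f 0 with hf'
  have hf'm : Measurable f' :=
    hf.continuousOn.measurable_piecewise continuousOn_const hU.measurableSet
  let Z : (Fin d₁ × List Bool → Bool) × (Fin d₂ × List Bool → Bool) → ℝ := fun q =>
    doubleLoop f' Gf N ML (S₁.scrambled q.1) (S₂.scrambled q.2) -
      doubleLoop f' Gc N MC (S₁.scrambled q.1) S₂.point - c
  have hZ : Measurable Z := by
    have h₁ : Measurable
        (Prod.fst : (Fin d₁ × List Bool → Bool) × (Fin d₂ × List Bool → Bool) → _) := measurable_fst
    exact ((hGf.measurable_doubleLoop_prod hf'm N ML (measurable_scrambled S₁) (measurable_scrambled S₂)).sub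
      ((measurable_doubleLoop_point S₁ S₂.point hGc hf'm N MC).comp h₁)).sub_const c
  have hZeq : ∀ b r, (∀ n, S₁.scrambled b n ∈ openCube d₁) → Z (b, r) =
      doubleLoop f Gf N ML (S₁.scrambled b) (S₂.scrambled r) -
        doubleLoop f Gc N MC (S₁.scrambled b) S₂.point - c := by
    intro b r hb
    have h1 : ∀ n, f' (innerMean Gf ML (S₂.scrambled r) (S₁.scrambled b n)) =
        f (innerMean Gf ML (S₂.scrambled r) (S₁.scrambled b n)) := fun n =>
      Set.piecewise_eq_of_mem _ _ _ (hGf.innerMean_mem hUc (hb n) hML (hxL r))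
    have h2 : ∀ n, f' (innerMean Gc MC S₂.point (S₁.scrambled b n)) =
        f (innerMean Gc MC S₂.point (S₁.scrambled b n)) := fun n =>
      Set.piecewise_eq_of_mem _ _ _ (hGc.innerMean_mem hUc (hb n) hMC hxC)
    simp only [Z, doubleLoop, h1, h2]
  have hcube : ∀ᵐ b ∂scrLaw d₁, ∀ n, S₁.scrambled b n ∈ openCube d₁ :=
    ae_all_iff.2 fun n => ae_mem_openCube (S₁.digits n)
  have hτm : Measurable fun ω q => τ q ω := measurable_pi_lambda _ fun i => hfair.1 (Sum.inl i)
  have hρm : Measurable fun ω q => ρ q ω := measurable_pi_lambda _ fun i => hfair.1 (Sum.inr i)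
  have hmap := hfair.map_prod
  have hτlaw : P.map (fun ω q => τ q ω) = scrLaw d₁ := by
    have hp : IsProbabilityMeasure (P.map fun ω q => ρ q ω) :=
      Measure.isProbabilityMeasure_map hρm.aemeasurable
    have h1 := congrArg (Measure.map Prod.fst) hmap
    rw [Measure.map_map measurable_fst (hτm.prodMk hρm), Measure.map_fst_prod, measure_univ,
      one_smul] at h1
    exact h1
  have hcond : ∀ᵐ ω ∂P, eLpNorm (fun b => Z (b, fun q => ρ q ω)) 2 (scrLaw d₁) ≤
      ENNReal.ofReal (r₁ + r₂) := by
    filter_upwards [hL₁, hL₂, hL₃, hL₄] with ω h₁ h₂ h₃ h₄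
    obtain ⟨hint, herr⟩ := hmean ω h₁ h₂
    have hae : (fun b => Z (b, fun q => ρ q ω)) =ᵐ[scrLaw d₁] fun b =>
        (1 / (N : ℝ) * ∑ n ∈ Finset.range N, F ω (S₁.scrambled b n) - cubeMean (F ω)) +
          (cubeMean (F ω) - c) := by
      filter_upwards [hcube] with b hb
      rw [hZeq b _ hb]
      simp only [doubleLoop, F, Finset.sum_sub_distrib]
      ring
    -- Between two inner scramblings the deterministic coarse term cancels. Both fine terms are
    -- compared with `f` at the inner integral of `Gf`, once for each scrambling, whence the factor
    -- 2.
    have hdiff : |cubeMean (F ω) - c| ≤ r₂ := by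
      have := abs_cubeMean_sub_le hint (hmean ω₀ h₁₀ h₂₀).1 (k₃ := 2 * k₃) (k₄ := 2 * k₄)
        (by positivity) (by positivity) hA₃ hA₄ (fun y hy => by
          have e1 := hH ω h₃ h₄ y hy
          have e2 := hH ω₀ h₃₀ h₄₀ y hy
          have e3 : F ω y - F ω₀ y =
              (f (innerMean Gf ML (S₂.scrambled fun q => ρ q ω) y) - f (innerIntegral Gf y)) -
              (f (innerMean Gf ML (S₂.scrambled fun q => ρ q ω₀) y) - f (innerIntegral Gf y)) := by
            simp only [F]; ring
          rw [e3]
          refine (abs_sub _ _).trans ?_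
          linarith)
      refine this.trans (le_of_eq ?_)
      rw [hr₂]; ring
    rw [eLpNorm_congr_ae hae]
    have hm : AEStronglyMeasurable (fun b => 1 / (N : ℝ) *
        ∑ n ∈ Finset.range N, F ω (S₁.scrambled b n) - cubeMean (F ω)) (scrLaw d₁) := by
      have h5 : AEStronglyMeasurable (fun b => Z (b, fun q => ρ q ω)) (scrLaw d₁) :=
        (hZ.comp (measurable_id.prodMk measurable_const)).aestronglyMeasurable
      have h6 := (h5.congr hae).sub
        (aestronglyMeasurable_const (b := cubeMean (F ω) - c) (μ := scrLaw d₁))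
      refine h6.congr (Eventually.of_forall fun b => ?_)
      simp
    refine (eLpNorm_add_le hm aestronglyMeasurable_const (by norm_num)).trans ?_
    rw [ENNReal.ofReal_add hr₁0 hr₂0]
    refine add_le_add herr ?_
    rw [eLpNorm_const _ (by norm_num) (IsProbabilityMeasure.ne_zero _), measure_univ,
      ENNReal.one_rpow, mul_one, ← ofReal_norm]
    exact ENNReal.ofReal_le_ofReal hdiff
  have hfinal := eLpNorm_two_le_of_conditional hτm hρm hmap hZ hcond
  have hcubeP : ∀ᵐ ω ∂P, ∀ n, S₁.scrambled (fun q => τ q ω) n ∈ openCube d₁ :=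
    ae_of_ae_map hτm.aemeasurable (hτlaw ▸ hcube)
  have hXZ : (fun ω => Z (fun q => τ q ω, fun q => ρ q ω)) =ᵐ[P] fun ω => X ω - c := by
    filter_upwards [hcubeP] with ω hω
    rw [hZeq _ _ hω, hX]
  rw [eLpNorm_congr_ae hXZ] at hfinal
  have hXm : AEStronglyMeasurable X P := by
    have h5 : AEStronglyMeasurable (fun ω => Z (fun q => τ q ω, fun q => ρ q ω)) P :=
      (hZ.comp (hτm.prodMk hρm)).aestronglyMeasurable
    have h6 := (h5.congr hXZ).add (aestronglyMeasurable_const (b := c) (μ := P))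
    refine h6.congr (Eventually.of_forall fun ω => ?_)
    simp
  exact variance_le_of_eLpNorm_sub hXm (by positivity) hfinal

/-! ### The constants and the final bound -/

theorem tendsto_geomConst : Tendsto geomConst (𝓝[>] 0) atTop := by
  unfold geomConst
  refine tendsto_inv_nhdsGT_zero.comp (tendsto_nhdsWithin_iff.2 ⟨?_, ?_⟩)
  · have h : ContinuousAt (fun δ : ℝ => 1 - (2 : ℝ) ^ (-δ)) 0 := by
      refine continuousAt_const.sub (ContinuousAt.rpow continuousAt_const continuousAt_neg ?_)
      exact Or.inl two_ne_zero
    have h' := h.tendsto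
    simp only [neg_zero, Real.rpow_zero, sub_self] at h'
    exact h'.mono_left nhdsWithin_le_nhds
  · filter_upwards [self_mem_nhdsWithin] with δ hδ
    have : (2 : ℝ) ^ (-δ) < 1 :=
      Real.rpow_lt_one_of_one_lt_of_neg one_lt_two (neg_lt_zero.2 hδ)
    exact sub_pos.2 this

/-- The constant attached to the vector of exponents. -/
noncomputable def exponentConst {d : ℕ} (S : SobolData d) (A : Fin d → ℝ) : ℝ :=
  -- The coefficients 2 and 3 absorb the numerical factors 2 and 8 after squaring, the 1 gives
  -- positivity, and the last summand forces divergence as the smallest exponent tends to zero from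
  -- above.
  1 + 2 * |errorConst S (maxExp A)| + 3 * |(2 * powBound (maxExp A)) ^ d| + |(⨅ i, A i)⁻¹|

theorem exponentConst_pos {d : ℕ} (S : SobolData d) (A : Fin d → ℝ) : 0 < exponentConst S A := by
  unfold exponentConst
  positivity

theorem tendsto_exponentConst {d : ℕ} (S : SobolData d) :
    Tendsto (exponentConst S) (comap (fun A => ⨅ i, A i) (𝓝[>] 0)) atTop := by
  have h₀ : Tendsto (fun A : Fin d → ℝ => (⨅ i, A i)⁻¹) (comap (fun A => ⨅ i, A i) (𝓝[>] 0))
      atTop := tendsto_inv_nhdsGT_zero.comp tendsto_comap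
  refine tendsto_atTop_mono (fun A => ?_) h₀
  have h := le_abs_self (⨅ i, A i)⁻¹
  have h₁ := abs_nonneg (errorConst S (maxExp A))
  have h₂ := abs_nonneg ((2 * powBound (maxExp A)) ^ d)
  unfold exponentConst
  linarith

/-! ### Absorption of numerical factors -/

theorem two_mul_sq_errorConst_le {d : ℕ} (S : SobolData d) (A : Fin d → ℝ) :
    2 * errorConst S (maxExp A) ^ 2 ≤ exponentConst S A ^ 2 := by
  have h : 2 * |errorConst S (maxExp A)| ≤ exponentConst S A := by
    have h₁ := abs_nonneg ((2 * powBound (maxExp A)) ^ d)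
    have h₂ := abs_nonneg (⨅ i, A i)⁻¹
    unfold exponentConst
    linarith
  have h₃ := pow_le_pow_left₀ (by positivity) h 2
  rw [mul_pow, sq_abs] at h₃
  nlinarith [sq_nonneg (errorConst S (maxExp A))]

theorem eight_mul_sq_powBound_le {d : ℕ} (S : SobolData d) (A : Fin d → ℝ) :
    8 * ((2 * powBound (maxExp A)) ^ d) ^ 2 ≤ exponentConst S A ^ 2 := by
  have h : 3 * |(2 * powBound (maxExp A)) ^ d| ≤ exponentConst S A := by
    have h₁ := abs_nonneg (errorConst S (maxExp A))
    have h₂ := abs_nonneg (⨅ i, A i)⁻¹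
    unfold exponentConst
    linarith
  have h₃ := pow_le_pow_left₀ (by positivity) h 2
  rw [mul_pow, sq_abs] at h₃
  nlinarith [sq_nonneg ((2 * powBound (maxExp A)) ^ d)]

/-- Cauchy–Schwarz for four terms: `s` and `t` are the sampling and discretization errors on the
fine level, `α * s` and `β * t` those on the coarse level. -/
theorem sq_sum_levels_le (s t α β : ℝ) :
    (s + t + (α * s + β * t)) ^ 2 ≤ 4 * ((max (α ^ 2) (β ^ 2) + 1) * (s ^ 2 + t ^ 2)) := by
  have h₁ := mul_le_mul_of_nonneg_right (le_max_left (α ^ 2) (β ^ 2)) (sq_nonneg s)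
  have h₂ := mul_le_mul_of_nonneg_right (le_max_right (α ^ 2) (β ^ 2)) (sq_nonneg t)
  nlinarith [sq_nonneg (s - t), sq_nonneg (s - α * s), sq_nonneg (s - β * t),
    sq_nonneg (t - α * s), sq_nonneg (t - β * t), sq_nonneg (α * s - β * t)]

theorem sq_sum_four_le (p q r s : ℝ) :
    (p + q + 2 * (r + s)) ^ 2 ≤ 4 * p ^ 2 + 4 * q ^ 2 + 16 * r ^ 2 + 16 * s ^ 2 := by
  nlinarith [sq_nonneg (p - q), sq_nonneg (p - 2 * r), sq_nonneg (p - 2 * s),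
    sq_nonneg (q - 2 * r), sq_nonneg (q - 2 * s), sq_nonneg (2 * r - 2 * s)]

/-- Two applications of Cauchy–Schwarz give the factor 16: the 8 appears in the conclusion, and the
remaining 2 goes into `exponentConst`. -/
theorem four_mul_sq_errorFactor_le {d : ℕ} (S : SobolData d) (A : Fin d → ℝ) {N : ℕ} (hN : 1 ≤ N)
    (ε s t α β b : ℝ) :
    4 * ((((s + t) * b + (α * s + β * t) * b)) * errorFactor S (maxExp A) ε N) ^ 2 ≤
      (s ^ 2 + t ^ 2) * (8 * (max (α ^ 2) (β ^ 2) + 1) * b ^ 2) * exponentConst S A ^ 2 *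
        (geomConst ε ^ d) ^ 2 / (N : ℝ) ^ (2 - 2 * ε - 2 * maxExp A) := by
  have hN0 : (0 : ℝ) < N := by exact_mod_cast hN
  have hrate : ((N : ℝ) ^ (maxExp A + ε - 1)) ^ 2 =
      ((N : ℝ) ^ (2 - 2 * ε - 2 * maxExp A))⁻¹ := by
    rw [← Real.rpow_natCast, ← Real.rpow_mul hN0.le, ← Real.rpow_neg hN0.le]
    congr 1
    push_cast
    ring
  have h₁ := sq_sum_levels_le s t α β
  have h₂ := two_mul_sq_errorConst_le S A
  rw [div_eq_mul_inv, ← hrate, errorFactor]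
  set W := b ^ 2 * ((geomConst ε ^ d) ^ 2 * ((N : ℝ) ^ (maxExp A + ε - 1)) ^ 2) with hW
  have hW0 : 0 ≤ W := by positivity
  set Q := (max (α ^ 2) (β ^ 2) + 1) * (s ^ 2 + t ^ 2) with hQ
  have hQ0 : 0 ≤ Q := by positivity
  calc _ = 4 * ((s + t + (α * s + β * t)) ^ 2 * (errorConst S (maxExp A) ^ 2 * W)) := by
        rw [hW]; ring
    _ ≤ 4 * (4 * Q * (errorConst S (maxExp A) ^ 2 * W)) := by gcongr
    _ = 8 * Q * (2 * errorConst S (maxExp A) ^ 2 * W) := by ring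
    _ ≤ 8 * Q * (exponentConst S A ^ 2 * W) := by gcongr
    _ = _ := by rw [hW, hQ]; ring

theorem sixteen_mul_sq_powBound_le {d : ℕ} (S : SobolData d) (A : Fin d → ℝ) (k b : ℝ) :
    16 * (k * b * (2 * powBound (maxExp A)) ^ d) ^ 2 ≤
      k ^ 2 * (2 * b ^ 2) * exponentConst S A ^ 2 := by
  have h := eight_mul_sq_powBound_le S A
  calc _ = k ^ 2 * (2 * b ^ 2) * (8 * ((2 * powBound (maxExp A)) ^ d) ^ 2) := by ring
    _ ≤ _ := by gcongr

/-! ### Ratios between consecutive levels -/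

theorem levelM_pos {M₀ : ℕ} (h : 1 ≤ M₀) (ℓ : ℕ) : 0 < levelM M₀ ℓ := by
  unfold levelM
  positivity

theorem levelH_pos {h₀ : ℝ} (h : 0 < h₀) (ℓ : ℕ) : 0 < levelH h₀ ℓ := by
  unfold levelH
  positivity

theorem levelM_eq_two_mul (M₀ : ℕ) {L : ℕ} (hL : 1 ≤ L) :
    levelM M₀ L = 2 * levelM M₀ (L - 1) := by
  obtain ⟨ℓ, rfl⟩ := Nat.exists_eq_add_of_le' hL
  simp only [levelM, Nat.add_sub_cancel, pow_succ]
  ring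

theorem levelH_eq_two_mul (h₀ : ℝ) {L : ℕ} (hL : 1 ≤ L) :
    levelH h₀ (L - 1) = 2 * levelH h₀ L := by
  obtain ⟨ℓ, rfl⟩ := Nat.exists_eq_add_of_le' hL
  simp only [levelH, Nat.add_sub_cancel, pow_succ]
  field_simp

theorem rpow_half_eq {m : ℝ} (hm : 0 < m) (r : ℝ) :
    m ^ (-r) = (2 : ℝ) ^ r * (2 * m) ^ (-r) := by
  rw [Real.mul_rpow two_pos.le hm.le, ← mul_assoc, ← Real.rpow_add two_pos]
  simp

theorem sq_rpow {x : ℝ} (hx : 0 < x) {r s : ℝ} (h : s = 2 * r) : (x ^ r) ^ 2 = x ^ s := by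
  rw [← Real.rpow_natCast, ← Real.rpow_mul hx.le, h]
  congr 1
  push_cast
  ring

theorem mainTheorem3 {d₁ : ℕ} (hd₁ : 0 < d₁) (S₁ : SobolData d₁) :
    -- the constants `C_{ε,d₁}` and `B_A`
    ∃ (C₁ : ℝ → ℝ) (B : (Fin d₁ → ℝ) → ℝ),
      (∀ ε, 0 < ε → 0 < C₁ ε) ∧ Tendsto C₁ (𝓝[>] 0) atTop ∧
      (∀ A, 0 < B A) ∧ Tendsto B (comap (fun A => ⨅ i, A i) (𝓝[>] 0)) atTop ∧
      ∀ {d₂ : ℕ} (_ : 0 < d₂) (S₂ : SobolData d₂)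
        -- the parameters of the estimator
        (L N M₀ : ℕ) (h₀ : ℝ) (_ : 1 ≤ L) (_ : 1 ≤ N) (_ : 1 ≤ M₀) (_ : 0 < h₀)
        -- the integrands
        (U : Set ℝ) (_ : IsOpen U) (_ : Convex ℝ U) (f : ℝ → ℝ) (_ : ContDiffOn ℝ 2 f U)
        (g : (Fin d₁ → ℝ) → (Fin d₂ → ℝ) → ℝ) (gh : ℝ → (Fin d₁ → ℝ) → (Fin d₂ → ℝ) → ℝ)
        (_ : AdmissibleIntegrand U g)
        (_ : ∀ ℓ ≤ L, AdmissibleIntegrand U (gh (levelH h₀ ℓ)))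
        -- the randomizations: independent Owen scramblings of the outer and of the inner points
        {Ω : Type*} [MeasurableSpace Ω] (P : Measure Ω) [IsProbabilityMeasure P]
        (τ : Fin d₁ × List Bool → Ω → Bool) (ρ : Fin d₂ × List Bool → Ω → Bool)
        (_ : IsFairBits (Sum.elim τ ρ) P)
        -- the constants in the growth assumptions
        (ε C₂ η Cη bI bII bIII bIV : ℝ) (_ : 0 < ε) (_ : 0 < C₂) (_ : 0 < η) (_ : 0 < Cη)
        (_ : 0 < bI) (_ : 0 < bII) (_ : 0 < bIII) (_ : 0 < bIV)
        (AI AII AIII AIV : Fin d₁ → ℝ)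
        (_ : 0 < maxExp AI ∧ maxExp AI < 1 / 2) (_ : 0 < maxExp AII ∧ maxExp AII < 1 / 2)
        (_ : 0 < maxExp AIII ∧ maxExp AIII < 1) (_ : 0 < maxExp AIV ∧ maxExp AIV < 1)
        -- the growth assumptions on level `L - 1`, for the Sobol' points
        (_ : GrowthI f g (gh (levelH h₀ (L - 1))) (levelH h₀ (L - 1)) (levelM M₀ (L - 1))
          S₂.point ε C₂ η Cη bI AI)
        (_ : GrowthII f g (gh (levelH h₀ (L - 1))) (levelH h₀ (L - 1)) (levelM M₀ (L - 1))
          S₂.point ε C₂ η Cη bII AII)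
        -- the growth assumptions on level `L`, for the scrambled Sobol' points
        (_ : ∀ᵐ ω ∂P, GrowthI f g (gh (levelH h₀ L)) (levelH h₀ L) (levelM M₀ L)
          (S₂.scrambled fun q => ρ q ω) ε C₂ η Cη bI AI)
        (_ : ∀ᵐ ω ∂P, GrowthII f g (gh (levelH h₀ L)) (levelH h₀ L) (levelM M₀ L)
          (S₂.scrambled fun q => ρ q ω) ε C₂ η Cη bII AII)
        (_ : ∀ᵐ ω ∂P, GrowthIII f (gh (levelH h₀ L)) (levelM M₀ L)
          (S₂.scrambled fun q => ρ q ω) ε C₂ bIII AIII)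
        (_ : ∀ᵐ ω ∂P, GrowthIV f (gh (levelH h₀ L)) (levelM M₀ L)
          (S₂.scrambled fun q => ρ q ω) ε C₂ bIV AIV)
        (M h : ℝ) (_ : M = levelM M₀ L) (_ : h = levelH h₀ L)
        (X : Ω → ℝ)
        (_ : X = fun ω =>
          finestDifference S₁ S₂ f gh L N M₀ h₀ (fun q => τ q ω) (fun q => ρ q ω)),
        MemLp X 2 P ∧
        variance X P ≤
          (C₂ ^ 2 / M ^ (2 - 2 * ε) + Cη ^ 2 * h ^ (2 * η)) *
              (8 * (max ((2 : ℝ) ^ (2 - 2 * ε)) ((2 : ℝ) ^ (2 * η)) + 1) * bI ^ 2) *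
              B AI ^ 2 * C₁ ε ^ 2 / (N : ℝ) ^ (2 - 2 * ε - 2 * maxExp AI) +
            (C₂ ^ 4 / M ^ (4 - 4 * ε) + Cη ^ 4 * h ^ (4 * η)) *
              (8 * (max ((2 : ℝ) ^ (4 - 4 * ε)) ((2 : ℝ) ^ (4 * η)) + 1) * bII ^ 2) *
              B AII ^ 2 * C₁ ε ^ 2 / (N : ℝ) ^ (2 - 2 * ε - 2 * maxExp AII) +
            C₂ ^ 2 * (2 * bIII ^ 2) * B AIII ^ 2 / M ^ (2 - 2 * ε) +
            C₂ ^ 4 * (2 * bIV ^ 2) * B AIV ^ 2 / M ^ (4 - 4 * ε) := by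
  refine ⟨fun ε => geomConst ε ^ d₁, exponentConst S₁, fun ε hε => ?_, ?_, exponentConst_pos S₁,
    tendsto_exponentConst S₁, ?_⟩
  · have := one_le_geomConst hε
    positivity
  · exact (tendsto_pow_atTop hd₁.ne').comp tendsto_geomConst
  intro d₂ _ S₂ L N M₀ h₀ hL hN hM₀ hh₀ U hU hUc f hf g gh hg hgh Ω _ P _ τ ρ hfair ε C₂ η Cη
    bI bII bIII bIV hε hC₂ hη hCη hbI hbII hbIII hbIV AI AII AIII AIV hAI hAII hAIII hAIV
    hI hII hLI hLII hLIII hLIV M h hM hh X hX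
  have hm := levelM_pos hM₀ (L - 1)
  have hml := levelM_pos hM₀ L
  have hM0 : 0 < M := by rw [hM]; exact_mod_cast hml
  have hh0 : 0 < h := hh ▸ levelH_pos hh₀ L
  have hm0 : (0 : ℝ) < levelM M₀ (L - 1) := by exact_mod_cast hm
  have hMm : M = 2 * (levelM M₀ (L - 1) : ℝ) := by
    rw [hM, levelM_eq_two_mul M₀ hL]
    push_cast
    rfl
  -- The coarse level has half the samples and twice the step size, so its bounds are those of level
  -- `L` times powers of 2; these become the maxima in the conclusion.
  have eM₁ : (levelM M₀ (L - 1) : ℝ) ^ (-1 + ε) = (2 : ℝ) ^ (1 - ε) * M ^ (-1 + ε) := by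
    have := rpow_half_eq hm0 (1 - ε)
    rwa [← hMm, neg_sub, sub_eq_neg_add] at this
  have eM₂ : (levelM M₀ (L - 1) : ℝ) ^ (-2 + 2 * ε) =
      (2 : ℝ) ^ (2 - 2 * ε) * M ^ (-2 + 2 * ε) := by
    have := rpow_half_eq hm0 (2 - 2 * ε)
    rwa [← hMm, neg_sub, sub_eq_neg_add] at this
  have eH : ∀ r : ℝ, levelH h₀ (L - 1) ^ r = (2 : ℝ) ^ r * h ^ r := fun r => by
    rw [levelH_eq_two_mul h₀ hL, ← hh, Real.mul_rpow two_pos.le hh0.le]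
  have hHL := levelH_pos hh₀ L
  have hHC := levelH_pos hh₀ (L - 1)
  have key := variance_finest_le S₁ S₂ hN hml hm hU hUc hf hg (hgh L le_rfl)
    (hgh (L - 1) (Nat.sub_le L 1)) P hfair hε (by positivity) (by positivity) (by positivity)
    (by positivity) (by positivity) (by positivity) hAI hAII hAIII hAIV hI hII hLI hLII hLIII
    hLIV hX
  refine ⟨key.1, key.2.trans ?_⟩
  rw [← hM, ← hh, eM₁, eM₂, eH, eH]
  refine (sq_sum_four_le _ _ _ _).trans ?_
  refine add_le_add (add_le_add (add_le_add ?_ ?_) ?_) ?_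
  · have h₁ := four_mul_sq_errorFactor_le S₁ AI hN ε (C₂ * M ^ (-1 + ε)) (Cη * h ^ η)
      ((2 : ℝ) ^ (1 - ε)) ((2 : ℝ) ^ η) bI
    rw [mul_pow C₂, mul_pow Cη, sq_rpow hM0 (s := -(2 - 2 * ε)) (by ring),
      sq_rpow hh0 (s := 2 * η) (by ring), sq_rpow two_pos (s := 2 - 2 * ε) (by ring),
      sq_rpow two_pos (s := 2 * η) (by ring), Real.rpow_neg hM0.le, ← div_eq_mul_inv] at h₁
    refine le_trans (le_of_eq ?_) h₁
    ring
  · have h₁ := four_mul_sq_errorFactor_le S₁ AII hN ε (C₂ ^ 2 * M ^ (-2 + 2 * ε))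
      (Cη ^ 2 * h ^ (2 * η)) ((2 : ℝ) ^ (2 - 2 * ε)) ((2 : ℝ) ^ (2 * η)) bII
    rw [mul_pow (C₂ ^ 2), mul_pow (Cη ^ 2), sq_rpow hM0 (s := -(4 - 4 * ε)) (by ring),
      sq_rpow hh0 (s := 4 * η) (by ring), sq_rpow two_pos (s := 4 - 4 * ε) (by ring),
      sq_rpow two_pos (s := 4 * η) (by ring), Real.rpow_neg hM0.le, ← div_eq_mul_inv,
      ← pow_mul, ← pow_mul] at h₁
    refine le_trans (le_of_eq ?_) h₁
    ring
  · refine (sixteen_mul_sq_powBound_le S₁ AIII _ _).trans (le_of_eq ?_)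
    rw [mul_pow C₂, sq_rpow hM0 (s := -(2 - 2 * ε)) (by ring), Real.rpow_neg hM0.le]
    ring
  · refine (sixteen_mul_sq_powBound_le S₁ AIV _ _).trans (le_of_eq ?_)
    rw [mul_pow (C₂ ^ 2), sq_rpow hM0 (s := -(4 - 4 * ε)) (by ring), Real.rpow_neg hM0.le]
    ring
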